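/- Conventions. A metric measure space $(X,d,\mu)$ is a metric space with a (Borel regular) Borel measure for which every ball $B(x,r)=\{y: d(x,y)<r\}$, $r>0$, has finite and positive measure. It is Ahlfors $n$-regular if there are constants $0<C_1\le 1\le C_2$ such that $C_1\lambda^{n}\mu(B(x,r))\le\mu(B(x,\lambda r))\le C_2\lambda^{n}\mu(B(x,r))$ for all $x\in X$, $0<r<2\operatorname{diam}X$ and $1\le\lambda<2\operatorname{diam}X/r$. "Measurable" means $\mu$-measurable (equal $\mu$-almost everywhere to a Borel function). For $s\in(0,\infty)$ and a measurable $u:X\to\mathbb R$, let $\mathbb D^s(u)$ be the set of all sequences $\vec g=\{g_k\}_{k\in\mathbb Z}$ of measurable functions $g_k:X\to[0,\infty)$ for which there is $E\subset X$ with $\mu(E)=0$ such that $$|u(x)-u(y)|\le d(x,y)^s\,[g_k(x)+g_k(y)]\quad\text{for all }k\in\mathbb Z,\ x,y\in X\setminus E\text{ with }2^{-k-1}\le d(x,y)<2^{-k}.$$ For $p\in(0,\infty)$ and $q\in(0,\infty]$, $\dot M^s_{p,q}(X)$ is the space of all measurable $u:X\to\mathbb R$ with $$\|u\|_{\dot M^s_{p,q}(X)}=\inf_{\vec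 g\in\mathbb D^s(u)}\Big\|\,\|\{g_k\}_{k\in\mathbb Z}\|_{\ell^q}\Big\|_{L^p(X)}<\infty .$$ A homeomorphism $f:X\to Y$ is quasisymmetric if there is a homeomorphism $\eta:[0,\infty)\to[0,\infty)$ with $\frac{d_Y(f(x),f(a))}{d_Y(f(x),f(b))}\le\eta\Big(\frac{d_X(x,a)}{d_X(x,b)}\Big)$ for all $a,b,x\in X$ with $x\ne b$. It is absolutely continuous if $\mu_X(E)=0$ implies $\mu_Y(f(E))=0$. Its volume derivative is $J_f(x)=\lim_{r\to0}\mu_Y(f(B(x,r)))/\mu_X(B(x,r))$ (the upper limit is taken at points where the limit does not exist). For $r\in(1,\infty]$, $\mathcal B_r(X)$ is the class of $w:X\to[0,\infty]$ for which there is a finite constant $C$ such that, for every ball $B\subset X$, $\Big(\frac1{\mu(B)}\int_B w^r\,d\mu\Big)^{1/r}\le\frac{C}{\mu(B)}\int_B w\,d\mu$, where the left-hand side is $\operatorname{ess\,sup}_B w$ if $r=\infty$. Corollary 5.2. Let $n_1,n_2\in(0,\infty)$, and let $X$ and $Y$ be Ahlfors $n_1$-regular and Ahlfors $n_2$-regular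 metric measure spaces, respectively. Let $f$ be a quasisymmetric mapping from $X$ onto $Y$ such that $f$ and $f^{-1}$ are absolutely continuous and $J_f\in\mathcal B_r(X)$ for some $r\in(1,\infty]$. Let $s_1\in(0,n_1)$ and $s_2\in(0,n_2)$ satisfy $n_1/s_1=n_2/s_2$, and let $q\in(0,\infty]$. Then $f$ and $f^{-1}$ induce bounded composition operators between $\dot M^{s_1}_{n_1/s_1,q}(X)$ and $\dot M^{s_2}_{n_2/s_2,q}(Y)$: there is a finite constant $C$ such that (a) for every $u\in\dot M^{s_2}_{n_2/s_2,q}(Y)$, $u\circ f\in\dot M^{s_1}_{n_1/s_1,q}(X)$ and $\|u\circ f\|_{\dot M^{s_1}_{n_1/s_1,q}(X)}\le C\,\|u\|_{\dot M^{s_2}_{n_2/s_2,q}(Y)}$; (b) for every $v\in\dot M^{s_1}_{n_1/s_1,q}(X)$, $v\circ f^{-1}\in\dot M^{s_2}_{n_2/s_2,q}(Y)$ and $\|v\circ f^{-1}\|_{\dot M^{s_2}_{n_2/s_2,q}(Y)}\le C\,\|v\|_{\dot M^{s_1}_{n_1/s_1,q}(X)}$. -/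

import Mathlib

open MeasureTheory Set Filter Topology Metric
open scoped NNReal ENNReal

noncomputable section

namespace HajlaszTL

section OneSpace

variable {X : Type*} [MetricSpace X] [MeasurableSpace X]

/-- All balls (of positive radius) have finite and positive measure. Together with `BorelSpace X`
this says that `(X, d, μ)` is a metric measure space; a Mathlib measure on a Borel space is
automatically Borel regular (every set lies in a Borel set of the same measure). -/
def BallsFinitePos (μ : Measure X) : Prop :=
  ∀ (x : X) (r : ℝ), 0 < r → 0 < μ (ball x r) ∧ μ (ball x r) < ∞

/-- Ahlfors `n`-regularity: there are constants `0 < C₁ ≤ 1 ≤ C₂` with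
`C₁ t ^ n μ(B(x, r)) ≤ μ(B(x, t r)) ≤ C₂ t ^ n μ(B(x, r))` for all `x`, all `0 < r < 2 diam X`
and all `1 ≤ t < 2 diam X / r`. The diameter is extended-valued (infinite if `X` is unbounded). -/
def AhlforsRegular (n : ℝ) (μ : Measure X) : Prop :=
  ∃ C₁ C₂ : ℝ, 0 < C₁ ∧ C₁ ≤ 1 ∧ 1 ≤ C₂ ∧
    ∀ (x : X) (r t : ℝ), 0 < r → ENNReal.ofReal r < 2 * ediam (univ : Set X) →
      1 ≤ t → ENNReal.ofReal (t * r) < 2 * ediam (univ : Set X) →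
        ENNReal.ofReal (C₁ * t ^ n) * μ (ball x r) ≤ μ (ball x (t * r)) ∧
        μ (ball x (t * r)) ≤ ENNReal.ofReal (C₂ * t ^ n) * μ (ball x r)

/-- The class of weights satisfying the reverse Hölder inequality of order `r ∈ (1, ∞]`:
with one finite constant `C`, for all balls `B`,
`(⨍_B w ^ r) ^ (1 / r) ≤ C ⨍_B w`, the left side being `esssup_B w` when `r = ∞`. -/
def ReverseHolder (r : ℝ≥0∞) (μ : Measure X) (w : X → ℝ≥0∞) : Prop :=
  ∃ C : ℝ≥0, ∀ (x : X) (ρ : ℝ), 0 < ρ →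
    (if r = ∞ then essSup w (μ.restrict (ball x ρ))
      else (⨍⁻ y in ball x ρ, w y ^ r.toReal ∂μ) ^ (1 / r.toReal))
      ≤ C * ⨍⁻ y in ball x ρ, w y ∂μ

/-- `g = (g k)` is a fractional `s`-Hajłasz gradient of `u`: the `g k` are nonnegative
`μ`-measurable functions, and off one `μ`-null set `E`,
`|u x - u y| ≤ d(x, y) ^ s (g k x + g k y)` whenever `2 ^ (-k-1) ≤ d(x, y) < 2 ^ (-k)`. -/
def IsFracHajlaszGradient (s : ℝ) (μ : Measure X) (u : X → ℝ) (g : ℤ → X → ℝ≥0) : Prop :=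
  (∀ k, AEMeasurable (g k) μ) ∧
  ∃ E : Set X, μ E = 0 ∧ ∀ (k : ℤ) (x y : X), x ∉ E → y ∉ E →
    (2 : ℝ) ^ (-k - 1) ≤ dist x y → dist x y < (2 : ℝ) ^ (-k) →
      |u x - u y| ≤ dist x y ^ s * ((g k x : ℝ) + (g k y : ℝ))

/-- The `ℓ^q` (quasi-)norm of a nonnegative sequence indexed by `ℤ`, for `q ∈ (0, ∞]`. -/
def ellNorm (q : ℝ≥0∞) (a : ℤ → ℝ≥0) : ℝ≥0∞ :=
  if q = ∞ then ⨆ k, (a k : ℝ≥0∞) else (∑' k, (a k : ℝ≥0∞) ^ q.toReal) ^ (1 / q.toReal)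

/-- The `L^p(X, ℓ^q)` (quasi-)norm, for `p ∈ (0, ∞)` and `q ∈ (0, ∞]`. -/
def mixedNorm (p : ℝ) (q : ℝ≥0∞) (μ : Measure X) (g : ℤ → X → ℝ≥0) : ℝ≥0∞ :=
  (∫⁻ x, ellNorm q (fun k => g k x) ^ p ∂μ) ^ (1 / p)

/-- The homogeneous Hajłasz-Triebel-Lizorkin (quasi-)seminorm, for `s, p ∈ (0, ∞)` and
`q ∈ (0, ∞]`. -/
def hajlaszTLNorm (s p : ℝ) (q : ℝ≥0∞) (μ : Measure X) (u : X → ℝ) : ℝ≥0∞ :=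
  ⨅ (g : ℤ → X → ℝ≥0) (_ : IsFracHajlaszGradient s μ u g), mixedNorm p q μ g

/-- The homogeneous Hajłasz-Triebel-Lizorkin space: `μ`-measurable functions of finite
seminorm. -/
def MSpace (s p : ℝ) (q : ℝ≥0∞) (μ : Measure X) : Set (X → ℝ) :=
  {u | AEMeasurable u μ ∧ hajlaszTLNorm s p q μ u < ∞}

end OneSpace

section TwoSpaces

variable {X Y : Type*} [MetricSpace X] [MetricSpace Y]

/-- A homeomorphism `f` is quasisymmetric if, for some homeomorphism `η` of `[0, ∞)`,
`d(f x, f a) / d(f x, f b) ≤ η (d(x, a) / d(x, b))` for all `a, b, x` with `x ≠ b`. -/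
def Quasisymmetric (f : X ≃ₜ Y) : Prop :=
  ∃ η : ℝ≥0 ≃ₜ ℝ≥0, ∀ a b x : X, x ≠ b →
    nndist (f x) (f a) / nndist (f x) (f b) ≤ η (nndist x a / nndist x b)

variable [MeasurableSpace X] [MeasurableSpace Y]

/-- Absolute continuity of a map between measure spaces: null sets have null images. -/
def AbsContMap (μ : Measure X) (ν : Measure Y) (f : X → Y) : Prop :=
  ∀ E : Set X, μ E = 0 → ν (f '' E) = 0

/-- The volume derivative `J_f(x) = lim_{r → 0} ν(f(B(x, r))) / μ(B(x, r))`. It is written as an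
upper limit, so that it equals the limit at every point where the limit exists. -/
def volDeriv (μ : Measure X) (ν : Measure Y) (f : X → Y) (x : X) : ℝ≥0∞ :=
  limsup (fun r : ℝ => ν (f '' ball x r) / μ (ball x r)) (𝓝[>] 0)

end TwoSpaces

end HajlaszTL

end

noncomputable section

namespace HajlaszTL

/-! ### Dyadic averages and the dyadic maximal function -/

section Averages

variable {X : Type*} [MetricSpace X] [MeasurableSpace X]

/-! Put p = n₁/s₁ = n₂/s₂, which exceeds 1, let w be the density with respect to μ of the measure A
↦ ν(f(A)), and let G be a gradient of u on Y. If z lies in a ball B of radius ρ and d(z, z') ≲ ρ,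
quasisymmetry and lower regularity of ν give d(f z, f z')^n₂ ≲ ν(f(B)). If moreover z is a good
point, meaning that w(z) is at least a fixed multiple of the mean ν(f(B))/μ(B), the right side is ≲
ρ^n₁ w(z), and the p-th root reads d(f z, f z')^s₂ ≲ ρ^s₁ w(z)^(1/p). So w^(1/p) · G_i∘f, with i
running over the image scales that f can produce at z from the scale j, acts as a gradient of u∘f at
scale j between good points. This pull-back `pullGrad` is bounded in L^p(ℓ^q) by change of
variables, since at a given point each i serves boundedly many j.

Arbitrary points are reached through good ones. The reverse Hölder inequality yields an A_∞
condition, so good points fill a fixed proportion of every ball. In B(x, 2^(-j)) one selects a good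
point that is away from the center, at which the pulled-back gradient is at most a multiple of its
average over the ball, and at which, for large j, u∘f is close to its value at x (approximate
continuity). Telescoping over the scales bounds |u(f x) - u(f y)| by 2^(-k s₁) times a geometrically
weighted sum of averages around x and y (`WeakQS.exists_edist_comp_le`).

The norm of that sum is controlled by a discrete Young inequality and the vector-valued maximal
inequality `exists_lintegral_ellENorm_dyAvg_le`. There the j-th average acts on the j-th function
only, and a power σ may be put inside it; this covers every q > 0 as soon as p > 1.

For the inverse map the density is 1/w∘f⁻¹. The A_∞ condition of w also produces good parts for this
density (`hasGoodParts_symm_of_setLIntegral_le_half`), so the same theorem applies with the roles of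
X and Y exchanged, without a reverse Hölder inequality on Y. -/

/-- Average at scale `2 ^ (-j)`, normalized by the `n`-th power of the radius. -/
def dyAvg (n : ℝ) (μ : Measure X) (j : ℤ) (φ : X → ℝ≥0∞) (x : X) : ℝ≥0∞ :=
  ENNReal.ofReal (((2 : ℝ) ^ (-j)) ^ (-n)) * ∫⁻ y in ball x ((2 : ℝ) ^ (-j)), φ y ∂μ

/-- The maximal function associated with the averages `dyAvg`. -/
def dyMax (n : ℝ) (μ : Measure X) (φ : X → ℝ≥0∞) (x : X) : ℝ≥0∞ := ⨆ j, dyAvg n μ j φ x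

/-- Upper Ahlfors regularity on all balls. -/
def UpperRegular (n : ℝ) (K : ℝ≥0) (μ : Measure X) : Prop :=
  ∀ (x : X) (ρ : ℝ), 0 < ρ → μ (ball x ρ) ≤ K * ENNReal.ofReal (ρ ^ n)

variable {n : ℝ} {K : ℝ≥0} {μ : Measure X}

lemma ofReal_rpow_neg_mul_self (n : ℝ) {ρ : ℝ} (hρ : 0 < ρ) :
    ENNReal.ofReal (ρ ^ (-n)) * ENNReal.ofReal (ρ ^ n) = 1 := by
  rw [← ENNReal.ofReal_mul (by positivity), ← Real.rpow_add hρ]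
  simp

lemma dyAvg_mono {φ ψ : X → ℝ≥0∞} (h : φ ≤ ψ) (j : ℤ) : dyAvg n μ j φ ≤ dyAvg n μ j ψ := by
  intro x
  unfold dyAvg
  gcongr
  exact h _

lemma dyAvg_le_dyMax (j : ℤ) (φ : X → ℝ≥0∞) (x : X) : dyAvg n μ j φ x ≤ dyMax n μ φ x :=
  le_iSup (fun j => dyAvg n μ j φ x) j

lemma dyAvg_congr_ae {φ ψ : X → ℝ≥0∞} (h : φ =ᵐ[μ] ψ) (j : ℤ) (x : X) :
    dyAvg n μ j φ x = dyAvg n μ j ψ x := by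
  unfold dyAvg
  rw [lintegral_congr_ae (ae_restrict_of_ae h)]

lemma dyAvg_const_le (hK : UpperRegular n K μ) (c : ℝ≥0∞) (j : ℤ) (x : X) :
    dyAvg n μ j (fun _ => c) x ≤ K * c := by
  unfold dyAvg
  have h2 : (0 : ℝ) < 2 ^ (-j) := by positivity
  rw [setLIntegral_const]
  calc _ ≤ ENNReal.ofReal (((2 : ℝ) ^ (-j)) ^ (-n)) *
        (c * (K * ENNReal.ofReal (((2 : ℝ) ^ (-j)) ^ n))) := by gcongr; exact hK x _ h2
    _ = K * c * (ENNReal.ofReal (((2 : ℝ) ^ (-j)) ^ (-n)) *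
        ENNReal.ofReal (((2 : ℝ) ^ (-j)) ^ n)) := by ring
    _ = K * c := by rw [ofReal_rpow_neg_mul_self n h2, mul_one]

/-- Hölder's inequality for the averages. -/
lemma dyAvg_mul_le {a b : ℝ} (ha : 0 ≤ a) (hb : 0 ≤ b) (hab : a + b = 1) {φ ψ : X → ℝ≥0∞}
    (hφ : Measurable φ) (hψ : Measurable ψ) (j : ℤ) (x : X) :
    dyAvg n μ j (fun y => φ y ^ a * ψ y ^ b) x ≤ dyAvg n μ j φ x ^ a * dyAvg n μ j ψ x ^ b := by
  unfold dyAvg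
  set c := ENNReal.ofReal (((2 : ℝ) ^ (-j)) ^ (-n))
  have hc : c = c ^ a * c ^ b := by
    rw [← ENNReal.rpow_add_of_nonneg _ _ ha hb, hab, ENNReal.rpow_one]
  rw [ENNReal.mul_rpow_of_nonneg _ _ ha, ENNReal.mul_rpow_of_nonneg _ _ hb]
  calc _ ≤ c * ((∫⁻ y in ball x (2 ^ (-j)), φ y ∂μ) ^ a *
        (∫⁻ y in ball x (2 ^ (-j)), ψ y ∂μ) ^ b) := by
        gcongr
        exact ENNReal.lintegral_mul_norm_pow_le hφ.aemeasurable hψ.aemeasurable ha hb hab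
    _ = (c ^ a * c ^ b) * ((∫⁻ y in ball x (2 ^ (-j)), φ y ∂μ) ^ a *
        (∫⁻ y in ball x (2 ^ (-j)), ψ y ∂μ) ^ b) := by rw [← hc]
    _ = _ := by ring

lemma dyAvg_add_le {φ ψ : X → ℝ≥0∞} (hφ : Measurable φ) (j : ℤ) (x : X) :
    dyAvg n μ j (fun y => φ y + ψ y) x ≤ dyAvg n μ j φ x + dyAvg n μ j ψ x := by
  unfold dyAvg
  rw [lintegral_add_left hφ, mul_add]

variable [BorelSpace X] [SecondCountableTopology X]

lemma measurable_indicator_ball {φ : X → ℝ≥0∞} (hφ : Measurable φ) (r : ℝ) :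
    Measurable fun p : X × X => (ball p.1 r).indicator φ p.2 := by
  have hs : MeasurableSet {p : X × X | dist p.2 p.1 < r} :=
    measurableSet_lt (measurable_snd.dist measurable_fst) measurable_const
  exact (hφ.comp measurable_snd).indicator hs

/-- The weak type `(1, 1)` inequality for the dyadic maximal function. -/
lemma mul_measure_dyMax_gt_le (hK : UpperRegular n K μ) {φ : X → ℝ≥0∞}
    (t : ℝ≥0∞) :
    t * μ {x | t < dyMax n μ φ x} ≤ K * ENNReal.ofReal (4 ^ n) * ∫⁻ x, φ x ∂μ := by
  -- Bounding j from below bounds the radii 2^(-j) by 2^N, as the Vitali covering lemma requires;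
  -- the sets increase with N.
  have hE : {x | t < dyMax n μ φ x} = ⋃ N : ℕ, {x | ∃ j : ℤ, -(N : ℤ) ≤ j ∧ t < dyAvg n μ j φ x} := by
    ext x
    simp only [dyMax, lt_iSup_iff, mem_ofPred_eq, mem_iUnion]
    constructor
    · rintro ⟨j, hj⟩
      exact ⟨j.natAbs, j, by omega, hj⟩
    · rintro ⟨N, j, -, hj⟩
      exact ⟨j, hj⟩
  rw [hE, Monotone.measure_iUnion, ENNReal.mul_iSup]
  swap
  · rintro N M hNM x ⟨j, hj, h⟩
    exact ⟨j, by omega, h⟩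
  refine iSup_le fun N => ?_
  set E := {x | ∃ j : ℤ, -(N : ℤ) ≤ j ∧ t < dyAvg n μ j φ x}
  have hex : ∀ x, ∃ j : ℤ, x ∈ E → -(N : ℤ) ≤ j ∧ t < dyAvg n μ j φ x := by
    intro x
    by_cases hx : x ∈ E
    · obtain ⟨j, hj⟩ := hx
      exact ⟨j, fun _ => hj⟩
    · exact ⟨0, fun h => absurd h hx⟩
  choose J hJ using hex
  obtain ⟨u, huE, hdisj, hcov⟩ := Vitali.exists_disjoint_subfamily_covering_enlargement_ball E
    (fun x => x) (fun x => (2 : ℝ) ^ (-J x)) ((2 : ℝ) ^ (N : ℤ))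
    (fun x hx => zpow_le_zpow_right₀ (by norm_num) (by have := (hJ x hx).1; omega)) 4 (by norm_num)
  have hpos : ∀ x, (0 : ℝ) < 2 ^ (-J x) := fun x => by positivity
  have hu : u.Countable := hdisj.countable_of_isOpen (fun _ _ => isOpen_ball)
    (fun x _ => nonempty_ball.2 (hpos x))
  have hball : ∀ b ∈ u, t * μ (ball b (4 * 2 ^ (-J b))) ≤
      K * ENNReal.ofReal (4 ^ n) * ∫⁻ y in ball b (2 ^ (-J b)), φ y ∂μ := by
    intro b hb
    have h1 := (hJ b (huE hb)).2.le
    have h2 : t * ENNReal.ofReal ((2 ^ (-J b)) ^ n) ≤ ∫⁻ y in ball b (2 ^ (-J b)), φ y ∂μ := by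
      calc _ ≤ dyAvg n μ (J b) φ b * ENNReal.ofReal ((2 ^ (-J b)) ^ n) := by gcongr
        _ = (ENNReal.ofReal ((2 ^ (-J b)) ^ (-n)) * ENNReal.ofReal ((2 ^ (-J b)) ^ n)) *
            ∫⁻ y in ball b (2 ^ (-J b)), φ y ∂μ := by unfold dyAvg; ring
        _ = _ := by rw [ofReal_rpow_neg_mul_self n (hpos b), one_mul]
    calc _ ≤ t * (K * ENNReal.ofReal ((4 * 2 ^ (-J b)) ^ n)) := by
          gcongr; exact hK _ _ (by have := hpos b; positivity)
      _ = K * ENNReal.ofReal (4 ^ n) * (t * ENNReal.ofReal ((2 ^ (-J b)) ^ n)) := by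
          rw [Real.mul_rpow (by norm_num) (hpos b).le, ENNReal.ofReal_mul (by positivity)]; ring
      _ ≤ _ := by gcongr
  have hsub : E ⊆ ⋃ b ∈ u, ball b (4 * 2 ^ (-J b)) := by
    intro x hx
    obtain ⟨b, hb, h⟩ := hcov x hx
    exact mem_biUnion hb (h (mem_ball_self (hpos x)))
  calc t * μ E ≤ t * ∑' b : u, μ (ball (b : X) (4 * 2 ^ (-J b))) := by
        gcongr
        exact (measure_mono hsub).trans (measure_biUnion_le μ hu _)
    _ = ∑' b : u, t * μ (ball (b : X) (4 * 2 ^ (-J b))) := by rw [ENNReal.tsum_mul_left]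
    _ ≤ ∑' b : u, K * ENNReal.ofReal (4 ^ n) * ∫⁻ y in ball (b : X) (2 ^ (-J b)), φ y ∂μ :=
        ENNReal.tsum_le_tsum fun b => hball b b.2
    _ = K * ENNReal.ofReal (4 ^ n) * ∫⁻ y in ⋃ b ∈ u, ball b (2 ^ (-J b)), φ y ∂μ := by
        rw [ENNReal.tsum_mul_left, lintegral_biUnion hu (fun _ _ => measurableSet_ball) hdisj]
    _ ≤ _ := by gcongr; exact Measure.restrict_le_self

variable [SigmaFinite μ]

lemma measurable_dyAvg {φ : X → ℝ≥0∞} (hφ : Measurable φ) (j : ℤ) :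
    Measurable (dyAvg n μ j φ) := by
  unfold dyAvg
  refine Measurable.const_mul ?_ _
  simp_rw [← lintegral_indicator measurableSet_ball]
  exact (measurable_indicator_ball hφ _).lintegral_prod_right'

lemma measurable_dyMax {φ : X → ℝ≥0∞} (hφ : Measurable φ) : Measurable (dyMax n μ φ) :=
  Measurable.iSup fun j => measurable_dyAvg hφ j

/-- The averages are self-adjoint. -/
lemma lintegral_dyAvg_mul {φ ψ : X → ℝ≥0∞} (hφ : Measurable φ) (hψ : Measurable ψ) (j : ℤ) :
    ∫⁻ x, dyAvg n μ j φ x * ψ x ∂μ = ∫⁻ x, φ x * dyAvg n μ j ψ x ∂μ := by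
  unfold dyAvg
  simp_rw [← lintegral_indicator measurableSet_ball]
  set c := ENNReal.ofReal (((2 : ℝ) ^ (-j)) ^ (-n))
  set r : ℝ := (2 : ℝ) ^ (-j)
  have hm1 := measurable_indicator_ball hφ r
  have hm2 := measurable_indicator_ball hψ r
  have e1 : ∀ x, (c * ∫⁻ y, (ball x r).indicator φ y ∂μ) * ψ x =
      ∫⁻ y, c * (ball x r).indicator φ y * ψ x ∂μ := by
    intro x
    have : Measurable fun y => (ball x r).indicator φ y := hφ.indicator measurableSet_ball
    rw [← lintegral_const_mul _ this, ← lintegral_mul_const _ (this.const_mul c)]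
  have e2 : ∀ x, φ x * (c * ∫⁻ y, (ball x r).indicator ψ y ∂μ) =
      ∫⁻ y, φ x * (c * (ball x r).indicator ψ y) ∂μ := by
    intro x
    have : Measurable fun y => (ball x r).indicator ψ y := hψ.indicator measurableSet_ball
    rw [← lintegral_const_mul _ this, ← lintegral_const_mul _ (this.const_mul c)]
  simp_rw [e1, e2]
  rw [lintegral_lintegral_swap]
  · refine lintegral_congr fun y => lintegral_congr fun x => ?_
    by_cases h : dist y x < r
    · have h1 : y ∈ ball x r := h
      have h2 : x ∈ ball y r := by rwa [mem_ball_comm]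
      rw [indicator_of_mem h1, indicator_of_mem h2]; ring
    · have h1 : y ∉ ball x r := h
      have h2 : x ∉ ball y r := by rwa [mem_ball_comm]
      rw [indicator_of_notMem h1, indicator_of_notMem h2]; simp
  · exact ((hm1.const_mul c).mul (hψ.comp measurable_fst)).aemeasurable

/-- By self-adjointness this is dual to the bound for averages of the constant 1. -/
lemma lintegral_dyAvg_le (hK : UpperRegular n K μ) {φ : X → ℝ≥0∞} (hφ : Measurable φ) (j : ℤ) :
    ∫⁻ x, dyAvg n μ j φ x ∂μ ≤ K * ∫⁻ x, φ x ∂μ := by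
  have := lintegral_dyAvg_mul (n := n) (μ := μ) hφ (measurable_const (a := (1 : ℝ≥0∞))) j
  simp only [mul_one] at this
  rw [this, mul_comm, ← lintegral_mul_const _ hφ]
  refine lintegral_mono fun x => ?_
  gcongr
  simpa using dyAvg_const_le hK 1 j x

end Averages

/-! ### Geometric series and dyadic layer-cake sums -/

section GeometricSums

lemma two_rpow_add (a b : ℝ) : (2 : ℝ≥0∞) ^ (a + b) = 2 ^ a * 2 ^ b :=
  ENNReal.rpow_add _ _ (by norm_num) (by norm_num)

lemma two_rpow_ne_zero (a : ℝ) : (2 : ℝ≥0∞) ^ a ≠ 0 := by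
  simp [ENNReal.rpow_eq_zero_iff]

lemma two_rpow_ne_top (a : ℝ) : (2 : ℝ≥0∞) ^ a ≠ ∞ := by
  simp [ENNReal.rpow_eq_top_iff]

lemma two_rpow_lt_one {s : ℝ} (hs : 0 < s) : (2 : ℝ≥0∞) ^ (-s) < 1 :=
  ENNReal.rpow_lt_one_of_one_lt_of_neg (by norm_num) (by linarith)

/-- The sum of the geometric series of ratio `2 ^ (-s)`. -/
def geomConst (s : ℝ) : ℝ≥0∞ := (1 - 2 ^ (-s))⁻¹

lemma geomConst_ne_top {s : ℝ} (hs : 0 < s) : geomConst s ≠ ∞ :=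
  ENNReal.inv_ne_top.2 (tsub_pos_of_lt (two_rpow_lt_one hs)).ne'

lemma tsum_two_rpow_neg (s : ℝ) : ∑' l : ℕ, (2 : ℝ≥0∞) ^ (-(l * s)) = geomConst s := by
  rw [geomConst, ← ENNReal.tsum_geometric]
  congr 1 with l
  rw [← ENNReal.rpow_natCast, ← ENNReal.rpow_mul]
  congr 1; ring

lemma exists_two_rpow_lt_le {b : ℝ≥0∞} (h0 : b ≠ 0) (ht : b ≠ ∞) :
    ∃ i : ℤ, (2 : ℝ≥0∞) ^ (i : ℝ) < b ∧ b ≤ 2 ^ ((i : ℝ) + 1) := by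
  obtain ⟨i, hi⟩ := ENNReal.exists_mem_Ioc_zpow h0 ht (by norm_num : (1 : ℝ≥0∞) < 2) (by norm_num)
  refine ⟨i, ?_, ?_⟩
  · rw [ENNReal.rpow_intCast]; exact hi.1
  · have := hi.2
    rw [← ENNReal.rpow_intCast] at this
    push_cast at this
    exact this

/-- The sum is a geometric series descending from the largest i with 2^i < b. -/
lemma tsum_two_rpow_lt_le {s : ℝ} (hs : 0 < s) (b : ℝ≥0∞) :
    ∑' i : ℤ, (if (2 : ℝ≥0∞) ^ (i : ℝ) < b then (2 : ℝ≥0∞) ^ (i * s) else 0) ≤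
      geomConst s * b ^ s := by
  rcases eq_or_ne b 0 with rfl | h0
  · simp
  have hg : geomConst s ≠ 0 := ENNReal.inv_ne_zero.2 (by simp)
  rcases eq_or_ne b ∞ with rfl | ht
  · simp [ENNReal.top_rpow_of_pos hs, ENNReal.mul_top hg]
  obtain ⟨k, hk1, hk2⟩ := exists_two_rpow_lt_le h0 ht
  have hlt : ∀ i : ℤ, (2 : ℝ≥0∞) ^ (i : ℝ) < b → i ≤ k := by
    intro i hi
    have := hi.trans_le hk2
    by_contra! hc
    have h3 : ((k : ℝ) + 1) ≤ i := by exact_mod_cast hc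
    exact absurd this (not_lt.2 (ENNReal.rpow_le_rpow_of_exponent_le (by norm_num) h3))
  have hinj : Function.Injective fun l : ℕ => k - (l : ℤ) := fun a b h => by simpa using h
  rw [← hinj.tsum_eq]
  · calc _ ≤ ∑' l : ℕ, 2 ^ (k * s) * (2 : ℝ≥0∞) ^ (-(l * s)) := by
          refine ENNReal.tsum_le_tsum fun l => ?_
          split_ifs
          · rw [← two_rpow_add]
            apply le_of_eq; congr 1; push_cast; ring
          · exact zero_le
      _ = geomConst s * (2 ^ (k : ℝ)) ^ s := by
          rw [ENNReal.tsum_mul_left, tsum_two_rpow_neg, mul_comm, ENNReal.rpow_mul]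
      _ ≤ _ := by gcongr
  · intro i hi
    have : (2 : ℝ≥0∞) ^ (i : ℝ) < b := by
      by_contra hc
      simp only [Function.mem_support, if_neg hc, ne_eq, not_true] at hi
    refine ⟨(k - i).toNat, ?_⟩
    have := hlt i this
    simp only; omega

/-- Half of a dyadic layer-cake formula: for finite nonzero a, the single term with 2^i < a ≤
2^(i+1) already suffices. -/
lemma rpow_le_tsum_two_rpow {P : ℝ} (hP : 0 < P) (a : ℝ≥0∞) :
    a ^ P ≤ ∑' i : ℤ, (if (2 : ℝ≥0∞) ^ (i : ℝ) < a then (2 : ℝ≥0∞) ^ ((i + 1) * P) else 0) := by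
  rcases eq_or_ne a 0 with rfl | h0
  · simp [hP]
  rcases eq_or_ne a ∞ with rfl | ht
  · have hinj : Function.Injective fun l : ℕ => (l : ℤ) := fun a b h => by simpa using h
    refine le_trans ?_ (ENNReal.tsum_comp_le_tsum_of_injective hinj _)
    refine le_trans ?_ (ENNReal.tsum_le_tsum (f := fun _ => (1 : ℝ≥0∞)) fun l => ?_)
    · rw [ENNReal.tsum_const_eq_top_of_ne_zero one_ne_zero]; exact le_top
    · rw [if_pos (two_rpow_ne_top _).lt_top]
      exact ENNReal.one_le_rpow (by norm_num) (by push_cast; positivity)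
  · obtain ⟨k, hk1, hk2⟩ := exists_two_rpow_lt_le h0 ht
    refine le_trans ?_ (ENNReal.le_tsum k)
    rw [if_pos hk1, ENNReal.rpow_mul]
    gcongr

end GeometricSums

/-! ### Strong type bound for the dyadic maximal function -/

section Maximal

variable {X : Type*} [MetricSpace X] [MeasurableSpace X] [BorelSpace X]
  [SecondCountableTopology X] {n : ℝ} {K : ℝ≥0} {μ : Measure X}

/-- The values of φ up to t/(2K) contribute at most t/2 to any average, so the weak type inequality
at height t/2 need only see the larger values. Marcinkiewicz interpolation uses this truncated form.
-/
lemma measure_dyMax_gt_le (hK : UpperRegular n K μ) (hK1 : 1 ≤ K) {φ : X → ℝ≥0∞}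
    (hφ : Measurable φ) {t : ℝ≥0∞} (h0 : t ≠ 0) (ht : t ≠ ∞) :
    μ {x | t < dyMax n μ φ x} ≤ 2 * (K * ENNReal.ofReal (4 ^ n)) * t⁻¹ *
      ∫⁻ x, (if t < 2 * K * φ x then φ x else 0) ∂μ := by
  have hK0 : (K : ℝ≥0∞) ≠ 0 := by
    have : K ≠ 0 := by intro h; rw [h] at hK1; norm_num at hK1
    exact_mod_cast this
  have hS : MeasurableSet {x | t < 2 * K * φ x} :=
    measurableSet_lt measurable_const (hφ.const_mul _)
  set ψ : X → ℝ≥0∞ := fun x => if t < 2 * K * φ x then φ x else 0 with hψ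
  have hψm : Measurable ψ := Measurable.ite hS hφ measurable_const
  have hle : ∀ x, dyMax n μ φ x ≤ dyMax n μ ψ x + t / 2 := by
    intro x
    refine iSup_le fun j => ?_
    have h1 : φ ≤ fun x => ψ x + t / (2 * K) := by
      intro x
      simp only [hψ]
      split_ifs with h
      · exact le_self_add
      · rw [zero_add, ENNReal.le_div_iff_mul_le (by simp [hK0]) (by simp [ENNReal.mul_eq_top])]
        rw [mul_comm]; exact not_lt.1 h
    refine (dyAvg_mono h1 j x).trans ((dyAvg_add_le hψm j x).trans ?_)
    gcongr
    · exact dyAvg_le_dyMax j ψ x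
    · refine (dyAvg_const_le hK _ j x).trans (le_of_eq ?_)
      rw [← mul_div_assoc, mul_comm, ENNReal.mul_div_mul_right _ _ hK0 ENNReal.coe_ne_top]
  have hsub : {x | t < dyMax n μ φ x} ⊆ {x | t / 2 < dyMax n μ ψ x} := by
    intro x hx
    by_contra hc
    have h2 : dyMax n μ ψ x ≤ t / 2 := not_lt.1 hc
    have : dyMax n μ φ x ≤ t := (hle x).trans ((add_le_add_left h2 _).trans (by simp))
    exact absurd hx (not_lt.2 this)
  have hw := mul_measure_dyMax_gt_le hK (φ := ψ) (t / 2)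
  calc _ ≤ μ {x | t / 2 < dyMax n μ ψ x} := measure_mono hsub
    _ = 2 * t⁻¹ * (t / 2 * μ {x | t / 2 < dyMax n μ ψ x}) := by
        rw [← mul_assoc, ENNReal.div_eq_inv_mul]
        have : 2 * t⁻¹ * (2⁻¹ * t) = (2 * 2⁻¹) * (t⁻¹ * t) := by ring
        rw [this, ENNReal.inv_mul_cancel h0 ht, ENNReal.mul_inv_cancel (by norm_num) (by norm_num)]
        simp
    _ ≤ 2 * t⁻¹ * (K * ENNReal.ofReal (4 ^ n) * ∫⁻ x, ψ x ∂μ) := by gcongr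
    _ = _ := by ring

variable [SigmaFinite μ]

/-- The dyadic maximal function is bounded on `L ^ P`, `P > 1`. -/
theorem exists_lintegral_dyMax_rpow_le (hK : UpperRegular n K μ) (hK1 : 1 ≤ K)
    {P : ℝ} (hP : 1 < P) :
    ∃ C : ℝ≥0∞, C ≠ ∞ ∧ ∀ φ : X → ℝ≥0∞, Measurable φ →
      ∫⁻ x, dyMax n μ φ x ^ P ∂μ ≤ C * ∫⁻ x, φ x ^ P ∂μ := by
  have hP1 : 0 < P - 1 := by linarith
  have hP0 : 0 < P := by linarith
  set D : ℝ≥0∞ := 2 * (K * ENNReal.ofReal (4 ^ n)) with hD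
  refine ⟨D * 2 ^ P * geomConst (P - 1) * (2 * K) ^ (P - 1), ?_, fun φ hφ => ?_⟩
  · have : D ≠ ∞ := by finiteness
    have := geomConst_ne_top hP1
    have := two_rpow_ne_top P
    have : ((2 : ℝ≥0∞) * K) ^ (P - 1) ≠ ∞ := ENNReal.rpow_ne_top_of_nonneg hP1.le (by finiteness)
    finiteness
  have hM := measurable_dyMax (n := n) (μ := μ) hφ
  have hm1 : ∀ i : ℤ, Measurable fun x => if (2 : ℝ≥0∞) ^ (i : ℝ) < dyMax n μ φ x then
      (2 : ℝ≥0∞) ^ ((i + 1) * P) else 0 := fun i =>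
    Measurable.ite (measurableSet_lt measurable_const hM) measurable_const measurable_const
  have hm2 : ∀ i : ℤ, Measurable fun x => if (2 : ℝ≥0∞) ^ (i : ℝ) < 2 * K * φ x then φ x else 0 :=
    fun i => Measurable.ite (measurableSet_lt measurable_const (hφ.const_mul _)) hφ
      measurable_const
  calc ∫⁻ x, dyMax n μ φ x ^ P ∂μ
      ≤ ∫⁻ x, ∑' i : ℤ, (if (2 : ℝ≥0∞) ^ (i : ℝ) < dyMax n μ φ x then
        (2 : ℝ≥0∞) ^ ((i + 1) * P) else 0) ∂μ :=
        lintegral_mono fun x => rpow_le_tsum_two_rpow hP0 _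
    _ = ∑' i : ℤ, (2 : ℝ≥0∞) ^ ((i + 1) * P) * μ {x | (2 : ℝ≥0∞) ^ (i : ℝ) < dyMax n μ φ x} := by
        rw [lintegral_tsum fun i => (hm1 i).aemeasurable]
        congr 1 with i
        rw [← setLIntegral_const, ← lintegral_indicator (measurableSet_lt measurable_const hM)]
        refine lintegral_congr fun x => ?_
        simp only [indicator, mem_ofPred_eq]
    _ ≤ ∑' i : ℤ, ∫⁻ x, D * 2 ^ P * (2 ^ (i * (P - 1)) *
          (if (2 : ℝ≥0∞) ^ (i : ℝ) < 2 * K * φ x then φ x else 0)) ∂μ := by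
        refine ENNReal.tsum_le_tsum fun i => ?_
        rw [lintegral_const_mul _ ((hm2 i).const_mul _), lintegral_const_mul _ (hm2 i)]
        refine (mul_le_mul_right (measure_dyMax_gt_le hK hK1 hφ (two_rpow_ne_zero i)
          (two_rpow_ne_top i)) _).trans (le_of_eq ?_)
        rw [← ENNReal.rpow_neg, ← hD]
        have : (2 : ℝ≥0∞) ^ ((i + 1) * P) * 2 ^ (-(i : ℝ)) = 2 ^ P * 2 ^ (i * (P - 1)) := by
          rw [← two_rpow_add, ← two_rpow_add]; congr 1; ring
        rw [← mul_assoc, mul_comm D, ← mul_assoc, this]; ring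
    _ = ∫⁻ x, ∑' i : ℤ, D * 2 ^ P * (2 ^ (i * (P - 1)) *
          (if (2 : ℝ≥0∞) ^ (i : ℝ) < 2 * K * φ x then φ x else 0)) ∂μ := by
        rw [lintegral_tsum fun i => (((hm2 i).const_mul _).const_mul _).aemeasurable]
    _ ≤ ∫⁻ x, D * 2 ^ P * geomConst (P - 1) * (2 * K) ^ (P - 1) * φ x ^ P ∂μ := by
        refine lintegral_mono fun x => ?_
        simp only
        have e : ∀ i : ℤ, D * 2 ^ P * (2 ^ (i * (P - 1)) *
            (if (2 : ℝ≥0∞) ^ (i : ℝ) < 2 * K * φ x then φ x else 0)) =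
            D * 2 ^ P * φ x * (if (2 : ℝ≥0∞) ^ (i : ℝ) < 2 * K * φ x then
              2 ^ (i * (P - 1)) else 0) := by
          intro i; split_ifs
          · ring
          · simp
        simp_rw [e]
        rw [ENNReal.tsum_mul_left]
        calc _ ≤ D * 2 ^ P * φ x * (geomConst (P - 1) * (2 * K * φ x) ^ (P - 1)) := by
              gcongr; exact tsum_two_rpow_lt_le hP1 _
          _ = D * 2 ^ P * geomConst (P - 1) * (2 * K) ^ (P - 1) * (φ x * φ x ^ (P - 1)) := by
              rw [ENNReal.mul_rpow_of_nonneg _ _ hP1.le]; ring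
          _ = _ := by
              congr 1
              conv_lhs => rw [← ENNReal.rpow_one (φ x), ← ENNReal.rpow_mul, one_mul,
                ← ENNReal.rpow_add_of_nonneg _ _ zero_le_one hP1.le]
              congr 1; ring
    _ = _ := lintegral_const_mul _ (hφ.pow_const _)

end Maximal

/-! ### Vector-valued maximal inequalities -/

section VectorValued

/-- The `ℓ^q` (quasi-)norm of an extended nonnegative sequence. -/
def ellENorm (q : ℝ≥0∞) (a : ℤ → ℝ≥0∞) : ℝ≥0∞ :=
  if q = ∞ then ⨆ k, a k else (∑' k, a k ^ q.toReal) ^ (1 / q.toReal)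

/-- Equality can fail only at F = ∞, where the left side is 0 if b > 0. -/
lemma rpow_mul_rpow_neg_le (F : ℝ≥0∞) {a b : ℝ} (hb : 0 ≤ b) (hab : b < a) :
    F ^ a * F ^ (-b) ≤ F ^ (a - b) := by
  rcases eq_or_ne F 0 with rfl | h0
  · rw [ENNReal.zero_rpow_of_pos (by linarith)]; simp
  rcases eq_or_ne F ∞ with rfl | ht
  · rw [ENNReal.top_rpow_of_pos (by linarith : 0 < a - b)]; exact le_top
  rw [← ENNReal.rpow_add _ _ h0 ht]
  rfl

variable {X : Type*} [MetricSpace X] [MeasurableSpace X] [BorelSpace X]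
  [SecondCountableTopology X] {n : ℝ} {K : ℝ≥0} {μ : Measure X} [SigmaFinite μ]

lemma lintegral_tsum_dyAvg_le (hK : UpperRegular n K μ) {φ : ℤ → X → ℝ≥0∞}
    (hφ : ∀ j, Measurable (φ j)) :
    ∫⁻ x, ∑' j, dyAvg n μ j (φ j) x ∂μ ≤ K * ∫⁻ x, ∑' j, φ j x ∂μ := by
  rw [lintegral_tsum fun j => (measurable_dyAvg (hφ j) j).aemeasurable,
    lintegral_tsum fun j => (hφ j).aemeasurable, ← ENNReal.tsum_mul_left]
  exact ENNReal.tsum_le_tsum fun j => lintegral_dyAvg_le hK (hφ j) j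

/-- The dual form of the maximal inequality: `L ^ P` bounds for sums of averages, `P > 1`. -/
theorem exists_lintegral_tsum_dyAvg_rpow_le (hK : UpperRegular n K μ)
    (hK1 : 1 ≤ K) {P : ℝ} (hP : 1 < P) :
    ∃ C : ℝ≥0∞, C ≠ ∞ ∧ ∀ φ : ℤ → X → ℝ≥0∞, (∀ j, Measurable (φ j)) →
      ∫⁻ x, (∑' j, dyAvg n μ j (φ j) x) ^ P ∂μ ≤ C * ∫⁻ x, (∑' j, φ j x) ^ P ∂μ := by
  have hP0 : 0 < P := by linarith
  have hP1 : 0 < P - 1 := by linarith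
  obtain ⟨C, hC, hmax⟩ := exists_lintegral_dyMax_rpow_le (μ := μ) hK hK1
    (P := P / (P - 1)) (by rw [lt_div_iff₀ hP1]; linarith)
  refine ⟨C ^ (P - 1), ENNReal.rpow_ne_top_of_nonneg hP1.le hC, fun φ hφ => ?_⟩
  set S : X → ℝ≥0∞ := fun x => ∑' j, dyAvg n μ j (φ j) x with hS
  set F : X → ℝ≥0∞ := fun x => ∑' j, φ j x with hF
  have hSm : Measurable S := Measurable.tsum fun j => measurable_dyAvg (hφ j) j
  have hFm : Measurable F := Measurable.tsum hφ
  -- Truncation makes the integral of T^P finite, so that a power of it can be cancelled below.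
  set T : ℕ → X → ℝ≥0∞ := fun N => (spanningSets μ N).indicator fun x => min (S x) N with hT
  have hTm : ∀ N, Measurable (T N) := fun N =>
    (hSm.min measurable_const).indicator (measurableSet_spanningSets μ N)
  have hTS : ∀ N x, T N x ≤ S x := fun N x =>
    (indicator_le_self _ _ x).trans (min_le_left _ _)
  have hmono : Monotone T := by
    intro N M hNM x
    simp only [hT]
    refine (indicator_le_indicator_of_subset (monotone_spanningSets μ hNM) (fun _ => zero_le)
      x).trans ?_
    refine indicator_le_indicator ?_
    gcongr
  have hsup : ∀ x, ⨆ N, T N x = S x := by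
    intro x
    refine le_antisymm (iSup_le fun N => hTS N x) ?_
    have hx := mem_iUnion.1 ((iUnion_spanningSets μ).symm ▸ mem_univ x :
      x ∈ ⋃ N, spanningSets μ N)
    obtain ⟨N0, hN0⟩ := hx
    refine le_of_forall_lt fun c hc => ?_
    obtain ⟨N1, hN1⟩ := ENNReal.exists_nat_gt hc.ne_top
    refine lt_of_lt_of_le ?_ (le_iSup (fun N => T N x) (max N0 N1))
    simp only [hT]
    rw [indicator_of_mem (monotone_spanningSets μ (le_max_left _ _) hN0)]
    refine lt_min hc (hN1.trans_le ?_)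
    exact_mod_cast le_max_right N0 N1
  have hbound : ∀ N, ∫⁻ x, T N x ^ P ∂μ ≤ C ^ (P - 1) * ∫⁻ x, F x ^ P ∂μ := by
    intro N
    set I := ∫⁻ x, T N x ^ P ∂μ with hI
    have hfin : I ≠ ∞ := by
      have : I ≤ ∫⁻ x in spanningSets μ N, (N : ℝ≥0∞) ^ P ∂μ := by
        rw [hI, ← lintegral_indicator (measurableSet_spanningSets μ N)]
        refine lintegral_mono fun x => ?_
        by_cases hx : x ∈ spanningSets μ N
        · simp only [hT, indicator_of_mem hx]
          gcongr; exact min_le_right _ _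
        · simp only [hT, indicator_of_notMem hx]
          rw [ENNReal.zero_rpow_of_pos hP0]
      refine (this.trans_lt ?_).ne
      rw [setLIntegral_const]
      exact ENNReal.mul_lt_top (ENNReal.rpow_lt_top_of_nonneg hP0.le (by simp))
        (measure_spanningSets_lt_top μ N)
    set ψ : X → ℝ≥0∞ := fun x => T N x ^ (P - 1) with hψ
    have hψm : Measurable ψ := (hTm N).pow_const _
    -- Duality: test the sum of averages against ψ = T^(P-1), move each average onto ψ, and dominate
    -- it by the maximal function, which does not depend on j.
    have h1 : I ≤ ∫⁻ x, F x * dyMax n μ ψ x ∂μ := by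
      calc I ≤ ∫⁻ x, ∑' j, dyAvg n μ j (φ j) x * ψ x ∂μ := by
            refine lintegral_mono fun x => ?_
            simp only
            rw [ENNReal.tsum_mul_right]
            calc T N x ^ P = T N x * T N x ^ (P - 1) := by
                  conv_rhs => rw [← ENNReal.rpow_one (T N x), ← ENNReal.rpow_mul, one_mul,
                    ← ENNReal.rpow_add_of_nonneg _ _ zero_le_one hP1.le]
                  congr 1; ring
              _ ≤ _ := by gcongr; exact hTS N x
        _ = ∑' j, ∫⁻ x, dyAvg n μ j (φ j) x * ψ x ∂μ :=
            lintegral_tsum fun j => ((measurable_dyAvg (hφ j) j).mul hψm).aemeasurable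
        _ = ∑' j, ∫⁻ x, φ j x * dyAvg n μ j ψ x ∂μ := by
            congr 1 with j; exact lintegral_dyAvg_mul (hφ j) hψm j
        _ = ∫⁻ x, ∑' j, φ j x * dyAvg n μ j ψ x ∂μ :=
            (lintegral_tsum fun j => ((hφ j).mul (measurable_dyAvg hψm j)).aemeasurable).symm
        _ ≤ _ := by
            refine lintegral_mono fun x => ?_
            simp only [hF]
            rw [← ENNReal.tsum_mul_right]
            refine ENNReal.tsum_le_tsum fun j => ?_
            gcongr; exact dyAvg_le_dyMax j ψ x
    have h2 : I ≤ (∫⁻ x, F x ^ P ∂μ) ^ (1 / P) * (C * I) ^ (1 / (P / (P - 1))) := by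
      refine h1.trans ((ENNReal.lintegral_mul_le_Lp_mul_Lq μ
        (Real.HolderConjugate.conjExponent hP) hFm.aemeasurable
        (measurable_dyMax hψm).aemeasurable).trans ?_)
      simp only [Real.conjExponent]
      gcongr
      refine (hmax ψ hψm).trans (le_of_eq ?_)
      congr 1
      refine lintegral_congr fun x => ?_
      simp only [hψ]
      rw [← ENNReal.rpow_mul]
      congr 1; field_simp
    rcases eq_or_ne I 0 with h0 | h0
    · rw [h0]; exact zero_le
    have h3 : I ^ P ≤ (∫⁻ x, F x ^ P ∂μ) * C ^ (P - 1) * I ^ (P - 1) := by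
      calc I ^ P ≤ ((∫⁻ x, F x ^ P ∂μ) ^ (1 / P) * (C * I) ^ (1 / (P / (P - 1)))) ^ P := by
            gcongr
        _ = _ := by
            rw [ENNReal.mul_rpow_of_nonneg _ _ hP0.le, ← ENNReal.rpow_mul, ← ENNReal.rpow_mul,
              one_div_mul_cancel hP0.ne', ENNReal.rpow_one, mul_assoc,
              ← ENNReal.mul_rpow_of_nonneg _ _ hP1.le]
            congr 2; field_simp
    have h4 : I ^ P = I * I ^ (P - 1) := by
      conv_rhs => rw [← ENNReal.rpow_one I, ← ENNReal.rpow_mul, one_mul,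
                    ← ENNReal.rpow_add_of_nonneg _ _ zero_le_one hP1.le]
      congr 1; ring
    rw [h4, ENNReal.mul_le_mul_iff_left] at h3
    · rwa [mul_comm]
    · simp [ENNReal.rpow_eq_zero_iff, h0, hfin]
    · exact ENNReal.rpow_ne_top_of_nonneg hP1.le hfin
  calc ∫⁻ x, S x ^ P ∂μ = ∫⁻ x, ⨆ N, T N x ^ P ∂μ := by
        refine lintegral_congr fun x => ?_
        rw [← hsup x]
        exact (ENNReal.orderIsoRpow P hP0).map_iSup _
    _ = ⨆ N, ∫⁻ x, T N x ^ P ∂μ := by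
        refine lintegral_iSup (fun N => (hTm N).pow_const _) fun N M hNM x => ?_
        simp only
        gcongr; exact hmono hNM x
    _ ≤ _ := iSup_le hbound

/-- `L ^ P (ℓ ^ Q)` bounds for the averages, `1 < P < Q < ∞`. -/
theorem exists_lintegral_tsum_dyAvg_rpow_rpow_le (hK : UpperRegular n K μ)
    (hK1 : 1 ≤ K) {P Q : ℝ} (hP : 1 < P) (hPQ : P < Q) :
    ∃ C : ℝ≥0∞, C ≠ ∞ ∧ ∀ φ : ℤ → X → ℝ≥0∞, (∀ j, Measurable (φ j)) →
      ∫⁻ x, (∑' j, dyAvg n μ j (φ j) x ^ Q) ^ (P / Q) ∂μ ≤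
        C * ∫⁻ x, (∑' j, φ j x ^ Q) ^ (P / Q) ∂μ := by
  have hP0 : 0 < P := by linarith
  have hQ0 : 0 < Q := by linarith
  have hQ1 : 0 < Q - 1 := by linarith
  have hQP : 0 < Q - P := by linarith
  set P1 : ℝ := (Q - 1) * P / (Q - P) with hP1
  set α : ℝ := (Q - P) / (Q - 1) with hα
  have hα0 : 0 < α := div_pos hQP hQ1
  have hαP : α * P1 = P := by rw [hα, hP1]; field_simp
  obtain ⟨C, hC, hmax⟩ := exists_lintegral_dyMax_rpow_le (μ := μ) hK hK1
    (P := P1) (by rw [hP1, lt_div_iff₀ hQP]; nlinarith)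
  have hPQ1 : 0 < P / Q := by positivity
  have hPQ2 : 0 < 1 - P / Q := by rw [sub_pos, div_lt_one hQ0]; exact hPQ
  -- The summand 1 keeps the constant nonzero, which matters when the right-hand integral is
  -- infinite.
  refine ⟨(K : ℝ≥0∞) ^ (P / Q) * (C + 1) ^ (1 - P / Q), ?_, fun φ hφ => ?_⟩
  · exact ENNReal.mul_ne_top (ENNReal.rpow_ne_top_of_nonneg hPQ1.le ENNReal.coe_ne_top)
      (ENNReal.rpow_ne_top_of_nonneg hPQ2.le (by finiteness))
  set G : X → ℝ≥0∞ := fun x => ∑' j, φ j x ^ Q with hG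
  have hGm : Measurable G := Measurable.tsum fun j => (hφ j).pow_const _
  set F : X → ℝ≥0∞ := fun x => G x ^ (1 / Q) with hF
  have hFm : Measurable F := hGm.pow_const _
  have hFP : ∀ x, F x ^ P = G x ^ (P / Q) := by
    intro x; simp only [hF]; rw [← ENNReal.rpow_mul]; congr 1; ring
  set I := ∫⁻ x, F x ^ P ∂μ with hI
  have hI' : ∫⁻ x, G x ^ (P / Q) ∂μ = I := lintegral_congr fun x => (hFP x).symm
  rw [hI']
  have hφF : ∀ j x, φ j x ≤ F x := by
    intro j x
    calc φ j x = (φ j x ^ Q) ^ (1 / Q) := by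
          rw [← ENNReal.rpow_mul, mul_one_div_cancel hQ0.ne', ENNReal.rpow_one]
      _ ≤ _ := by simp only [hF, hG]; gcongr; exact ENNReal.le_tsum (f := fun j => φ j x ^ Q) j
  rcases eq_or_ne I ∞ with hIt | hIt
  · have hK0 : (K : ℝ≥0∞) ≠ 0 := by
      have : K ≠ 0 := by intro h; rw [h] at hK1; norm_num at hK1
      exact_mod_cast this
    rw [hIt, ENNReal.mul_top]
    · exact le_top
    · refine mul_ne_zero ?_ ?_
      · simp [ENNReal.rpow_eq_zero_iff, hK0]
      · rw [ne_eq, ENNReal.rpow_eq_zero_iff]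
        rintro (h | h)
        · simp at h
        · exact absurd h.2 (not_lt.2 hPQ2.le)
  have hFfin : ∀ᵐ x ∂μ, F x ≠ ∞ := by
    filter_upwards [ae_lt_top (hFm.pow_const P) hIt] with x hx h
    rw [h, ENNReal.top_rpow_of_pos hP0] at hx
    exact lt_irrefl _ hx
  set ψ : ℤ → X → ℝ≥0∞ := fun j x => φ j x ^ Q * F x ^ (-(Q - P)) with hψ
  have hψm : ∀ j, Measurable (ψ j) := fun j => ((hφ j).pow_const _).mul (hFm.pow_const _)
  have hFαm : Measurable fun x => F x ^ α := hFm.pow_const _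
  set U : X → ℝ≥0∞ := fun x => ∑' j, dyAvg n μ j (ψ j) x with hU
  set V : X → ℝ≥0∞ := dyMax n μ fun x => F x ^ α with hV
  have hUm : Measurable U := Measurable.tsum fun j => measurable_dyAvg (hψm j) j
  have hVm : Measurable V := measurable_dyMax hFαm
  have hQ' : 0 < 1 - 1 / Q := by rw [sub_pos, div_lt_one hQ0]; linarith
  have hterm : ∀ j x, dyAvg n μ j (φ j) x ^ Q ≤ dyAvg n μ j (ψ j) x * V x ^ (Q - 1) := by
    intro j x
    -- The powers of F cancel where F is finite; where F = 0 both sides vanish because φ j ≤ F.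
    -- Hölder then separates a factor summable in j from one bounded by V.
    have hae : φ j =ᵐ[μ] fun y => ψ j y ^ (1 / Q) * (F y ^ α) ^ (1 - 1 / Q) := by
      filter_upwards [hFfin] with y hy
      have e1 : α * (1 - 1 / Q) = (Q - P) / Q := by rw [hα]; field_simp
      have e2 : -(Q - P) * (1 / Q) = -((Q - P) / Q) := by ring
      simp only [hψ]
      rw [ENNReal.mul_rpow_of_nonneg _ _ (by positivity), ← ENNReal.rpow_mul (φ j y),
        ← ENNReal.rpow_mul (F y), ← ENNReal.rpow_mul (F y), e1, e2, mul_one_div_cancel hQ0.ne', ENNReal.rpow_one]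
      rcases eq_or_ne (F y) 0 with h0 | h0
      · have : φ j y = 0 := le_antisymm (h0 ▸ hφF j y) zero_le
        simp [this]
      · rw [mul_assoc, ← ENNReal.rpow_add _ _ h0 hy]; simp
    have h1 := dyAvg_mul_le (n := n) (μ := μ) (by positivity : (0 : ℝ) ≤ 1 / Q) hQ'.le (by ring)
      (hψm j) hFαm j x
    rw [← dyAvg_congr_ae hae] at h1
    calc _ ≤ (dyAvg n μ j (ψ j) x ^ (1 / Q) *
          dyAvg n μ j (fun y => F y ^ α) x ^ (1 - 1 / Q)) ^ Q := by gcongr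
      _ = dyAvg n μ j (ψ j) x * dyAvg n μ j (fun y => F y ^ α) x ^ (Q - 1) := by
          rw [ENNReal.mul_rpow_of_nonneg _ _ hQ0.le, ← ENNReal.rpow_mul, ← ENNReal.rpow_mul,
            one_div_mul_cancel hQ0.ne', ENNReal.rpow_one]
          congr 2; field_simp
      _ ≤ _ := by gcongr; exact dyAvg_le_dyMax j _ x
  have hUint : ∫⁻ x, U x ∂μ ≤ K * I := by
    refine (lintegral_tsum_dyAvg_le hK hψm).trans ?_
    gcongr
    refine lintegral_mono fun x => ?_
    simp only [hψ]
    rw [ENNReal.tsum_mul_right]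
    have e : G x = F x ^ Q := by
      simp only [hF]; rw [← ENNReal.rpow_mul, one_div_mul_cancel hQ0.ne', ENNReal.rpow_one]
    have := rpow_mul_rpow_neg_le (F x) hQP.le (by linarith : Q - P < Q)
    rw [sub_sub_cancel] at this
    rwa [← e] at this
  have hVint : ∫⁻ x, V x ^ P1 ∂μ ≤ (C + 1) * I := by
    refine (hmax _ hFαm).trans ?_
    gcongr
    · exact le_self_add
    · simp_rw [← ENNReal.rpow_mul, hαP]; rfl
  calc _ ≤ ∫⁻ x, U x ^ (P / Q) * (V x ^ P1) ^ (1 - P / Q) ∂μ := by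
        refine lintegral_mono fun x => ?_
        have e : (V x ^ P1) ^ (1 - P / Q) = (V x ^ (Q - 1)) ^ (P / Q) := by
          rw [← ENNReal.rpow_mul, ← ENNReal.rpow_mul]
          congr 1; rw [hP1]; field_simp
        rw [e, ← ENNReal.mul_rpow_of_nonneg _ _ hPQ1.le]
        gcongr
        simp only [hU]
        rw [← ENNReal.tsum_mul_right]
        exact ENNReal.tsum_le_tsum fun j => hterm j x
    _ ≤ (∫⁻ x, U x ∂μ) ^ (P / Q) * (∫⁻ x, V x ^ P1 ∂μ) ^ (1 - P / Q) :=
        ENNReal.lintegral_mul_norm_pow_le hUm.aemeasurable (hVm.pow_const _).aemeasurable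
          hPQ1.le hPQ2.le (by ring)
    _ ≤ (K * I) ^ (P / Q) * ((C + 1) * I) ^ (1 - P / Q) := by gcongr
    _ = (K : ℝ≥0∞) ^ (P / Q) * (C + 1) ^ (1 - P / Q) * (I ^ (P / Q) * I ^ (1 - P / Q)) := by
        rw [ENNReal.mul_rpow_of_nonneg _ _ hPQ1.le, ENNReal.mul_rpow_of_nonneg _ _ hPQ2.le]; ring
    _ = _ := by
        rw [← ENNReal.rpow_add_of_nonneg _ _ hPQ1.le hPQ2.le, add_sub_cancel, ENNReal.rpow_one]

/-- Vector-valued maximal inequality for the power averages `(A_j (φ ^ σ)) ^ (1 / σ)`. -/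
theorem exists_lintegral_ellENorm_dyAvg_le (hK : UpperRegular n K μ)
    (hK1 : 1 ≤ K) {p : ℝ} (hp : 1 < p) {q : ℝ≥0∞} (hq : 0 < q) :
    ∃ σ : ℝ, 0 < σ ∧ ∃ C : ℝ≥0∞, C ≠ ∞ ∧ ∀ φ : ℤ → X → ℝ≥0∞, (∀ j, Measurable (φ j)) →
      ∫⁻ x, ellENorm q (fun j => dyAvg n μ j (fun y => φ j y ^ σ) x ^ (1 / σ)) ^ p ∂μ ≤
        C * ∫⁻ x, ellENorm q (fun j => φ j x) ^ p ∂μ := by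
  have hp0 : 0 < p := by linarith
  rcases eq_or_ne q ∞ with rfl | hqt
  · obtain ⟨C, hC, hmax⟩ := exists_lintegral_dyMax_rpow_le (μ := μ) hK hK1 hp
    refine ⟨1, one_pos, C, hC, fun φ hφ => ?_⟩
    simp only [ellENorm, if_true, ENNReal.rpow_one, div_one]
    refine le_trans ?_ (hmax (fun x => ⨆ j, φ j x) (Measurable.iSup hφ))
    gcongr with x
    refine iSup_le fun j => le_trans ?_ (dyAvg_le_dyMax j _ x)
    exact dyAvg_mono (fun y => le_iSup (fun j => φ j y) j) j x
  simp only [ellENorm, if_neg hqt]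
  set Q := q.toReal
  have hQ : 0 < Q := ENNReal.toReal_pos hq.ne' hqt
  have e1 : ∀ a : ℝ≥0∞, (a ^ (1 / Q)) ^ p = a ^ (p / Q) := by
    intro a; rw [← ENNReal.rpow_mul]; congr 1; ring
  have e2 : ∀ a : ℝ≥0∞, (a ^ (1 / Q)) ^ Q = a := by
    intro a; rw [← ENNReal.rpow_mul, one_div_mul_cancel hQ.ne', ENNReal.rpow_one]
  simp_rw [e1]
  -- For p < Q one averages φ j itself. For p ≥ Q one averages its Q-th power, which leaves a plain
  -- sum of averages in L^(p/Q) with p/Q ≥ 1: the L¹ bound if p = Q, the dual inequality if p > Q.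
  rcases lt_trichotomy p Q with h | h | h
  · obtain ⟨C, hC, hb⟩ := exists_lintegral_tsum_dyAvg_rpow_rpow_le (μ := μ) hK hK1 hp h
    refine ⟨1, one_pos, C, hC, fun φ hφ => ?_⟩
    simp only [ENNReal.rpow_one, div_one]
    exact hb φ hφ
  · refine ⟨Q, hQ, K, ENNReal.coe_ne_top, fun φ hφ => ?_⟩
    simp_rw [e2, h, div_self hQ.ne', ENNReal.rpow_one]
    exact lintegral_tsum_dyAvg_le hK fun j => (hφ j).pow_const _
  · obtain ⟨C, hC, hb⟩ := exists_lintegral_tsum_dyAvg_rpow_le (μ := μ) hK hK1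
      (P := p / Q) (by rwa [one_lt_div hQ])
    refine ⟨Q, hQ, C, hC, fun φ hφ => ?_⟩
    simp_rw [e2]
    exact hb _ fun j => (hφ j).pow_const _

end VectorValued

/-! ### Consequences of Ahlfors regularity -/

section Regularity

variable {X : Type*} [MetricSpace X] [MeasurableSpace X] {n : ℝ} {μ : Measure X}

/-- Lower Ahlfors regularity on balls of radius at most the diameter. -/
def LowerRegular (n c : ℝ) (μ : Measure X) : Prop :=
  ∀ (x a b : X) (ρ : ℝ), 0 < ρ → ρ ≤ dist a b → ENNReal.ofReal (c * ρ ^ n) ≤ μ (ball x ρ)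

/-- Regularity compares concentric balls only; different centers are linked through one large ball.
In an unbounded space this is a ball about x₀ containing the given one, or contained in its
enlargement. In a bounded space it is a ball of radius 3/2 of the diameter, which is all of X and
still within the range of the hypothesis. -/
lemma AhlforsRegular.exists_upper_lower [Nontrivial X] (hn : 0 < n) (hμ : BallsFinitePos μ)
    (h : AhlforsRegular n μ) :
    (∃ K : ℝ≥0, 1 ≤ K ∧ UpperRegular n K μ) ∧ ∃ c : ℝ, 0 < c ∧ LowerRegular n c μ := by
  obtain ⟨C₁, C₂, hC₁, hC₁1, hC₂, h⟩ := h
  have hC₂0 : 0 < C₂ := by linarith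
  set m : X → ℝ → ℝ := fun x r => (μ (ball x r)).toReal with hm
  have hmpos : ∀ x r, 0 < r → 0 < m x r := fun x r hr =>
    ENNReal.toReal_pos (hμ x r hr).1.ne' (hμ x r hr).2.ne
  have hmE : ∀ x r, 0 < r → μ (ball x r) = ENNReal.ofReal (m x r) := fun x r hr =>
    (ENNReal.ofReal_toReal (hμ x r hr).2.ne).symm
  have hmono : ∀ x y r R, 0 < R → ball x r ⊆ ball y R → m x r ≤ m y R := fun x y r R hR hs =>
    ENNReal.toReal_mono (hμ y R hR).2.ne (measure_mono hs)
  have key : ∀ x r R, 0 < r → r ≤ R → ENNReal.ofReal R < 2 * ediam (univ : Set X) →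
      C₁ * (R ^ n * m x r) ≤ r ^ n * m x R ∧ r ^ n * m x R ≤ C₂ * (R ^ n * m x r) := by
    intro x r R hr hrR hR
    have hRpos : 0 < R := hr.trans_le hrR
    have e : R / r * r = R := div_mul_cancel₀ _ hr.ne'
    obtain ⟨h1, h2⟩ := h x r (R / r) hr ((ENNReal.ofReal_le_ofReal hrR).trans_lt hR)
      (by rwa [one_le_div hr]) (by rwa [e])
    rw [e, hmE x r hr, hmE x R hRpos, Real.div_rpow hRpos.le hr.le,
      ← ENNReal.ofReal_mul (by positivity)] at h1 h2
    rw [ENNReal.ofReal_le_ofReal_iff (hmpos x R hRpos).le] at h1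
    rw [ENNReal.ofReal_le_ofReal_iff (by have := hmpos x r hr; positivity)] at h2
    have hrn : 0 < r ^ n := by positivity
    constructor
    · calc _ = r ^ n * (C₁ * (R ^ n / r ^ n) * m x r) := by field_simp
        _ ≤ _ := by gcongr
    · calc _ ≤ r ^ n * (C₂ * (R ^ n / r ^ n) * m x r) := by gcongr
        _ = _ := by field_simp
  suffices hs : ∃ c' K' : ℝ, 0 < c' ∧ (∀ x ρ, 0 < ρ → m x ρ ≤ K' * ρ ^ n) ∧
      ∀ (x a b : X) ρ, 0 < ρ → ρ ≤ dist a b → c' * ρ ^ n ≤ m x ρ by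
    obtain ⟨c', K', hc', hK', hl⟩ := hs
    refine ⟨⟨max 1 K'.toNNReal, le_max_left _ _, fun x ρ hρ => ?_⟩, c', hc',
      fun x a b ρ hρ hab => ?_⟩
    · rw [hmE x ρ hρ]
      calc ENNReal.ofReal (m x ρ) ≤ ENNReal.ofReal (K' * ρ ^ n) :=
            ENNReal.ofReal_le_ofReal (hK' x ρ hρ)
        _ = ENNReal.ofReal K' * ENNReal.ofReal (ρ ^ n) := ENNReal.ofReal_mul' (by positivity)
        _ ≤ _ := by gcongr; exact ENNReal.coe_le_coe.2 (le_max_right _ _)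
    · rw [hmE x ρ hρ]; exact ENNReal.ofReal_le_ofReal (hl x a b ρ hρ hab)
  obtain ⟨x₀, y₀, hxy⟩ := exists_pair_ne X
  have hd0 : 0 < dist x₀ y₀ := dist_pos.2 hxy
  by_cases hD : ediam (univ : Set X) = ∞
  · have hall : ∀ R, ENNReal.ofReal R < 2 * ediam (univ : Set X) := by
      intro R; rw [hD, ENNReal.mul_top (by norm_num)]; exact ENNReal.ofReal_lt_top
    set M := m x₀ 1
    have hM : 0 < M := hmpos _ _ one_pos
    refine ⟨C₁ * (2 ^ n)⁻¹ * M * C₂⁻¹, C₂ * 2 ^ n * M * C₁⁻¹, by positivity,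
      fun x ρ hρ => ?_, fun x a b ρ hρ _ => ?_⟩
    all_goals
      set R := max ρ (max 1 (dist x x₀)) with hR
      have hρR : ρ ≤ R := le_max_left _ _
      have h1R : 1 ≤ R := (le_max_left _ _).trans (le_max_right _ _)
      have hdR : dist x x₀ ≤ R := (le_max_right _ _).trans (le_max_right _ _)
      have hR0 : 0 < R := by linarith
      have hRn : 0 < R ^ n := by positivity
      have hρn : 0 < ρ ^ n := by positivity
      have h2n : (0 : ℝ) < 2 ^ n := by positivity
      have e2 : (2 * R) ^ n = 2 ^ n * R ^ n := Real.mul_rpow (by norm_num) hR0.le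
    · have k1 := (key x ρ R hρ hρR (hall _)).1
      have k2 := (key x₀ 1 (2 * R) one_pos (by linarith) (hall _)).2
      have k3 : m x R ≤ m x₀ (2 * R) := hmono _ _ _ _ (by linarith)
        (ball_subset_ball' (by linarith))
      rw [Real.one_rpow, one_mul, e2] at k2
      have : C₁ * (R ^ n * m x ρ) ≤ C₁ * (R ^ n * (C₂ * 2 ^ n * M * C₁⁻¹ * ρ ^ n)) := by
        calc _ ≤ ρ ^ n * m x R := k1
          _ ≤ ρ ^ n * (C₂ * (2 ^ n * R ^ n * M)) := by gcongr; exact k3.trans k2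
          _ = _ := by field_simp
      exact le_of_mul_le_mul_left (le_of_mul_le_mul_left this hC₁) hRn
    · have k1 := (key x ρ (2 * R) hρ (by linarith) (hall _)).2
      have k2 := (key x₀ 1 R one_pos h1R (hall _)).1
      have k3 : m x₀ R ≤ m x (2 * R) := hmono _ _ _ _ (by linarith)
        (ball_subset_ball' (by rw [dist_comm]; linarith))
      rw [Real.one_rpow, one_mul] at k2
      rw [e2] at k1
      have : (C₂ * 2 ^ n * R ^ n) * (C₁ * (2 ^ n)⁻¹ * M * C₂⁻¹ * ρ ^ n) ≤
          (C₂ * 2 ^ n * R ^ n) * m x ρ := by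
        calc _ = ρ ^ n * (C₁ * (R ^ n * M)) := by field_simp
          _ ≤ ρ ^ n * m x (2 * R) := by gcongr; exact k2.trans k3
          _ ≤ _ := k1.trans (le_of_eq (by ring))
      exact le_of_mul_le_mul_left this (by positivity)
  · set D := Metric.diam (univ : Set X) with hDdef
    have hbd : Bornology.IsBounded (univ : Set X) := isBounded_iff_ediam_ne_top.2 hD
    have hle : ∀ a b : X, dist a b ≤ D := fun a b =>
      dist_le_diam_of_mem hbd (mem_univ a) (mem_univ b)
    have hD0 : 0 < D := hd0.trans_le (hle _ _)
    have hDe : ediam (univ : Set X) = ENNReal.ofReal D := by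
      rw [hDdef, Metric.diam, ENNReal.ofReal_toReal hD]
    have hball : ∀ (x : X) r, D < r → ball x r = univ := fun x r hr =>
      eq_univ_of_forall fun y => (hle y x).trans_lt hr
    set R := 3 / 2 * D with hR
    have hDR : D < R := by linarith
    have hR0 : 0 < R := by linarith
    have hRal : ENNReal.ofReal R < 2 * ediam (univ : Set X) := by
      rw [hDe, ← ENNReal.ofReal_ofNat 2, ← ENNReal.ofReal_mul (by norm_num),
        ENNReal.ofReal_lt_ofReal_iff (by linarith)]
      linarith
    set M := m x₀ R with hM
    have hM0 : 0 < M := hmpos _ _ hR0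
    have hmM : ∀ x r, D < r → m x r = M := by
      intro x r hr; simp only [hM, hm]; rw [hball x r hr, hball x₀ R hDR]
    have hRn : 0 < R ^ n := by positivity
    refine ⟨M / R ^ n / C₂, M / R ^ n / C₁, by positivity, fun x ρ hρ => ?_,
      fun x a b ρ hρ hab => ?_⟩
    · have hρn : 0 < ρ ^ n := by positivity
      rcases le_or_gt ρ R with hρR | hρR
      · have k1 := (key x ρ R hρ hρR hRal).1
        rw [hmM x R hDR] at k1
        rw [div_div, div_mul_eq_mul_div, le_div_iff₀ (by positivity)]
        linarith
      · rw [hmM x ρ (by linarith), div_div, div_mul_eq_mul_div, le_div_iff₀ (by positivity)]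
        have : R ^ n ≤ ρ ^ n := Real.rpow_le_rpow hR0.le hρR.le hn.le
        calc M * (R ^ n * C₁) ≤ M * (ρ ^ n * 1) := by gcongr
          _ = _ := by ring
    · have k1 := (key x ρ R hρ (by linarith [hle a b]) hRal).2
      rw [hmM x R hDR] at k1
      rw [div_div, div_mul_eq_mul_div, div_le_iff₀ (by positivity)]
      linarith

/-- The centers of a maximal disjoint family of ε/4-balls are ε-dense, and a ball of finite measure
contains at most countably many disjoint balls of positive measure. -/
lemma BallsFinitePos.secondCountableTopology [OpensMeasurableSpace X] (hμ : BallsFinitePos μ) :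
    SecondCountableTopology X := by
  rcases isEmpty_or_nonempty X with hX | ⟨⟨x₀⟩⟩
  · infer_instance
  refine secondCountable_of_almost_dense_set fun ε hε => ?_
  obtain ⟨u, -, hdisj, hcov⟩ := Vitali.exists_disjoint_subfamily_covering_enlargement_ball
    (univ : Set X) (fun x => x) (fun _ => ε / 4) (ε / 4) (fun _ _ => le_rfl) 4 (by norm_num)
  refine ⟨u, ?_, fun x => ?_⟩
  · have hN : u = ⋃ N : ℕ, u ∩ ball x₀ N := by
      ext x
      simp only [mem_iUnion, mem_inter_iff, mem_ball, exists_and_left]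
      exact ⟨fun h => ⟨h, exists_nat_gt _⟩, fun h => h.1⟩
    rw [hN]
    refine countable_iUnion fun N => ?_
    set B := ball x₀ (N + ε)
    have hBfin : IsFiniteMeasure (μ.restrict B) :=
      ⟨by rw [Measure.restrict_apply_univ]; exact (hμ x₀ _ (by positivity)).2⟩
    have hc := Measure.countable_meas_pos_of_disjoint_iUnion (μ := μ.restrict B)
      (As := fun b : u => ball (b : X) (ε / 4)) (fun _ => measurableSet_ball)
      (hdisj.subtype _ _)
    refine (hc.image (Subtype.val)).mono ?_
    rintro b ⟨hbu, hbN⟩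
    refine ⟨⟨b, hbu⟩, ?_, rfl⟩
    simp only [mem_ofPred_eq]
    rw [Measure.restrict_apply measurableSet_ball, inter_eq_left.2]
    · exact (hμ b _ (by positivity)).1
    · refine ball_subset_ball' ?_
      have := mem_ball.1 hbN
      linarith
  · obtain ⟨b, hb, hs⟩ := hcov x (mem_univ x)
    refine ⟨b, hb, ?_⟩
    have := mem_ball.1 (hs (mem_ball_self (by positivity)))
    linarith

lemma BallsFinitePos.isLocallyFiniteMeasure (hμ : BallsFinitePos μ) :
    IsLocallyFiniteMeasure μ :=
  ⟨fun x => ⟨ball x 1, ball_mem_nhds x one_pos, (hμ x 1 one_pos).2⟩⟩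

variable {K : ℝ≥0} {c : ℝ}

lemma UpperRegular.measure_ball_mul_le (hK : UpperRegular n K μ) (hc : 0 < c)
    (hl : LowerRegular n c μ) {t : ℝ} (ht : 0 < t) {x y a b : X} {ρ : ℝ} (hρ : 0 < ρ)
    (hab : ρ ≤ dist a b) :
    μ (ball x (t * ρ)) ≤ K * ENNReal.ofReal (t ^ n / c) * μ (ball y ρ) := by
  calc _ ≤ K * ENNReal.ofReal ((t * ρ) ^ n) := hK x _ (by positivity)
    _ = K * ENNReal.ofReal (t ^ n / c) * ENNReal.ofReal (c * ρ ^ n) := by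
        rw [mul_assoc, ← ENNReal.ofReal_mul (by positivity), Real.mul_rpow ht.le hρ.le]
        congr 2; field_simp
    _ ≤ _ := by gcongr; exact hl y a b ρ hρ hab

lemma UpperRegular.isUnifLocDoublingMeasure [Nontrivial X] (hK : UpperRegular n K μ) (hc : 0 < c)
    (hl : LowerRegular n c μ) : IsUnifLocDoublingMeasure μ := by
  obtain ⟨a, b, hab⟩ := exists_pair_ne X
  refine ⟨⟨K * (3 ^ n / c).toNNReal, ?_⟩⟩
  filter_upwards [Ioc_mem_nhdsGT (dist_pos.2 hab)] with ρ hρ x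
  calc μ (closedBall x (2 * ρ)) ≤ μ (ball x (3 * ρ)) :=
        measure_mono (closedBall_subset_ball (by linarith [hρ.1]))
    _ ≤ K * ENNReal.ofReal (3 ^ n / c) * μ (ball x ρ) :=
        hK.measure_ball_mul_le hc hl (by norm_num) hρ.1 hρ.2
    _ ≤ _ := by
        gcongr
        · simp [ENNReal.ofReal]
        · exact ball_subset_closedBall

/-- The ratio of the measures is at most a constant times δ^n, which tends to 0 with δ because n >
0. -/
lemma UpperRegular.exists_measure_ball_mul_le (hn : 0 < n) (hK : UpperRegular n K μ) (hc : 0 < c)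
    (hl : LowerRegular n c μ) {ε : ℝ≥0∞} (hε : 0 < ε) :
    ∃ δ : ℝ, 0 < δ ∧ δ < 1 ∧ ∀ (x a b : X) (ρ : ℝ), 0 < ρ → ρ ≤ dist a b →
      μ (ball x (δ * ρ)) ≤ ε * μ (ball x ρ) := by
  have hlim : Tendsto (fun δ : ℝ => (K : ℝ≥0∞) * ENNReal.ofReal (δ ^ n / c)) (𝓝[>] 0) (𝓝 0) := by
    have h1 : Tendsto (fun δ : ℝ => δ ^ n / c) (𝓝[>] 0) (𝓝 (0 ^ n / c)) :=
      ((Real.continuousAt_rpow_const 0 n (Or.inr hn.le)).tendsto.mono_left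
        nhdsWithin_le_nhds).div_const c
    rw [Real.zero_rpow hn.ne', zero_div] at h1
    have h2 := ENNReal.Tendsto.const_mul (a := (K : ℝ≥0∞)) (ENNReal.tendsto_ofReal h1)
      (Or.inr ENNReal.coe_ne_top)
    simpa using h2
  obtain ⟨δ, hδ, hδ1⟩ := ((hlim.eventually_lt_const hε).and
    (Ioo_mem_nhdsGT (one_pos : (0 : ℝ) < 1))).exists
  refine ⟨δ, hδ1.1, hδ1.2, fun x a b ρ hρ hab => ?_⟩
  refine (hK.measure_ball_mul_le hc hl (y := x) hδ1.1 hρ hab).trans ?_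
  gcongr

end Regularity

/-! ### Quasisymmetry in a form symmetric under inversion -/

section WeakQS

variable {X Y : Type*} [MetricSpace X] [MetricSpace Y]

/-- A symmetric form of quasisymmetry: ratios of distances are controlled by an unspecified
function which is finite everywhere and small near zero. -/
def WeakQS (f : X ≃ₜ Y) : Prop :=
  (∀ t : ℝ, 0 < t → ∃ T : ℝ, 0 < T ∧ ∀ x a b : X, dist x a ≤ t * dist x b →
    dist (f x) (f a) ≤ T * dist (f x) (f b)) ∧
  (∀ T : ℝ, 0 < T → ∃ t : ℝ, 0 < t ∧ ∀ x a b : X, dist x a ≤ t * dist x b →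
    dist (f x) (f a) ≤ T * dist (f x) (f b))

/-- A homeomorphism of [0, ∞) is increasing, since an antitone one would be bounded by its value at
0, and therefore fixes 0. The two clauses follow by evaluating η and its inverse. -/
lemma Quasisymmetric.weakQS {f : X ≃ₜ Y} (hf : Quasisymmetric f) : WeakQS f := by
  obtain ⟨η, hη⟩ := hf
  have hmono : StrictMono η := by
    rcases η.continuous.strictMono_of_inj η.injective with h | h
    · exact h
    · exfalso
      obtain ⟨y, hy⟩ := η.surjective (η 0 + 1)
      have : η y ≤ η 0 := h.antitone zero_le
      rw [hy] at this
      exact absurd this (not_le.2 (lt_add_one _))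
  have h0 : η 0 = 0 := by
    obtain ⟨y, hy⟩ := η.surjective 0
    have := hmono.monotone (zero_le : 0 ≤ y)
    rw [hy] at this
    exact le_antisymm this zero_le
  have key : ∀ t : ℝ≥0, ∀ x a b : X, dist x a ≤ t * dist x b →
      dist (f x) (f a) ≤ η t * dist (f x) (f b) := by
    intro t x a b h
    rcases eq_or_ne x b with rfl | hxb
    · rw [dist_self, mul_zero] at h
      have : x = a := dist_le_zero.1 h
      simp [this]
    · have h1 := hη a b x hxb
      have hpos : 0 < nndist x b := by rw [← NNReal.coe_pos, coe_nndist]; exact dist_pos.2 hxb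
      have hposf : 0 < nndist (f x) (f b) := by
        rw [← NNReal.coe_pos, coe_nndist]; exact dist_pos.2 (f.injective.ne hxb)
      have h2 : nndist x a / nndist x b ≤ t := by
        rw [div_le_iff₀ hpos]; exact_mod_cast h
      have h3 := h1.trans (hmono.monotone h2)
      rw [div_le_iff₀ hposf] at h3
      exact_mod_cast h3
  refine ⟨fun t ht => ⟨η t.toNNReal, ?_, ?_⟩, fun T hT => ?_⟩
  · have : η 0 < η t.toNNReal := hmono (Real.toNNReal_pos.2 ht)
    rw [h0] at this
    exact_mod_cast this
  · intro x a b h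
    refine key t.toNNReal x a b ?_
    rwa [Real.coe_toNNReal t ht.le]
  · refine ⟨η.symm T.toNNReal, ?_, fun x a b h => ?_⟩
    · rw [NNReal.coe_pos, pos_iff_ne_zero]
      intro h
      have h' : T.toNNReal = η 0 := by rw [← h, η.apply_symm_apply]
      rw [h0, Real.toNNReal_eq_zero] at h'
      linarith
    · have := key _ x a b h
      rwa [η.apply_symm_apply, Real.coe_toNNReal T hT.le] at this

/-- Contraposition exchanges the two clauses; the factors 2 turn the negated inequalities into
contradictions. -/
lemma WeakQS.symm {f : X ≃ₜ Y} (hf : WeakQS f) : WeakQS f.symm := by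
  constructor
  · intro t ht
    obtain ⟨s, hs, h⟩ := hf.2 (1 / (2 * t)) (by positivity)
    refine ⟨1 / s, by positivity, fun x a b hab => ?_⟩
    by_contra! hc
    have h1 := h (f.symm x) (f.symm b) (f.symm a) (by
      rw [one_div, inv_mul_lt_iff₀ hs] at hc; exact hc.le)
    simp only [f.apply_symm_apply] at h1
    have hxa : 0 < dist x a := by
      rw [dist_pos]; rintro rfl
      rw [dist_self] at hc
      exact absurd hc (not_lt.2 (by positivity))
    have : t * dist x b ≤ t * (1 / (2 * t) * dist x a) := by gcongr
    have e : t * (1 / (2 * t) * dist x a) = dist x a / 2 := by field_simp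
    linarith
  · intro T hT
    obtain ⟨s, hs, h⟩ := hf.1 (1 / T) (by positivity)
    refine ⟨1 / (2 * s), by positivity, fun x a b hab => ?_⟩
    by_contra! hc
    have h1 := h (f.symm x) (f.symm b) (f.symm a) (by
      rw [one_div, inv_mul_eq_div, le_div_iff₀ hT]; linarith)
    simp only [f.apply_symm_apply] at h1
    have hxa : 0 < dist x a := by
      rw [dist_pos]; rintro rfl
      rw [dist_self] at hc
      exact absurd hc (not_lt.2 (by positivity))
    have : 1 / (2 * s) * dist x b ≤ 1 / (2 * s) * (s * dist x a) := by gcongr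
    have e : 1 / (2 * s) * (s * dist x a) = dist x a / 2 := by field_simp
    linarith

variable {f : X ≃ₜ Y} [MeasurableSpace Y] {ν : Measure Y}

/-- The image of the ball contains a ball about f x of radius comparable to d(f x, f z), and lower
regularity bounds its measure from below. Taking T ≥ 1 keeps the radius at most d(f x, f z), where
lower regularity is available. -/
lemma WeakQS.exists_ofReal_dist_rpow_le (hf : WeakQS f) {n c : ℝ} (hn : 0 < n) (hc : 0 < c)
    (hl : LowerRegular n c ν) {t : ℝ} (ht : 0 < t) :
    ∃ C : ℝ≥0, ∀ (x z : X) (ρ : ℝ), dist x z ≤ t * ρ →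
      ENNReal.ofReal (dist (f x) (f z) ^ n) ≤ C * ν (f '' ball x ρ) := by
  obtain ⟨T', hT', h⟩ := hf.1 t ht
  set T := max T' 1
  have hT : 0 < T := by positivity
  refine ⟨(T ^ n / c).toNNReal, fun x z ρ hz => ?_⟩
  rcases eq_or_ne x z with rfl | hxz
  · simp [Real.zero_rpow hn.ne']
  have hd : 0 < dist (f x) (f z) := dist_pos.2 (f.injective.ne hxz)
  set R := dist (f x) (f z) / T with hR
  have hR0 : 0 < R := by positivity
  have hsub : ball (f x) R ⊆ f '' ball x ρ := by
    intro y hy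
    refine ⟨f.symm y, ?_, f.apply_symm_apply y⟩
    by_contra hc
    have hc : ρ ≤ dist x (f.symm y) := by rw [dist_comm]; exact not_lt.1 hc
    have h1 := h x z (f.symm y) (hz.trans (by gcongr))
    rw [f.apply_symm_apply] at h1
    rw [mem_ball, dist_comm, hR, lt_div_iff₀ hT] at hy
    have : T' * dist (f x) y ≤ T * dist (f x) y := by gcongr; exact le_max_left _ _
    linarith
  calc _ = ENNReal.ofReal (T ^ n / c) * ENNReal.ofReal (c * R ^ n) := by
        rw [← ENNReal.ofReal_mul (by positivity), hR, Real.div_rpow hd.le hT.le]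
        congr 1; field_simp
    _ ≤ _ := by
        rw [ENNReal.ofReal]
        gcongr
        exact (hl (f x) (f x) (f z) R hR0 (div_le_self hd.le (le_max_right _ _))).trans
          (measure_mono hsub)

/-- Comparison with one fixed point b ≠ x shows that the image of the ball is bounded. -/
lemma WeakQS.measure_image_ball_lt_top [Nontrivial X] (hf : WeakQS f) (hν : BallsFinitePos ν)
    (x : X) {ρ : ℝ} (hρ : 0 < ρ) : ν (f '' ball x ρ) < ∞ := by
  obtain ⟨b, hb⟩ := exists_ne x
  have hd : 0 < dist x b := dist_pos.2 hb.symm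
  obtain ⟨T, hT, h⟩ := hf.1 (ρ / dist x b) (by positivity)
  have hdf : 0 < dist (f x) (f b) := dist_pos.2 (f.injective.ne hb.symm)
  refine (measure_mono ?_).trans_lt (hν (f x) (T * dist (f x) (f b) + 1) (by positivity)).2
  rintro _ ⟨a, ha, rfl⟩
  have := h x a b (by rw [div_mul_cancel₀ _ hd.ne', dist_comm]; exact (mem_ball.1 ha).le)
  rw [mem_ball, dist_comm]
  linarith

lemma BallsFinitePos.measure_image_ball_pos (hν : BallsFinitePos ν) (f : X ≃ₜ Y)
    (x : X) {ρ : ℝ} (hρ : 0 < ρ) : 0 < ν (f '' ball x ρ) := by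
  have ho : IsOpen (f '' ball x ρ) := f.isOpenMap _ isOpen_ball
  obtain ⟨r, hr, hs⟩ := Metric.isOpen_iff.1 ho (f x) (mem_image_of_mem f (mem_ball_self hρ))
  exact (hν (f x) r hr).1.trans_le (measure_mono hs)

end WeakQS

/-! ### Sequence norms and a discrete Young inequality -/

section SequenceNorm

lemma ellENorm_mono (q : ℝ≥0∞) {a b : ℤ → ℝ≥0∞} (h : ∀ k, a k ≤ b k) :
    ellENorm q a ≤ ellENorm q b := by
  unfold ellENorm
  split_ifs
  · exact iSup_mono h
  · refine ENNReal.rpow_le_rpow (ENNReal.tsum_le_tsum fun k => ?_) (by positivity)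
    exact ENNReal.rpow_le_rpow (h k) ENNReal.toReal_nonneg

lemma ellENorm_const_mul {q : ℝ≥0∞} (hq : 0 < q) (c : ℝ≥0∞) (a : ℤ → ℝ≥0∞) :
    ellENorm q (fun k => c * a k) = c * ellENorm q a := by
  unfold ellENorm
  split_ifs with h
  · rw [ENNReal.mul_iSup]
  · have hQ : 0 < q.toReal := ENNReal.toReal_pos hq.ne' h
    simp_rw [ENNReal.mul_rpow_of_nonneg _ _ hQ.le]
    rw [ENNReal.tsum_mul_left, ENNReal.mul_rpow_of_nonneg _ _ (by positivity),
      ← ENNReal.rpow_mul, mul_one_div_cancel hQ.ne', ENNReal.rpow_one]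

lemma le_ellENorm {q : ℝ≥0∞} (hq : 0 < q) (a : ℤ → ℝ≥0∞) (k : ℤ) : a k ≤ ellENorm q a := by
  unfold ellENorm
  split_ifs with h
  · exact le_iSup a k
  · have hQ : 0 < q.toReal := ENNReal.toReal_pos hq.ne' h
    calc a k = (a k ^ q.toReal) ^ (1 / q.toReal) := by
          rw [← ENNReal.rpow_mul, mul_one_div_cancel hQ.ne', ENNReal.rpow_one]
      _ ≤ _ := by gcongr; exact ENNReal.le_tsum (f := fun k => a k ^ q.toReal) k

lemma measurable_ellENorm {X : Type*} [MeasurableSpace X] (q : ℝ≥0∞) {φ : ℤ → X → ℝ≥0∞}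
    (hφ : ∀ j, Measurable (φ j)) : Measurable fun x => ellENorm q fun j => φ j x := by
  unfold ellENorm
  split_ifs
  · exact Measurable.iSup hφ
  · exact (Measurable.tsum fun j => (hφ j).pow_const _).pow_const _

lemma iSup_rpow_le_tsum {ι : Type*} {Q : ℝ} (hQ : 0 < Q) (a : ι → ℝ≥0∞) :
    (⨆ i, a i) ^ Q ≤ ∑' i, a i ^ Q := by
  have : (⨆ i, a i) ^ Q = ⨆ i, a i ^ Q := (ENNReal.orderIsoRpow Q hQ).map_iSup a
  rw [this]
  exact iSup_le fun i => ENNReal.le_tsum (f := fun i => a i ^ Q) i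

/-- A discrete Young inequality for geometrically decaying one-sided convolutions. -/
lemma exists_ellENorm_geom_tsum_le {s : ℝ} (hs : 0 < s) {q : ℝ≥0∞} (hq : 0 < q) :
    ∃ C : ℝ≥0∞, C ≠ ∞ ∧ ∀ a : ℤ → ℝ≥0∞,
      ellENorm q (fun k => ∑' l : ℕ, (2 : ℝ≥0∞) ^ (-(l * s)) * a (k + l)) ≤ C * ellENorm q a := by
  set g := geomConst (s / 2)
  have hg : g ≠ ∞ := geomConst_ne_top (by linarith)
  -- Half of the decay pays for replacing the sum by a supremum. The Q-th power of a supremum is at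
  -- most the sum of Q-th powers, for Q < 1 as well.
  have hpt : ∀ (a : ℤ → ℝ≥0∞) k, ∑' l : ℕ, (2 : ℝ≥0∞) ^ (-(l * s)) * a (k + l) ≤
      g * ⨆ l : ℕ, (2 : ℝ≥0∞) ^ (-(l * (s / 2))) * a (k + l) := by
    intro a k
    rw [show g = _ from (tsum_two_rpow_neg (s / 2)).symm, ← ENNReal.tsum_mul_right]
    refine ENNReal.tsum_le_tsum fun l => ?_
    calc _ = (2 : ℝ≥0∞) ^ (-(l * (s / 2))) * ((2 : ℝ≥0∞) ^ (-(l * (s / 2))) * a (k + l)) := by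
          rw [← mul_assoc, ← two_rpow_add]; congr 2; ring
      _ ≤ _ := by
          gcongr
          exact le_iSup (fun l : ℕ => (2 : ℝ≥0∞) ^ (-(l * (s / 2))) * a (k + l)) l
  by_cases h : q = ∞
  · refine ⟨g, hg, fun a => ?_⟩
    simp only [ellENorm, if_pos h]
    refine iSup_le fun k => (hpt a k).trans ?_
    gcongr
    refine iSup_le fun l => ?_
    calc _ ≤ 1 * a (k + l) := by
          gcongr
          calc (2 : ℝ≥0∞) ^ (-(l * (s / 2))) ≤ 2 ^ (0 : ℝ) :=
                ENNReal.rpow_le_rpow_of_exponent_le (by norm_num) (by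
                  have : (0 : ℝ) ≤ l * (s / 2) := by positivity
                  linarith)
            _ = 1 := ENNReal.rpow_zero
      _ ≤ _ := by rw [one_mul]; exact le_iSup a (k + l)
  · set Q := q.toReal
    have hQ : 0 < Q := ENNReal.toReal_pos hq.ne' h
    set g' := geomConst (s / 2 * Q)
    refine ⟨(g ^ Q * g') ^ (1 / Q), ?_, fun a => ?_⟩
    · have : g' ≠ ∞ := geomConst_ne_top (by positivity)
      have : g ^ Q ≠ ∞ := ENNReal.rpow_ne_top_of_nonneg hQ.le hg
      exact ENNReal.rpow_ne_top_of_nonneg (by positivity) (by finiteness)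
    simp only [ellENorm, if_neg h]
    rw [← ENNReal.mul_rpow_of_nonneg _ _ (by positivity)]
    refine ENNReal.rpow_le_rpow ?_ (by positivity)
    calc _ ≤ ∑' k : ℤ, g ^ Q * ∑' l : ℕ, (2 : ℝ≥0∞) ^ (-(l * (s / 2 * Q))) * a (k + l) ^ Q := by
          refine ENNReal.tsum_le_tsum fun k => ?_
          refine (ENNReal.rpow_le_rpow (hpt a k) hQ.le).trans ?_
          rw [ENNReal.mul_rpow_of_nonneg _ _ hQ.le]
          gcongr
          refine (iSup_rpow_le_tsum hQ _).trans (ENNReal.tsum_le_tsum fun l => ?_)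
          rw [ENNReal.mul_rpow_of_nonneg _ _ hQ.le, ← ENNReal.rpow_mul]
          apply le_of_eq; congr 2; ring
      _ = g ^ Q * ∑' l : ℕ, (2 : ℝ≥0∞) ^ (-(l * (s / 2 * Q))) * ∑' k : ℤ, a (k + l) ^ Q := by
          rw [ENNReal.tsum_mul_left, ENNReal.tsum_comm]
          simp_rw [ENNReal.tsum_mul_left]
      _ = g ^ Q * ∑' l : ℕ, (2 : ℝ≥0∞) ^ (-(l * (s / 2 * Q))) * ∑' k : ℤ, a k ^ Q := by
          congr 2 with l
          rw [← (Equiv.addRight (l : ℤ)).tsum_eq fun k => a k ^ Q]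
          rfl
      _ = _ := by rw [ENNReal.tsum_mul_right, tsum_two_rpow_neg, mul_assoc]

end SequenceNorm

/-! ### The pulled-back gradient and its mixed norm -/

section PulledBackGradient

variable {X Y : Type*} [MetricSpace X] [MetricSpace Y]

/-- The dyadic scales of `dist (f z) (f w)` when `dist z w` is comparable to `2 ^ (-j)`. -/
def window (f : X ≃ₜ Y) (κ : ℝ) (j : ℤ) (z : X) : Set ℤ :=
  {i | ∃ w, κ * 2 ^ (-j) < dist z w ∧ dist z w < κ⁻¹ * 2 ^ (-j) ∧
    2 ^ (-i - 2) < dist (f z) (f w) ∧ dist (f z) (f w) < 2 ^ (-i + 1)}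

/-- The pull-back of a fractional gradient under `f`, with density `J`. -/
def pullGrad (f : X ≃ₜ Y) (κ p : ℝ) (J : X → ℝ≥0∞) (G : ℤ → Y → ℝ≥0∞) (j : ℤ) (z : X) : ℝ≥0∞ :=
  J z ^ (1 / p) * ⨆ i, {z | i ∈ window f κ j z}.indicator (fun z => G i (f z)) z

variable {f : X ≃ₜ Y} {κ p : ℝ} {J : X → ℝ≥0∞} {G : ℤ → Y → ℝ≥0∞}

/-- This is why the inequalities in `window` are strict: a union over uncountably many w remains
open, so the pulled-back gradient is measurable. -/
lemma isOpen_setOf_mem_window (f : X ≃ₜ Y) (κ : ℝ) (i j : ℤ) :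
    IsOpen {z | i ∈ window f κ j z} := by
  have : {z | i ∈ window f κ j z} = ⋃ w, {z | κ * 2 ^ (-j) < dist z w} ∩
      {z | dist z w < κ⁻¹ * 2 ^ (-j)} ∩ ({z | 2 ^ (-i - 2) < dist (f z) (f w)} ∩
      {z | dist (f z) (f w) < 2 ^ (-i + 1)}) := by
    ext z
    simp [window, and_assoc]
  rw [this]
  have hf := f.continuous
  refine isOpen_iUnion fun w => ((isOpen_lt ?_ ?_).inter (isOpen_lt ?_ ?_)).inter
    ((isOpen_lt ?_ ?_).inter (isOpen_lt ?_ ?_)) <;> fun_prop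

lemma le_pullGrad {i j : ℤ} {z : X} (h : i ∈ window f κ j z) :
    J z ^ (1 / p) * G i (f z) ≤ pullGrad f κ p J G j z := by
  unfold pullGrad
  gcongr
  refine le_trans (le_of_eq ?_)
    (le_iSup (fun i => {z | i ∈ window f κ j z}.indicator (fun z => G i (f z)) z) i)
  exact (indicator_of_mem (s := {z | i ∈ window f κ j z}) h fun z => G i (f z)).symm

/-- Two points with images at comparable distances from f z are themselves at comparable distances
from z, so a common i forces j and j' to be close. The value 1/8 is the ratio of the two end points
2^(-i-2) and 2^(-i+1). -/
lemma WeakQS.exists_window_le (hf : WeakQS f) (hκ : 0 < κ) :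
    ∃ N : ℕ, ∀ (z : X) (i j j' : ℤ), i ∈ window f κ j z → i ∈ window f κ j' z → j' ≤ j + N := by
  obtain ⟨t, ht, h⟩ := hf.2 (1 / 8) (by norm_num)
  obtain ⟨N, hN⟩ := pow_unbounded_of_one_lt (κ⁻¹ * κ⁻¹ / t) (one_lt_two (α := ℝ))
  refine ⟨N, fun z i j j' hj hj' => ?_⟩
  obtain ⟨w, hw1, -, -, hw4⟩ := hj
  obtain ⟨w', -, hw2, hw3, -⟩ := hj'
  have hlt : t * dist z w < dist z w' := by
    by_contra! hc
    have h1 := h z w' w hc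
    have e : (2 : ℝ) ^ (-i + 1) = 8 * 2 ^ (-i - 2) := by
      rw [zpow_add₀ (by norm_num), zpow_sub₀ (by norm_num)]; norm_num; ring
    rw [e] at hw4
    linarith
  have h2 : t * (κ * 2 ^ (-j)) < κ⁻¹ * 2 ^ (-j') := by
    calc _ < t * dist z w := by gcongr
      _ < _ := hlt.trans hw2
  by_contra! hc
  have h3 : (2 : ℝ) ^ (j' - j) < 2 ^ (N : ℤ) := by
    rw [zpow_natCast]
    refine lt_trans ?_ hN
    rw [lt_div_iff₀ ht, zpow_sub₀ (by norm_num)]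
    rw [zpow_neg, zpow_neg] at h2
    have hj0 : (0 : ℝ) < 2 ^ j := by positivity
    have hj0' : (0 : ℝ) < 2 ^ j' := by positivity
    calc (2 : ℝ) ^ j' / 2 ^ j * t = (t * (κ * (2 ^ j)⁻¹)) * (2 ^ j' * κ⁻¹) := by field_simp
      _ < (κ⁻¹ * (2 ^ j')⁻¹) * (2 ^ j' * κ⁻¹) := by gcongr
      _ = _ := by field_simp
  rw [zpow_lt_zpow_iff_right₀ (by norm_num)] at h3
  omega

/-- After the supremum over i is bounded by a sum and the order of summation exchanged, each i is
counted for at most 2N + 1 values of j. -/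
lemma WeakQS.exists_ellENorm_pullGrad_le (hf : WeakQS f) (hκ : 0 < κ) {q : ℝ≥0∞} (hq : 0 < q) :
    ∃ C : ℝ≥0∞, C ≠ ∞ ∧ ∀ (p : ℝ) (J : X → ℝ≥0∞) (G : ℤ → Y → ℝ≥0∞) (z : X),
      ellENorm q (fun j => pullGrad f κ p J G j z) ≤
        C * (J z ^ (1 / p) * ellENorm q fun i => G i (f z)) := by
  obtain ⟨N, hN⟩ := hf.exists_window_le hκ
  suffices hs : ∃ C : ℝ≥0∞, C ≠ ∞ ∧ ∀ (G : ℤ → Y → ℝ≥0∞) (z : X),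
      ellENorm q (fun j => ⨆ i, {z | i ∈ window f κ j z}.indicator (fun z => G i (f z)) z) ≤
        C * ellENorm q fun i => G i (f z) by
    obtain ⟨C, hC, h⟩ := hs
    refine ⟨C, hC, fun p J G z => ?_⟩
    unfold pullGrad
    rw [ellENorm_const_mul hq, mul_left_comm]
    gcongr
    exact h G z
  by_cases h : q = ∞
  · refine ⟨1, by simp, fun G z => ?_⟩
    simp only [ellENorm, if_pos h, one_mul]
    refine iSup_le fun j => iSup_mono fun i => indicator_le_self _ _ z
  · set Q := q.toReal with hQdef
    have hQ : 0 < Q := ENNReal.toReal_pos hq.ne' h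
    refine ⟨((2 * N + 1 : ℕ) : ℝ≥0∞) ^ (1 / Q), ?_, fun G z => ?_⟩
    · exact ENNReal.rpow_ne_top_of_nonneg (by positivity) (ENNReal.natCast_ne_top _)
    simp only [ellENorm, if_neg h, ← hQdef]
    rw [← ENNReal.mul_rpow_of_nonneg _ _ (by positivity)]
    refine ENNReal.rpow_le_rpow ?_ (by positivity)
    calc _ ≤ ∑' j : ℤ, ∑' i : ℤ,
          {z | i ∈ window f κ j z}.indicator (fun z => G i (f z)) z ^ Q :=
          ENNReal.tsum_le_tsum fun j => iSup_rpow_le_tsum hQ _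
      _ = ∑' i : ℤ, ∑' j : ℤ,
          {z | i ∈ window f κ j z}.indicator (fun z => G i (f z)) z ^ Q := ENNReal.tsum_comm
      _ ≤ ∑' i : ℤ, ((2 * N + 1 : ℕ) : ℝ≥0∞) * G i (f z) ^ Q := by
          refine ENNReal.tsum_le_tsum fun i => ?_
          have hout : ∀ j, i ∉ window f κ j z →
              {z | i ∈ window f κ j z}.indicator (fun z => G i (f z)) z ^ Q = 0 := by
            intro j hj
            rw [indicator_of_notMem (s := {z | i ∈ window f κ j z}) hj,
              ENNReal.zero_rpow_of_pos hQ]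
          by_cases hex : ∃ j₀, i ∈ window f κ j₀ z
          · obtain ⟨j₀, hj₀⟩ := hex
            rw [tsum_eq_sum (s := Finset.Icc (j₀ - N) (j₀ + N))]
            · refine (Finset.sum_le_card_nsmul _ _ (G i (f z) ^ Q) fun j _ => ?_).trans ?_
              · exact ENNReal.rpow_le_rpow (indicator_le_self _ _ z) hQ.le
              · rw [nsmul_eq_mul, Int.card_Icc]
                gcongr
                omega
            · intro j hj
              refine hout j fun hjw => hj ?_
              have h1 := hN z i j₀ j hj₀ hjw
              have h2 := hN z i j j₀ hjw hj₀
              rw [Finset.mem_Icc]; omega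
          · push Not at hex
            rw [ENNReal.tsum_eq_zero.2 fun j => hout j (hex j)]
            exact zero_le
      _ = _ := ENNReal.tsum_mul_left

variable [MeasurableSpace X] [MeasurableSpace Y]

/-- The change of variables inequality satisfied by a volume derivative. -/
def ChangeOfVariablesLE (μ : Measure X) (ν : Measure Y) (f : X ≃ₜ Y) (J : X → ℝ≥0∞) : Prop :=
  ∀ G : Y → ℝ≥0∞, Measurable G → ∫⁻ z, J z * G (f z) ∂μ ≤ ∫⁻ y, G y ∂ν

lemma WeakQS.exists_lintegral_pullGrad_le (hf : WeakQS f) (hκ : 0 < κ) (hp : 0 < p)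
    {μ : Measure X} {ν : Measure Y} (hJ : ChangeOfVariablesLE μ ν f J)
    {q : ℝ≥0∞} (hq : 0 < q) :
    ∃ C : ℝ≥0∞, C ≠ ∞ ∧ ∀ G : ℤ → Y → ℝ≥0∞, (∀ i, Measurable (G i)) →
      ∫⁻ z, ellENorm q (fun j => pullGrad f κ p J G j z) ^ p ∂μ ≤
        C * ∫⁻ y, ellENorm q (fun i => G i y) ^ p ∂ν := by
  obtain ⟨C, hC, h⟩ := hf.exists_ellENorm_pullGrad_le hκ hq
  refine ⟨C ^ p, ENNReal.rpow_ne_top_of_nonneg hp.le hC, fun G hG => ?_⟩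
  calc _ ≤ ∫⁻ z, C ^ p * (J z * ellENorm q (fun i => G i (f z)) ^ p) ∂μ := by
        refine lintegral_mono fun z => (ENNReal.rpow_le_rpow (h p J G z) hp.le).trans (le_of_eq ?_)
        rw [ENNReal.mul_rpow_of_nonneg _ _ hp.le, ENNReal.mul_rpow_of_nonneg _ _ hp.le,
          ← ENNReal.rpow_mul, one_div_mul_cancel hp.ne', ENNReal.rpow_one]
    _ = C ^ p * ∫⁻ z, J z * ellENorm q (fun i => G i (f z)) ^ p ∂μ :=
        lintegral_const_mul' _ _ (ENNReal.rpow_ne_top_of_nonneg hp.le hC)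
    _ ≤ _ := by
        gcongr
        exact hJ _ ((measurable_ellENorm q hG).pow_const p)

variable [BorelSpace X] [BorelSpace Y]

lemma measurable_pullGrad (hJ : Measurable J) (hG : ∀ i, Measurable (G i)) (j : ℤ) :
    Measurable (pullGrad f κ p J G j) := by
  refine (hJ.pow_const _).mul (Measurable.iSup fun i => ?_)
  exact ((hG i).comp f.continuous.measurable).indicator
    (isOpen_setOf_mem_window f κ i j).measurableSet

end PulledBackGradient

/-! ### Good parts of balls and oscillation between good points -/

section GoodParts

variable {X Y : Type*} [MetricSpace X] [MetricSpace Y] [MeasurableSpace X] [MeasurableSpace Y]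

/-- The part of a ball on which the density `J` is at least a multiple of its mean value. -/
def goodPart (μ : Measure X) (ν : Measure Y) (f : X ≃ₜ Y) (J : X → ℝ≥0∞) (c : ℝ≥0)
    (x : X) (ρ : ℝ) : Set X :=
  {z ∈ ball x ρ | c * ν (f '' ball x ρ) ≤ J z * μ (ball x ρ)}

/-- In every ball, the density `J` is bounded below by a multiple of its mean value on a part of
proportional measure. -/
def HasGoodParts (μ : Measure X) (ν : Measure Y) (f : X ≃ₜ Y) (J : X → ℝ≥0∞) : Prop :=
  ∃ ε c : ℝ≥0, 0 < ε ∧ 0 < c ∧ ∀ (x a b : X) (ρ : ℝ), 0 < ρ → ρ ≤ dist a b →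
    ε * μ (ball x ρ) ≤ μ (goodPart μ ν f J c x ρ)

/-- `G` is an `s`-gradient of `u` outside the set `E`. -/
def GradientOff (s : ℝ) (E : Set Y) (u : Y → ℝ) (G : ℤ → Y → ℝ≥0∞) : Prop :=
  ∀ (i : ℤ) (y y' : Y), y ∉ E → y' ∉ E → (2 : ℝ) ^ (-i - 1) ≤ dist y y' →
    dist y y' < (2 : ℝ) ^ (-i) →
      edist (u y) (u y') ≤ ENNReal.ofReal (dist y y' ^ s) * (G i y + G i y')

variable {μ : Measure X} {ν : Measure Y} {f : X ≃ₜ Y} {J : X → ℝ≥0∞} {n₁ n₂ s₁ s₂ p κ c₂ : ℝ}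
  {K c : ℝ≥0}

/-- The chain is d(f z, f w)^n₂ ≲ ν(f(B)) ≲ J(z) μ(B) ≲ J(z) ρ^n₁ with B = B(x, ρ), followed by the
p-th root. Only z has to be good. -/
lemma WeakQS.exists_ofReal_dist_rpow_le_of_mem_goodPart (hf : WeakQS f)
    (hK : UpperRegular n₁ K μ) (hn₂ : 0 < n₂) (hc₂ : 0 < c₂) (hl : LowerRegular n₂ c₂ ν)
    (hp : 0 < p) (hs₁ : s₁ * p = n₁) (hs₂ : s₂ * p = n₂) (hc : 0 < c) (hκ : 0 < κ) :
    ∃ C : ℝ≥0∞, C ≠ ∞ ∧ ∀ (x z w : X) (ρ : ℝ), 0 < ρ → z ∈ goodPart μ ν f J c x ρ →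
      dist z w < κ⁻¹ * ρ → ENNReal.ofReal (dist (f z) (f w) ^ s₂) ≤
        C * ENNReal.ofReal (ρ ^ s₁) * J z ^ (1 / p) := by
  obtain ⟨C₀, hC₀⟩ := hf.exists_ofReal_dist_rpow_le hn₂ hc₂ hl (t := 1 + κ⁻¹) (by positivity)
  set C₁ : ℝ≥0∞ := ENNReal.ofReal (2 ^ n₂) * (C₀ * ((c⁻¹ : ℝ≥0) * K)) with hC₁
  have hC₁t : C₁ ≠ ∞ := by finiteness
  refine ⟨C₁ ^ (1 / p), ENNReal.rpow_ne_top_of_nonneg (by positivity) hC₁t,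
    fun x z w ρ hρ hz hzw => ?_⟩
  set B := ball x ρ
  have hκ' : 0 < κ⁻¹ := by positivity
  have hxz : dist x z < ρ := by rw [dist_comm]; exact hz.1
  have h1 := hC₀ x z ρ (by nlinarith)
  have h2 := hC₀ x w ρ (by nlinarith [dist_triangle x z w])
  have h3 : ENNReal.ofReal (dist (f z) (f w) ^ n₂) ≤
      ENNReal.ofReal (2 ^ n₂) * (C₀ * ν (f '' B)) := by
    set m := max (dist (f x) (f z)) (dist (f x) (f w)) with hm
    have hd : dist (f z) (f w) ≤ 2 * m := by
      have := dist_triangle_left (f z) (f w) (f x)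
      have := le_max_left (dist (f x) (f z)) (dist (f x) (f w))
      have := le_max_right (dist (f x) (f z)) (dist (f x) (f w))
      linarith
    have hm0 : 0 ≤ m := dist_nonneg.trans (le_max_left _ _)
    calc _ ≤ ENNReal.ofReal ((2 * m) ^ n₂) := by gcongr
      _ = ENNReal.ofReal (2 ^ n₂) * ENNReal.ofReal (m ^ n₂) := by
          rw [Real.mul_rpow (by norm_num) hm0, ENNReal.ofReal_mul (by positivity)]
      _ ≤ _ := by
          gcongr
          rcases max_choice (dist (f x) (f z)) (dist (f x) (f w)) with h | h <;> rw [hm, h]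
          exacts [h1, h2]
  have h4 : ν (f '' B) ≤ (c⁻¹ : ℝ≥0) * K * (ENNReal.ofReal (ρ ^ n₁) * J z) := by
    calc ν (f '' B) = (c⁻¹ : ℝ≥0) * (c * ν (f '' B)) := by
          rw [← mul_assoc, ← ENNReal.coe_mul, inv_mul_cancel₀ hc.ne', ENNReal.coe_one, one_mul]
      _ ≤ (c⁻¹ : ℝ≥0) * (J z * (K * ENNReal.ofReal (ρ ^ n₁))) := by
          exact mul_le_mul' le_rfl (hz.2.trans (mul_le_mul' le_rfl (hK x ρ hρ)))
      _ = _ := by ring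
  have h5 : ENNReal.ofReal (dist (f z) (f w) ^ n₂) ≤
      C₁ * (ENNReal.ofReal (ρ ^ n₁) * J z) := by
    refine h3.trans ?_
    calc _ ≤ ENNReal.ofReal (2 ^ n₂) * (C₀ * ((c⁻¹ : ℝ≥0) * K *
          (ENNReal.ofReal (ρ ^ n₁) * J z))) := by gcongr
      _ = _ := by rw [hC₁]; ring
  have e : ∀ {a s n : ℝ}, 0 ≤ a → s * p = n →
      ENNReal.ofReal (a ^ s) = ENNReal.ofReal (a ^ n) ^ (1 / p) := by
    intro a s n ha h
    rw [ENNReal.ofReal_rpow_of_nonneg (by positivity) (by positivity), ← Real.rpow_mul ha, ← h]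
    congr 2; field_simp
  rw [e dist_nonneg hs₂, e hρ.le hs₁, mul_assoc, ← ENNReal.mul_rpow_of_nonneg _ _ (by positivity),
    ← ENNReal.mul_rpow_of_nonneg _ _ (by positivity)]
  exact ENNReal.rpow_le_rpow h5 (by positivity)

/-- Oscillation estimate between points of good parts at comparable scales. -/
lemma WeakQS.exists_edist_le_of_mem_goodPart (hf : WeakQS f)
    (hK : UpperRegular n₁ K μ) (hn₂ : 0 < n₂) (hc₂ : 0 < c₂) (hl : LowerRegular n₂ c₂ ν)
    (hp : 0 < p) (hs₁ : s₁ * p = n₁) (hs₂ : s₂ * p = n₂) (hc : 0 < c) (hκ : 0 < κ) :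
    ∃ C : ℝ≥0∞, C ≠ ∞ ∧ ∀ (u : Y → ℝ) (E : Set Y) (G : ℤ → Y → ℝ≥0∞), GradientOff s₂ E u G →
      ∀ (x x' z z' : X) (j j' : ℤ), z ∈ goodPart μ ν f J c x (2 ^ (-j)) →
        z' ∈ goodPart μ ν f J c x' (2 ^ (-j')) → f z ∉ E → f z' ∉ E →
        κ * 2 ^ (-j) < dist z z' → dist z z' < κ⁻¹ * 2 ^ (-j) →
        κ * 2 ^ (-j') < dist z z' → dist z z' < κ⁻¹ * 2 ^ (-j') →
        edist (u (f z)) (u (f z')) ≤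
          C * (ENNReal.ofReal ((2 ^ (-j)) ^ s₁) * pullGrad f κ p J G j z) +
          C * (ENNReal.ofReal ((2 ^ (-j')) ^ s₁) * pullGrad f κ p J G j' z') := by
  obtain ⟨C, hC, h⟩ := hf.exists_ofReal_dist_rpow_le_of_mem_goodPart (J := J) hK hn₂ hc₂ hl hp
    hs₁ hs₂ hc hκ
  refine ⟨C, hC, fun u E G hG x x' z z' j j' hz hz' hzE hzE' h1 h2 h3 h4 => ?_⟩
  have hd0 : 0 < dist z z' := lt_of_le_of_lt (by positivity) h1
  have hd : 0 < dist (f z) (f z') := dist_pos.2 (f.injective.ne (dist_pos.1 hd0))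
  -- The dyadic scale of d(f z, f z') lies in the windows of both points, each serving as witness
  -- for the other.
  obtain ⟨i, hi1, hi2⟩ := exists_mem_Ico_zpow hd (one_lt_two (α := ℝ))
  obtain ⟨i, rfl⟩ : ∃ k : ℤ, i = -k - 1 := ⟨-i - 1, by ring⟩
  rw [sub_add_cancel] at hi2
  have hi3 : (2 : ℝ) ^ (-i - 2) < dist (f z) (f z') :=
    (zpow_lt_zpow_right₀ one_lt_two (by omega)).trans_le hi1
  have hi4 : dist (f z) (f z') < (2 : ℝ) ^ (-i + 1) :=
    hi2.trans (zpow_lt_zpow_right₀ one_lt_two (by omega))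
  have hw : i ∈ window f κ j z := ⟨z', h1, h2, hi3, hi4⟩
  have hw' : i ∈ window f κ j' z' :=
    ⟨z, by rwa [dist_comm], by rwa [dist_comm], by rwa [dist_comm], by rwa [dist_comm]⟩
  refine (hG i _ _ hzE hzE' hi1 hi2).trans ?_
  rw [mul_add]
  gcongr ?_ + ?_
  · calc _ ≤ C * ENNReal.ofReal ((2 ^ (-j)) ^ s₁) * J z ^ (1 / p) * G i (f z) := by
          gcongr; exact h x z z' _ (by positivity) hz h2
      _ = C * (ENNReal.ofReal ((2 ^ (-j)) ^ s₁) * (J z ^ (1 / p) * G i (f z))) := by ring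
      _ ≤ _ := by gcongr; exact le_pullGrad hw
  · calc _ ≤ C * ENNReal.ofReal ((2 ^ (-j')) ^ s₁) * J z' ^ (1 / p) * G i (f z') := by
          gcongr; rw [dist_comm]; exact h x' z' z _ (by positivity) hz' (by rwa [dist_comm])
      _ = C * (ENNReal.ofReal ((2 ^ (-j')) ^ s₁) * (J z' ^ (1 / p) * G i (f z'))) := by ring
      _ ≤ _ := by gcongr; exact le_pullGrad hw'

/-- Good parts can be kept away from the center of the ball. -/
lemma HasGoodParts.exists_measure_sdiff_ball_ge (h : HasGoodParts μ ν f J) (hn₁ : 0 < n₁)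
    (hK : UpperRegular n₁ K μ) {c₁ : ℝ} (hc₁ : 0 < c₁) (hl : LowerRegular n₁ c₁ μ)
    (hμ : BallsFinitePos μ) :
    ∃ (c : ℝ≥0) (δ c' : ℝ), 0 < c ∧ 0 < δ ∧ δ < 1 ∧ 0 < c' ∧
      ∀ (x a b : X) (ρ : ℝ), 0 < ρ → ρ ≤ dist a b →
        ENNReal.ofReal (c' * ρ ^ n₁) ≤ μ (goodPart μ ν f J c x ρ \ ball x (δ * ρ)) := by
  obtain ⟨ε, c, hε, hc, h⟩ := h
  -- The removed central ball has at most half the measure guaranteed for the good part.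
  obtain ⟨δ, hδ, hδ1, hδb⟩ := hK.exists_measure_ball_mul_le hn₁ hc₁ hl
    (ε := (ε / 2 : ℝ≥0)) (by exact_mod_cast half_pos hε)
  refine ⟨c, δ, ε / 2 * c₁, hc, hδ, hδ1, by positivity, fun x a b ρ hρ hab => ?_⟩
  have h1 := h x a b ρ hρ hab
  have h2 := hδb x a b ρ hρ hab
  have hfin : ((ε / 2 : ℝ≥0) : ℝ≥0∞) * μ (ball x ρ) ≠ ∞ := by
    have := (hμ x ρ hρ).2.ne
    finiteness
  calc _ = ((ε / 2 : ℝ≥0) : ℝ≥0∞) * ENNReal.ofReal (c₁ * ρ ^ n₁) := by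
        rw [mul_assoc, ENNReal.ofReal_mul (by positivity)]
        congr 1
        rw [← NNReal.coe_two, ← NNReal.coe_div, ENNReal.ofReal_coe_nnreal]
    _ ≤ (ε / 2 : ℝ≥0) * μ (ball x ρ) := by gcongr; exact hl x a b ρ hρ hab
    _ = ε * μ (ball x ρ) - (ε / 2 : ℝ≥0) * μ (ball x ρ) := by
        refine ENNReal.eq_sub_of_add_eq hfin ?_
        rw [← add_mul, ← ENNReal.coe_add, add_halves]
    _ ≤ μ (goodPart μ ν f J c x ρ) - μ (ball x (δ * ρ)) := tsub_le_tsub h1 h2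
    _ ≤ _ := le_measure_sdiff

lemma measurableSet_goodPart [OpensMeasurableSpace X] (hJ : Measurable J) (c : ℝ≥0) (x : X)
    (ρ : ℝ) : MeasurableSet (goodPart μ ν f J c x ρ) :=
  measurableSet_ball.inter (measurableSet_le measurable_const (hJ.mul_const _))

end GoodParts

/-! ### Selecting points below the average; approximate continuity -/

section Selection

variable {X : Type*} [MetricSpace X] [MeasurableSpace X] {μ : Measure X} {n : ℝ} {K : ℝ≥0}

/-- Off any null set, some point of T has a value at most the mean over T, and that mean is at most
1/c times the normalized integral over the whole ball. -/
lemma exists_mem_le_dyAvg (hμ : BallsFinitePos μ) {φ : X → ℝ≥0∞} (hφ : Measurable φ) {c : ℝ} (hc : 0 < c) {x : X} {j : ℤ}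
    {T N : Set X} (hT : MeasurableSet T) (hTB : T ⊆ ball x (2 ^ (-j)))
    (hTμ : ENNReal.ofReal (c * (2 ^ (-j)) ^ n) ≤ μ T) (hN : μ N = 0) :
    ∃ z ∈ T, z ∉ N ∧ φ z ≤ ENNReal.ofReal c⁻¹ * dyAvg n μ j φ x := by
  have h2 : (0 : ℝ) < 2 ^ (-j) := by positivity
  have hpos : 0 < ENNReal.ofReal (c * (2 ^ (-j)) ^ n) := ENNReal.ofReal_pos.2 (by positivity)
  have : IsFiniteMeasure (μ.restrict T) :=
    ⟨by rw [Measure.restrict_apply_univ]; exact (measure_mono hTB).trans_lt (hμ x _ h2).2⟩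
  have hT0 : μ.restrict T ≠ 0 := by
    rw [ne_eq, Measure.restrict_eq_zero]
    exact (hpos.trans_le hTμ).ne'
  have hN' : μ.restrict T (N ∪ Tᶜ) = 0 := by
    refine measure_union_null ?_ ?_
    · exact le_antisymm ((Measure.restrict_apply_le _ _).trans hN.le) zero_le
    · rw [Measure.restrict_apply hT.compl, compl_inter_self, measure_empty]
  obtain ⟨z, hz, hle⟩ := exists_notMem_null_le_laverage hT0 hφ.aemeasurable hN'
  rw [mem_union, not_or, notMem_compl_iff] at hz
  refine ⟨z, hz.2, hz.1, hle.trans ?_⟩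
  rw [setLAverage_eq]
  calc _ ≤ (∫⁻ y in ball x (2 ^ (-j)), φ y ∂μ) / ENNReal.ofReal (c * (2 ^ (-j)) ^ n) := by
        gcongr
    _ = _ := by
        unfold dyAvg
        rw [ENNReal.div_eq_inv_mul, ← ENNReal.ofReal_inv_of_pos (by positivity), mul_inv,
          ENNReal.ofReal_mul (by positivity), ← Real.rpow_neg h2.le, mul_assoc]

lemma tendsto_two_zpow_neg_atTop : Tendsto (fun j : ℤ => (2 : ℝ) ^ (-j)) atTop (𝓝[>] 0) := by
  refine tendsto_nhdsWithin_iff.2 ⟨?_, Eventually.of_forall fun j => by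
    simp only [mem_Ioi]; positivity⟩
  rw [Metric.tendsto_atTop]
  intro ε hε
  obtain ⟨N, hN⟩ := exists_pow_lt_of_lt_one hε (by norm_num : (1 / 2 : ℝ) < 1)
  refine ⟨N, fun j hj => ?_⟩
  rw [Real.dist_eq, sub_zero, abs_of_pos (by positivity)]
  refine lt_of_le_of_lt ?_ hN
  calc (2 : ℝ) ^ (-j) ≤ 2 ^ (-(N : ℤ)) := zpow_le_zpow_right₀ (by norm_num) (by omega)
    _ = _ := by rw [zpow_neg, zpow_natCast, one_div, inv_pow]

/-- Measurable functions are approximately continuous almost everywhere. -/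
lemma ae_eventually_measure_dist_gt_le [BorelSpace X] [SecondCountableTopology X]
    [IsLocallyFiniteMeasure μ] [IsUnifLocDoublingMeasure μ] (hμ : BallsFinitePos μ)
    (hK : UpperRegular n K μ) (hK1 : 1 ≤ K) {v : X → ℝ} (hv : AEMeasurable v μ) :
    ∀ᵐ x ∂μ, ∀ η > 0, ∀ c > 0, ∀ᶠ j : ℤ in atTop,
      μ (ball x (2 ^ (-j)) ∩ {z | η < dist (v z) (v x)}) ≤
        ENNReal.ofReal (c * (2 ^ (-j)) ^ n) := by
  set w := hv.mk v with hw
  have hwm : Measurable w := hv.measurable_mk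
  have hvw : v =ᵐ[μ] w := hv.ae_eq_mk
  -- The density theorem is applied to countably many level sets, one for each rational interval, so
  -- no integrability of v is needed.
  have hden : ∀ᵐ x ∂μ, ∀ a b : ℚ, Tendsto
      (fun A => μ ((w ⁻¹' Ioo (a : ℝ) b)ᶜ ∩ A) / μ A)
      ((IsUnifLocDoublingMeasure.vitaliFamily μ 1).filterAt x)
      (𝓝 ((w ⁻¹' Ioo (a : ℝ) b)ᶜ.indicator 1 x)) := by
    rw [ae_all_iff]; intro a
    rw [ae_all_iff]; intro b
    exact VitaliFamily.ae_tendsto_measure_inter_div_of_measurableSet _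
      (hwm measurableSet_Ioo).compl
  filter_upwards [hden, hvw] with x hx hvx η hη c hc
  obtain ⟨a, ha1, ha2⟩ := exists_rat_btwn (show w x - η < w x by linarith)
  obtain ⟨b, hb1, hb2⟩ := exists_rat_btwn (show w x < w x + η by linarith)
  have h1 := (hx a b).comp (IsUnifLocDoublingMeasure.tendsto_closedBall_filterAt (K := 1) μ
    (fun _ : ℤ => x) (fun j : ℤ => (2 : ℝ) ^ (-j)) tendsto_two_zpow_neg_atTop
    (Eventually.of_forall fun j => mem_closedBall_self (by positivity)))
  have hxmem : x ∉ (w ⁻¹' Ioo (a : ℝ) b)ᶜ := by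
    rw [notMem_compl_iff]; exact ⟨ha2, hb1⟩
  rw [indicator_of_notMem hxmem] at h1
  have hK0 : (0 : ℝ) < K := by exact_mod_cast (zero_lt_one.trans_le hK1)
  have h2n : (0 : ℝ) < 2 ^ n := by positivity
  set ε := ENNReal.ofReal (c / (K * 2 ^ n))
  have hε : 0 < ε := ENNReal.ofReal_pos.2 (by positivity)
  filter_upwards [h1.eventually_lt_const hε] with j hj
  have h2 : (0 : ℝ) < 2 ^ (-j) := by positivity
  simp only [Function.comp_apply] at hj
  have hsub : (ball x (2 ^ (-j)) ∩ {z | η < dist (v z) (v x)} : Set X) ≤ᵐ[μ]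
      ((w ⁻¹' Ioo (a : ℝ) b)ᶜ ∩ closedBall x (2 ^ (-j)) : Set X) := by
    filter_upwards [hvw] with z hz hzmem
    refine ⟨fun hc => ?_, ball_subset_closedBall hzmem.1⟩
    have h3 : η < dist (v z) (v x) := hzmem.2
    rw [hz, hvx, Real.dist_eq] at h3
    have h4 : |w z - w x| < η := abs_lt.2 ⟨by linarith [hc.1], by linarith [hc.2]⟩
    linarith
  have hcb : μ (closedBall x (2 ^ (-j))) ≤ μ (ball x (2 * 2 ^ (-j))) :=
    measure_mono (closedBall_subset_ball (by linarith))
  have hcb0 : μ (closedBall x (2 ^ (-j))) ≠ 0 :=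
    ((hμ x _ h2).1.trans_le (measure_mono ball_subset_closedBall)).ne'
  have hcbt : μ (closedBall x (2 ^ (-j))) ≠ ∞ :=
    (hcb.trans_lt (hμ x _ (by positivity)).2).ne
  rw [ENNReal.div_lt_iff (Or.inl hcb0) (Or.inl hcbt)] at hj
  calc _ ≤ ε * μ (closedBall x (2 ^ (-j))) := (measure_mono_ae hsub).trans hj.le
    _ ≤ ε * (K * ENNReal.ofReal ((2 * 2 ^ (-j)) ^ n)) := by
        gcongr; exact hcb.trans (hK x _ (by positivity))
    _ = ENNReal.ofReal (c * (2 ^ (-j)) ^ n) := by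
        rw [← ENNReal.ofReal_coe_nnreal, ← ENNReal.ofReal_mul (by positivity),
          ← ENNReal.ofReal_mul (by positivity), Real.mul_rpow (by norm_num) h2.le]
        congr 1; field_simp

end Selection

/-! ### Pointwise oscillation estimate by telescoping -/

section Composition

variable {X Y : Type*} [MetricSpace X] [MetricSpace Y] [MeasurableSpace X] [MeasurableSpace Y]
  [BorelSpace X] [BorelSpace Y] [SecondCountableTopology X] {μ : Measure X} {ν : Measure Y}
  {f : X ≃ₜ Y} {J : X → ℝ≥0∞} {n₁ n₂ s₁ s₂ p κ c₁ c₂ : ℝ} {K : ℝ≥0}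

lemma ofReal_two_zpow_rpow (j : ℤ) (s : ℝ) :
    ENNReal.ofReal (((2 : ℝ) ^ (-j)) ^ s) = (2 : ℝ≥0∞) ^ (-(j * s)) := by
  rw [← Real.rpow_intCast, ← Real.rpow_mul (by norm_num),
    ← ENNReal.ofReal_rpow_of_pos (by norm_num), ENNReal.ofReal_ofNat]
  congr 1; push_cast; ring

set_option maxHeartbeats 1000000 in
/-- Pointwise estimate of the oscillation of `u ∘ f` by averages of the pulled-back gradient. -/
theorem WeakQS.exists_edist_comp_le [IsLocallyFiniteMeasure μ] [IsUnifLocDoublingMeasure μ]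
    (hf : WeakQS f) (hn₁ : 0 < n₁) (hμ : BallsFinitePos μ)
    (hK : UpperRegular n₁ K μ) (hK1 : 1 ≤ K) (hc₁ : 0 < c₁) (hl₁ : LowerRegular n₁ c₁ μ)
    (hn₂ : 0 < n₂) (hc₂ : 0 < c₂) (hl₂ : LowerRegular n₂ c₂ ν)
    (hnull : ∀ E, ν E = 0 → μ (f ⁻¹' E) = 0) (hJ : Measurable J) (hgood : HasGoodParts μ ν f J)
    (hp : 0 < p) (hs₁ : s₁ * p = n₁) (hs₂ : s₂ * p = n₂) {σ : ℝ} (hσ : 0 < σ) :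
    ∃ κ : ℝ, 0 < κ ∧ ∃ C : ℝ≥0∞, C ≠ ∞ ∧ ∀ (u : Y → ℝ) (E : Set Y) (G : ℤ → Y → ℝ≥0∞),
      GradientOff s₂ E u G → ν E = 0 → (∀ i, Measurable (G i)) → Measurable u →
      ∃ N : Set X, μ N = 0 ∧ ∀ (k : ℤ) (x y : X), x ∉ N → y ∉ N →
        (2 : ℝ) ^ (-k - 1) ≤ dist x y → dist x y < (2 : ℝ) ^ (-k) →
        edist (u (f x)) (u (f y)) ≤ C * (2 : ℝ≥0∞) ^ (-(k * s₁)) *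
          (∑' l : ℕ, (2 : ℝ≥0∞) ^ (-(l * s₁)) *
            dyAvg n₁ μ (k + l) (fun z => pullGrad f κ p J G (k + l) z ^ σ) x ^ (1 / σ) +
          ∑' l : ℕ, (2 : ℝ≥0∞) ^ (-(l * s₁)) *
            dyAvg n₁ μ (k + l) (fun z => pullGrad f κ p J G (k + l) z ^ σ) y ^ (1 / σ)) := by
  obtain ⟨c, δ, c', hc, hδ, hδ1, hc', htrim⟩ :=
    hgood.exists_measure_sdiff_ball_ge hn₁ hK hc₁ hl₁ hμ
  -- Scales are passed in jumps of m. The ball of radius 2^(-(j+m)) then lies deep inside the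
  -- removed ball of radius δ 2^(-j), so consecutive selected points are at distance comparable to
  -- 2^(-j).
  obtain ⟨m, hm⟩ := exists_pow_lt_of_lt_one (show 0 < δ / 8 by positivity)
    (by norm_num : (1 / 2 : ℝ) < 1)
  have hm1 : (m : ℤ) ≠ 0 := by
    intro h
    have : m = 0 := by exact_mod_cast h
    rw [this, pow_zero] at hm; linarith
  set e : ℝ := (1 / 2) ^ m with he
  have he0 : 0 < e := by positivity
  have hstep : ∀ j : ℤ, (2 : ℝ) ^ (-(j + m)) = e * 2 ^ (-j) := by
    intro j
    rw [he, neg_add, zpow_add₀ (by norm_num), zpow_neg 2 (m : ℤ), zpow_natCast, one_div, inv_pow,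
      mul_comm]
  -- Small enough that the distance of two linked points is within a factor κ of each of the scales
  -- 2^(-i) and e · 2^(-i) = 2^(-(i+m)), from above and below.
  set κ : ℝ := δ / 8 * e with hκdef
  have hκ : 0 < κ := by positivity
  have hκe : κ ≤ e / 8 := by rw [hκdef]; nlinarith
  have hκδ : κ ≤ δ / 8 := by rw [hκdef]; nlinarith
  have hκ1 : 8 * e⁻¹ ≤ κ⁻¹ := by
    rw [← one_div, ← one_div, ← mul_div_assoc, div_le_div_iff₀ he0 hκ]; linarith
  have he1 : 4 ≤ e⁻¹ := by rw [← one_div, le_div_iff₀ he0]; linarith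
  obtain ⟨CS, hCS, hosc⟩ := hf.exists_edist_le_of_mem_goodPart (μ := μ) (J := J) (p := p) hK hn₂
    hc₂ hl₂ hp hs₁ hs₂ hc hκ
  set Csel : ℝ≥0∞ := ENNReal.ofReal (c' / 2)⁻¹ ^ (1 / σ) with hCsel
  have hCselt : Csel ≠ ∞ := ENNReal.rpow_ne_top_of_nonneg (by positivity) (by simp)
  refine ⟨κ, hκ, 3 * CS * Csel, by finiteness, fun u E G hG hE hGm hu => ?_⟩
  set v : X → ℝ := fun x => u (f x) with hv
  have hvm : Measurable v := hu.comp f.continuous.measurable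
  set H := pullGrad f κ p J G with hH
  have hHm : ∀ j, Measurable (H j) := measurable_pullGrad hJ hGm
  set a : ℤ → X → ℝ≥0∞ := fun j x => dyAvg n₁ μ j (fun z => H j z ^ σ) x ^ (1 / σ) with ha
  set D : ℤ → X → ℝ≥0∞ := fun j z => CS * (ENNReal.ofReal ((2 ^ (-j)) ^ s₁) * H j z) with hD
  set b : ℤ → X → ℝ≥0∞ := fun j x => CS * Csel * ((2 : ℝ≥0∞) ^ (-(j * s₁)) * a j x) with hb
  set T : X → ℤ → Set X := fun x j =>
    goodPart μ ν f J c x (2 ^ (-j)) \ ball x (δ * 2 ^ (-j)) with hT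
  have hdens := ae_eventually_measure_dist_gt_le hμ hK hK1 hvm.aemeasurable
  set N : Set X := f ⁻¹' E ∪ {x | ¬ ∀ η > 0, ∀ c > 0, ∀ᶠ j : ℤ in atTop,
      μ (ball x (2 ^ (-j)) ∩ {z | η < dist (v z) (v x)}) ≤
        ENNReal.ofReal (c * (2 ^ (-j)) ^ n₁)} with hN
  have hN0 : μ N = 0 := measure_union_null (hnull E hE) hdens
  have hTm : ∀ x j, MeasurableSet (T x j) := fun x j =>
    (measurableSet_goodPart hJ c x _).diff measurableSet_ball
  -- One point does everything at once: it is good, off center and outside the null set, its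
  -- gradient is at most the average, and at fine scales v is within η of v x.
  have hsel : ∀ x, x ∉ N → ∀ η > 0, ∃ J₀ : ℤ, ∀ (j : ℤ) (a' b' : X), (2 : ℝ) ^ (-j) ≤ dist a' b' →
      ∃ z ∈ T x j, f z ∉ E ∧ D j z ≤ b j x ∧ (J₀ ≤ j → dist (v z) (v x) ≤ η) := by
    intro x hx η hη
    rw [hN, mem_union, not_or] at hx
    have hx2 := not_not.1 hx.2
    obtain ⟨J₀, hJ₀⟩ := eventually_atTop.1 (hx2 η hη (c' / 2) (by positivity))
    refine ⟨J₀, fun j a' b' hab => ?_⟩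
    have h2 : (0 : ℝ) < 2 ^ (-j) := by positivity
    have h1 := htrim x a' b' _ h2 hab
    have hle : ENNReal.ofReal (c' / 2 * (2 ^ (-j)) ^ n₁) ≤ μ (T x j) :=
      le_trans (ENNReal.ofReal_le_ofReal (by gcongr; linarith)) h1
    have hsub : T x j ⊆ ball x (2 ^ (-j)) := fun z hz => hz.1.1
    have hconc : ∀ z, H j z ^ σ ≤ ENNReal.ofReal (c' / 2)⁻¹ * dyAvg n₁ μ j (fun z => H j z ^ σ) x →
        D j z ≤ b j x := by
      intro z hz
      have h3 : H j z ≤ Csel * a j x := by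
        have := ENNReal.rpow_le_rpow hz (show 0 ≤ 1 / σ by positivity)
        rwa [← ENNReal.rpow_mul, mul_one_div_cancel hσ.ne', ENNReal.rpow_one,
          ENNReal.mul_rpow_of_nonneg _ _ (by positivity)] at this
      simp only [hD, hb]
      rw [ofReal_two_zpow_rpow]
      calc _ ≤ CS * (2 ^ (-(j * s₁)) * (Csel * a j x)) := by gcongr
        _ = _ := by ring
    by_cases hj : J₀ ≤ j
    · set S := {z | η < dist (v z) (v x)} with hS
      have hSm : MeasurableSet S :=
        measurableSet_lt measurable_const (hvm.dist measurable_const)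
      -- The points where v is far from v x cost at most half of the measure of the trimmed good
      -- part.
      have h4 : ENNReal.ofReal (c' / 2 * (2 ^ (-j)) ^ n₁) ≤ μ (T x j \ S) := by
        have e1 : ENNReal.ofReal (c' / 2 * (2 ^ (-j)) ^ n₁) =
            ENNReal.ofReal (c' * (2 ^ (-j)) ^ n₁) -
              ENNReal.ofReal (c' / 2 * (2 ^ (-j)) ^ n₁) := by
          rw [← ENNReal.ofReal_sub _ (by positivity)]; congr 1; ring
        rw [e1, ← sdiff_inter_self_eq_sdiff]
        refine (tsub_le_tsub h1 (le_trans (measure_mono ?_) (hJ₀ j hj))).trans le_measure_sdiff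
        exact fun z hz => ⟨hsub hz.2, hz.1⟩
      obtain ⟨z, hz, hzE, hzle⟩ := exists_mem_le_dyAvg hμ ((hHm j).pow_const σ)
        (show 0 < c' / 2 by positivity) ((hTm x j).diff hSm) (sdiff_subset.trans hsub) h4
        (hnull E hE)
      exact ⟨z, hz.1, hzE, hconc z hzle, fun _ => not_lt.1 hz.2⟩
    · obtain ⟨z, hz, hzE, hzle⟩ := exists_mem_le_dyAvg hμ ((hHm j).pow_const σ)
        (show 0 < c' / 2 by positivity) (hTm x j) hsub hle (hnull E hE)
      exact ⟨z, hz, hzE, hconc z hzle, fun h => absurd h hj⟩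
  have hchain : ∀ x, x ∉ N → ∀ η > 0, ∀ (j : ℤ) (a' b' : X), (2 : ℝ) ^ (-j) ≤ dist a' b' →
      ∃ z ∈ T x j, f z ∉ E ∧ D j z ≤ b j x ∧
        edist (v x) (v z) ≤ ENNReal.ofReal η + 2 * ∑' l : ℕ, b (j + m * l) x := by
    intro x hx η hη j a' b' hab
    obtain ⟨J₀, hJ₀⟩ := hsel x hx η hη
    have hab' : ∀ l : ℕ, (2 : ℝ) ^ (-(j + m * l : ℤ)) ≤ dist a' b' := fun l =>
      (zpow_le_zpow_right₀ (by norm_num) (by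
        have : (0 : ℤ) ≤ m * l := by positivity
        omega)).trans hab
    choose z hzT hzE hzD hzη using fun l : ℕ => hJ₀ (j + m * l) a' b' (hab' l)
    have hcons : ∀ l : ℕ, edist (v (z l)) (v (z (l + 1))) ≤
        b (j + m * l) x + b (j + m * (l + 1 : ℕ)) x := by
      intro l
      set i : ℤ := j + m * l
      have hi : (j + m * (l + 1 : ℕ) : ℤ) = i + m := by push_cast; ring
      have hz1 := hzT l
      have hz2 := hzT (l + 1)
      have hD1 := hzD l
      have hD2 := hzD (l + 1)
      rw [hi] at hz2 hD2 ⊢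
      have h2 : (0 : ℝ) < 2 ^ (-i) := by positivity
      have hs := hstep i
      have g1 : dist (z l) x < 2 ^ (-i) := hz1.1.1
      have g2 : δ * 2 ^ (-i) ≤ dist (z l) x := not_lt.1 hz1.2
      have g3 : dist (z (l + 1)) x < e * 2 ^ (-i) := hs ▸ hz2.1.1
      have g4 := dist_triangle (z l) (z (l + 1)) x
      have g5 := dist_triangle_right (z l) (z (l + 1)) x
      have hele : e ≤ 1 := by linarith
      have g6 : e * 2 ^ (-i) < δ / 8 * 2 ^ (-i) := mul_lt_mul_of_pos_right hm h2
      have g7 : δ / 8 * 2 ^ (-i) < 1 / 8 * 2 ^ (-i) := mul_lt_mul_of_pos_right (by linarith) h2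
      have d1 : δ / 2 * 2 ^ (-i) < dist (z l) (z (l + 1)) := by linarith
      have d2 : dist (z l) (z (l + 1)) < 2 * 2 ^ (-i) := by linarith
      have k1 : κ * 2 ^ (-i) ≤ δ / 2 * 2 ^ (-i) := by gcongr; linarith
      have k2 : 2 * (2 : ℝ) ^ (-i) ≤ κ⁻¹ * 2 ^ (-i) := by gcongr; linarith
      refine (hosc u E G hG x x (z l) (z (l + 1)) i (i + m) hz1.1 hz2.1 (hzE l) (hzE (l + 1))
        (k1.trans_lt d1) (d2.trans_le k2) ?_ ?_).trans (add_le_add hD1 hD2)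
      · rw [hs]
        refine lt_of_le_of_lt ?_ d1
        calc κ * (e * 2 ^ (-i)) ≤ δ / 8 * (1 * 2 ^ (-i)) := by gcongr
          _ ≤ _ := by nlinarith
      · rw [hs]
        refine d2.trans_le ?_
        calc 2 * (2 : ℝ) ^ (-i) ≤ 8 * 2 ^ (-i) := by gcongr; norm_num
          _ = 8 * e⁻¹ * (e * 2 ^ (-i)) := by field_simp
          _ ≤ _ := by gcongr
    refine ⟨z 0, by simpa using hzT 0, hzE 0, by simpa using hzD 0, ?_⟩
    -- Since m ≥ 1, after L jumps the scale index is at least J₀, so the chain may stop there with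
    -- error η.
    set L := (J₀ - j).toNat
    have hL : dist (v (z L)) (v x) ≤ η := hzη L (by
      have h5 : J₀ - j ≤ L := Int.self_le_toNat _
      have h6 : (L : ℤ) ≤ m * L := le_mul_of_one_le_left (by positivity) (by omega)
      omega)
    have hsum : edist (v (z 0)) (v (z L)) ≤ 2 * ∑' l : ℕ, b (j + m * l) x := by
      refine (edist_le_range_sum_edist (fun l => v (z l)) L).trans ?_
      refine (Finset.sum_le_sum fun l _ => hcons l).trans ?_
      rw [Finset.sum_add_distrib, two_mul]
      gcongr
      · exact ENNReal.sum_le_tsum _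
      · refine (ENNReal.sum_le_tsum (f := fun l : ℕ => b (j + m * (l + 1 : ℕ)) x) _).trans ?_
        exact ENNReal.tsum_comp_le_tsum_of_injective (add_left_injective 1)
          fun l : ℕ => b (j + m * l) x
    calc edist (v x) (v (z 0)) ≤ edist (v x) (v (z L)) + edist (v (z L)) (v (z 0)) :=
          edist_triangle _ _ _
      _ ≤ _ := by
          gcongr
          · rw [edist_comm, edist_dist]; exact ENNReal.ofReal_le_ofReal hL
          · rwa [edist_comm]
  refine ⟨N, hN0, fun k x y hx hy hxy1 hxy2 => ?_⟩
  have h2 : (0 : ℝ) < 2 ^ (-k) := by positivity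
  have hk1 : (2 : ℝ) ^ (-k - 1) = 2 ^ (-k) / 2 := by rw [zpow_sub₀ (by norm_num), zpow_one]
  have hs := hstep k
  have hele : e < 1 / 8 := by linarith
  have hek : e * 2 ^ (-k) < 1 / 8 * 2 ^ (-k) := mul_lt_mul_of_pos_right hele h2
  rw [hk1] at hxy1
  have hab : (2 : ℝ) ^ (-(k + m : ℤ)) ≤ dist x y := by rw [hs]; linarith
  -- Each chain counts its sum twice and the link between the two chains adds it once more, hence 3.
  -- The selected points depend on ε, but the bound does not, so ε can tend to 0.
  have hmain : edist (v x) (v y) ≤ 3 * (∑' l : ℕ, b (k + l) x + ∑' l : ℕ, b (k + l) y) := by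
    refine ENNReal.le_of_forall_pos_le_add fun ε hε _ => ?_
    obtain ⟨z, hzT, hzE, hzD, hz⟩ := hchain x hx (ε / 2) (by positivity) (k + m) x y hab
    obtain ⟨w, hwT, hwE, hwD, hw⟩ := hchain y hy (ε / 2) (by positivity) (k + m) x y hab
    have hinj : Function.Injective fun l : ℕ => m + m * l := fun l l' h => by
      have h7 : m * l = m * l' := by simpa using h
      exact Nat.eq_of_mul_eq_mul_left (by omega) h7
    have hre : ∀ x, ∑' l : ℕ, b (k + m + m * l) x ≤ ∑' l : ℕ, b (k + l) x := by
      intro x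
      refine le_trans (le_of_eq ?_)
        (ENNReal.tsum_comp_le_tsum_of_injective hinj fun l : ℕ => b (k + l) x)
      congr 1 with l
      have h8 : (k + m + m * l : ℤ) = k + ((m + m * l : ℕ) : ℤ) := by push_cast; ring
      simp only [h8]
    have hfst : ∀ x, b (k + m) x ≤ ∑' l : ℕ, b (k + l) x := fun x =>
      ENNReal.le_tsum (f := fun l : ℕ => b (k + l) x) m
    -- The chains start at scale k + m, so z and w are within 2^(-k)/8 of x and y, and d(z, w)
    -- remains comparable to 2^(-k).
    have hzw : edist (v z) (v w) ≤ D (k + m) z + D (k + m) w := by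
      have g1 : dist z x < e * 2 ^ (-k) := hs ▸ hzT.1.1
      have g2 : dist w y < e * 2 ^ (-k) := hs ▸ hwT.1.1
      have g3 := dist_triangle4 x z w y
      have g4 := dist_triangle4 z x y w
      rw [dist_comm x z] at g3
      rw [dist_comm y w] at g4
      have d1 : e * 2 ^ (-k) < dist z w := by linarith
      have d2 : dist z w < 2 * 2 ^ (-k) := by linarith
      have k1 : κ * 2 ^ (-(k + m : ℤ)) < dist z w := by
        rw [hs]
        refine lt_of_le_of_lt ?_ d1
        exact mul_le_of_le_one_left (by positivity) (by linarith)
      have k2 : dist z w < κ⁻¹ * 2 ^ (-(k + m : ℤ)) := by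
        rw [hs]
        refine d2.trans_le ?_
        calc 2 * (2 : ℝ) ^ (-k) ≤ 8 * 2 ^ (-k) := by gcongr; norm_num
          _ = 8 * e⁻¹ * (e * 2 ^ (-k)) := by field_simp
          _ ≤ _ := by gcongr
      exact hosc u E G hG x y z w (k + m) (k + m) hzT.1 hwT.1 hzE hwE k1 k2 k1 k2
    have hε2 : ENNReal.ofReal (ε / 2) + ENNReal.ofReal (ε / 2) = ε := by
      rw [← ENNReal.ofReal_add (by positivity) (by positivity), add_halves,
        ENNReal.ofReal_coe_nnreal]
    set Sx := ∑' l : ℕ, b (k + l) x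
    set Sy := ∑' l : ℕ, b (k + l) y
    calc edist (v x) (v y) ≤ edist (v x) (v z) + edist (v z) (v w) + edist (v w) (v y) :=
          edist_triangle4 _ _ _ _
      _ ≤ (ENNReal.ofReal (ε / 2) + 2 * Sx) + (Sx + Sy) + (ENNReal.ofReal (ε / 2) + 2 * Sy) := by
          gcongr
          · exact hz.trans (by gcongr; exact hre x)
          · exact hzw.trans (add_le_add (hzD.trans (hfst x)) (hwD.trans (hfst y)))
          · rw [edist_comm]; exact hw.trans (by gcongr; exact hre y)
      _ = 3 * (Sx + Sy) + (ENNReal.ofReal (ε / 2) + ENNReal.ofReal (ε / 2)) := by ring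
      _ = _ := by rw [hε2]
  refine hmain.trans (le_of_eq ?_)
  have hbs : ∀ x, ∑' l : ℕ, b (k + l) x = CS * Csel * (2 : ℝ≥0∞) ^ (-(k * s₁)) *
      ∑' l : ℕ, (2 : ℝ≥0∞) ^ (-(l * s₁)) * a (k + l) x := by
    intro x
    rw [← ENNReal.tsum_mul_left]
    congr 1 with l
    simp only [hb]
    have : (2 : ℝ≥0∞) ^ (-(((k + l : ℤ) : ℝ) * s₁)) = 2 ^ (-(k * s₁)) * 2 ^ (-(l * s₁)) := by
      rw [← two_rpow_add]; congr 1; push_cast; ring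
    rw [this]; ring
  rw [hbs, hbs]
  ring

end Composition

/-! ### From the pointwise estimate to boundedness of composition -/

section NormBound

variable {X Y : Type*} [MetricSpace X] [MetricSpace Y] [MeasurableSpace X] [MeasurableSpace Y]
  {μ : Measure X} {ν : Measure Y}
  {f : X ≃ₜ Y} {J : X → ℝ≥0∞} {n₁ n₂ s₁ s₂ p κ c₁ c₂ : ℝ} {K : ℝ≥0}

/-- A fractional Hajłasz gradient has a Borel version, for a Borel version of the function. -/
lemma IsFracHajlaszGradient.exists_gradientOff {s : ℝ} {u : Y → ℝ} {g : ℤ → Y → ℝ≥0}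
    (hg : IsFracHajlaszGradient s ν u g) (hu : AEMeasurable u ν) :
    ∃ (u' : Y → ℝ) (E : Set Y) (G : ℤ → Y → ℝ≥0∞), Measurable u' ∧ ν E = 0 ∧
      (∀ i, Measurable (G i)) ∧ GradientOff s E u' G ∧ (∀ y, y ∉ E → u y = u' y) ∧
      ∀ y, y ∉ E → ∀ i, G i y = g i y := by
  obtain ⟨hgm, E, hE, h⟩ := hg
  set E' : Set Y := E ∪ {y | ¬ u y = hu.mk u y} ∪ ⋃ i, {y | ¬ g i y = (hgm i).mk (g i) y}
  have hu' : ∀ y, y ∉ E' → u y = hu.mk u y := by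
    intro y hy
    by_contra hc
    exact hy (Or.inl (Or.inr hc))
  have hg' : ∀ y, y ∉ E' → ∀ i, g i y = (hgm i).mk (g i) y := by
    intro y hy i
    by_contra hc
    exact hy (Or.inr (mem_iUnion.2 ⟨i, hc⟩))
  refine ⟨hu.mk u, E', fun i y => (((hgm i).mk (g i) y : ℝ≥0) : ℝ≥0∞), hu.measurable_mk,
    measure_union_null (measure_union_null hE hu.ae_eq_mk)
      (measure_iUnion_null fun i => (hgm i).ae_eq_mk),
    fun i => (hgm i).measurable_mk.coe_nnreal_ennreal, ?_, hu',
    fun y hy i => by rw [hg' y hy i]⟩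
  intro i y y' hy hy' h1 h2
  have h3 := h i y y' (fun hc => hy (Or.inl (Or.inl hc))) (fun hc => hy' (Or.inl (Or.inl hc))) h1 h2
  beta_reduce
  rw [← hu' y hy, ← hu' y' hy', ← hg' y hy i, ← hg' y' hy' i, edist_dist, Real.dist_eq]
  refine (ENNReal.ofReal_le_ofReal h3).trans (le_of_eq ?_)
  rw [ENNReal.ofReal_mul (by positivity), ENNReal.ofReal_add (by positivity) (by positivity),
    ENNReal.ofReal_coe_nnreal, ENNReal.ofReal_coe_nnreal]

/-- A pointwise bound by an extended nonnegative sequence of functions of finite mixed norm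
controls the Hajłasz-Triebel-Lizorkin norm. -/
lemma hajlaszTLNorm_le_of_edist_le {s : ℝ} (hp : 0 < p) {q : ℝ≥0∞} (hq : 0 < q) {v : X → ℝ}
    {h : ℤ → X → ℝ≥0∞} (hm : ∀ k, Measurable (h k))
    (hfin : ∫⁻ x, ellENorm q (fun k => h k x) ^ p ∂μ ≠ ∞) {N : Set X} (hN : μ N = 0)
    (hv : ∀ (k : ℤ) (x y : X), x ∉ N → y ∉ N → (2 : ℝ) ^ (-k - 1) ≤ dist x y →
      dist x y < (2 : ℝ) ^ (-k) →
      edist (v x) (v y) ≤ ENNReal.ofReal (dist x y ^ s) * (h k x + h k y)) :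
    hajlaszTLNorm s p q μ v ≤ (∫⁻ x, ellENorm q (fun k => h k x) ^ p ∂μ) ^ (1 / p) := by
  have hae := ae_lt_top ((measurable_ellENorm q hm).pow_const p) hfin
  -- Finiteness of the mixed norm makes every h k finite off a null set, so passing to real values
  -- loses nothing there.
  set N' : Set X := N ∪ {x | ¬ ellENorm q (fun k => h k x) ^ p < ∞}
  have hN' : μ N' = 0 := measure_union_null hN hae
  have hhfin : ∀ x, x ∉ N' → ∀ k, h k x ≠ ∞ := by
    intro x hx k hk
    refine hx (Or.inr fun hc => ?_)
    have := le_ellENorm hq (fun k => h k x) k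
    rw [hk, top_le_iff] at this
    rw [this, ENNReal.top_rpow_of_pos hp] at hc
    exact lt_irrefl _ hc
  have hgrad : IsFracHajlaszGradient s μ v fun k x => (h k x).toNNReal := by
    refine ⟨fun k => (hm k).ennreal_toNNReal.aemeasurable, N', hN', ?_⟩
    intro k x y hx hy h1 h2
    have h3 := hv k x y (fun hc => hx (Or.inl hc)) (fun hc => hy (Or.inl hc)) h1 h2
    have hx' := hhfin x hx k
    have hy' := hhfin y hy k
    rw [← ENNReal.coe_toNNReal hx', ← ENNReal.coe_toNNReal hy', edist_dist, Real.dist_eq,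
      ← ENNReal.ofReal_coe_nnreal, ← ENNReal.ofReal_coe_nnreal,
      ← ENNReal.ofReal_add (by positivity) (by positivity),
      ← ENNReal.ofReal_mul (by positivity),
      ENNReal.ofReal_le_ofReal_iff (by positivity)] at h3
    exact h3
  · refine (iInf₂_le _ hgrad).trans ?_
    unfold mixedNorm
    gcongr with x
    exact ellENorm_mono q fun k => ENNReal.coe_toNNReal_le_self

variable [BorelSpace X] [BorelSpace Y] [SecondCountableTopology X]

/-- Composition with a quasisymmetric map whose density has good parts is bounded. -/
theorem WeakQS.exists_hajlaszTLNorm_comp_le [IsLocallyFiniteMeasure μ]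
    [IsUnifLocDoublingMeasure μ]
    (hf : WeakQS f) (hn₁ : 0 < n₁) (hμ : BallsFinitePos μ)
    (hK : UpperRegular n₁ K μ) (hK1 : 1 ≤ K) (hc₁ : 0 < c₁) (hl₁ : LowerRegular n₁ c₁ μ)
    (hn₂ : 0 < n₂) (hc₂ : 0 < c₂) (hl₂ : LowerRegular n₂ c₂ ν)
    (hnull : ∀ E, ν E = 0 → μ (f ⁻¹' E) = 0) (hJ : Measurable J) (hgood : HasGoodParts μ ν f J)
    (hcv : ChangeOfVariablesLE μ ν f J)
    (hp : 1 < p) (hs₁ : s₁ * p = n₁) (hs₂ : s₂ * p = n₂) {q : ℝ≥0∞} (hq : 0 < q) :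
    ∃ C : ℝ≥0, ∀ u ∈ MSpace s₂ p q ν, u ∘ f ∈ MSpace s₁ p q μ ∧
      hajlaszTLNorm s₁ p q μ (u ∘ f) ≤ C * hajlaszTLNorm s₂ p q ν u := by
  have hp0 : 0 < p := by linarith
  have hs₁0 : 0 < s₁ := by
    by_contra! hc
    have := mul_nonpos_of_nonpos_of_nonneg hc hp0.le
    linarith
  obtain ⟨σ, hσ, C₁, hC₁, hmax⟩ := exists_lintegral_ellENorm_dyAvg_le (μ := μ) hK hK1 hp hq
  obtain ⟨κ, hκ, C₂, hC₂, hpt⟩ := hf.exists_edist_comp_le hn₁ hμ hK hK1 hc₁ hl₁ hn₂ hc₂ hl₂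
    hnull hJ hgood hp0 hs₁ hs₂ hσ
  obtain ⟨C₃, hC₃, hpull⟩ := hf.exists_lintegral_pullGrad_le hκ hp0 hcv hq
  obtain ⟨C₄, hC₄, hgeom⟩ := exists_ellENorm_geom_tsum_le hs₁0 hq
  set A : ℝ≥0∞ := C₂ * 2 ^ s₁ with hA
  have hAt : A ≠ ∞ := ENNReal.mul_ne_top hC₂ (two_rpow_ne_top _)
  set B : ℝ≥0∞ := (A * C₄) ^ p * (C₁ * C₃) with hB
  have hBt : B ≠ ∞ := by
    have : (A * C₄) ^ p ≠ ∞ := ENNReal.rpow_ne_top_of_nonneg hp0.le (by finiteness)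
    finiteness
  -- The summand 1 makes C nonzero: gradients of infinite norm are then harmless, and C can be
  -- divided out to pass to the infimum.
  set C : ℝ≥0∞ := B ^ (1 / p) + 1 with hC
  have hCt : C ≠ ∞ := by
    have : B ^ (1 / p) ≠ ∞ := ENNReal.rpow_ne_top_of_nonneg (by positivity) hBt
    finiteness
  have hC0 : C ≠ 0 := by simp [hC]
  have key : ∀ u, AEMeasurable u ν → ∀ g, IsFracHajlaszGradient s₂ ν u g →
      hajlaszTLNorm s₁ p q μ (u ∘ f) ≤ C * mixedNorm p q ν g := by
    intro u hu g hg
    rcases eq_or_ne (mixedNorm p q ν g) ∞ with ht | ht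
    · rw [ht, ENNReal.mul_top hC0]; exact le_top
    obtain ⟨u', E, G, hu'm, hE, hGm, hG, huu', hGg⟩ := hg.exists_gradientOff hu
    obtain ⟨N, hN, hNb⟩ := hpt u' E G hG hE hGm hu'm
    set a : ℤ → X → ℝ≥0∞ := fun j x =>
      dyAvg n₁ μ j (fun z => pullGrad f κ p J G j z ^ σ) x ^ (1 / σ) with ha
    have hHm : ∀ j, Measurable (pullGrad f κ p J G j) := measurable_pullGrad hJ hGm
    have ham : ∀ j, Measurable (a j) := fun j =>
      (measurable_dyAvg ((hHm j).pow_const σ) j).pow_const _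
    set h : ℤ → X → ℝ≥0∞ := fun k x =>
      A * ∑' l : ℕ, (2 : ℝ≥0∞) ^ (-(l * s₁)) * a (k + l) x with hh
    have hhm : ∀ k, Measurable (h k) := fun k =>
      (Measurable.tsum fun l => (ham _).const_mul _).const_mul _
    have hGint : ∫⁻ y, ellENorm q (fun i => G i y) ^ p ∂ν = mixedNorm p q ν g ^ p := by
      unfold mixedNorm
      rw [← ENNReal.rpow_mul, one_div_mul_cancel hp0.ne', ENNReal.rpow_one]
      refine lintegral_congr_ae ?_
      filter_upwards [measure_eq_zero_iff_ae_notMem.1 hE] with y hy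
      simp only [hGg y hy]
      rfl
    have hint : ∫⁻ x, ellENorm q (fun k => h k x) ^ p ∂μ ≤ B * mixedNorm p q ν g ^ p := by
      calc _ ≤ ∫⁻ x, (A * C₄) ^ p * ellENorm q (fun j => a j x) ^ p ∂μ := by
            refine lintegral_mono fun x => ?_
            simp only [hh]
            rw [← ENNReal.mul_rpow_of_nonneg _ _ hp0.le, ellENorm_const_mul hq, mul_assoc A C₄]
            exact ENNReal.rpow_le_rpow (mul_le_mul' le_rfl (hgeom fun j => a j x)) hp0.le
        _ = (A * C₄) ^ p * ∫⁻ x, ellENorm q (fun j => a j x) ^ p ∂μ :=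
            lintegral_const_mul _ ((measurable_ellENorm q ham).pow_const p)
        _ ≤ (A * C₄) ^ p * (C₁ * (C₃ * mixedNorm p q ν g ^ p)) := by
            gcongr
            refine (hmax _ hHm).trans ?_
            gcongr
            exact (hpull G hGm).trans (le_of_eq (by rw [hGint]))
        _ = _ := by rw [hB]; ring
    have hfin : ∫⁻ x, ellENorm q (fun k => h k x) ^ p ∂μ ≠ ∞ := by
      refine (hint.trans_lt ?_).ne
      exact ENNReal.mul_lt_top hBt.lt_top (ENNReal.rpow_lt_top_of_nonneg hp0.le ht)
    refine (hajlaszTLNorm_le_of_edist_le (N := N ∪ f ⁻¹' E) hp0 hq hhm hfin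
      (measure_union_null hN (hnull E hE)) ?_).trans ?_
    · intro k x y hx hy h1 h2
      rw [mem_union, not_or] at hx hy
      have h3 := hNb k x y hx.1 hy.1 h1 h2
      simp only [Function.comp_apply]
      rw [huu' _ hx.2, huu' _ hy.2]
      refine h3.trans ?_
      -- From 2^(-k) ≤ 2 d(x, y); this is the source of the factor 2^s₁ in A.
      have h4 : (2 : ℝ≥0∞) ^ (-(k * s₁)) ≤ 2 ^ s₁ * ENNReal.ofReal (dist x y ^ s₁) := by
        calc (2 : ℝ≥0∞) ^ (-(k * s₁)) = 2 ^ s₁ * 2 ^ (-((k + 1 : ℤ) * s₁)) := by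
              rw [← two_rpow_add]; congr 1; push_cast; ring
          _ = 2 ^ s₁ * ENNReal.ofReal (((2 : ℝ) ^ (-k - 1)) ^ s₁) := by
              rw [← ofReal_two_zpow_rpow, neg_add, sub_eq_add_neg]
          _ ≤ _ := by gcongr
      calc _ ≤ C₂ * (2 ^ s₁ * ENNReal.ofReal (dist x y ^ s₁)) *
            (∑' l : ℕ, (2 : ℝ≥0∞) ^ (-(l * s₁)) * a (k + l) x +
              ∑' l : ℕ, (2 : ℝ≥0∞) ^ (-(l * s₁)) * a (k + l) y) := by gcongr
        _ = _ := by simp only [hh, hA]; ring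
    · calc _ ≤ (B * mixedNorm p q ν g ^ p) ^ (1 / p) := by gcongr
        _ = B ^ (1 / p) * mixedNorm p q ν g := by
            rw [ENNReal.mul_rpow_of_nonneg _ _ (by positivity), ← ENNReal.rpow_mul,
              mul_one_div_cancel hp0.ne', ENNReal.rpow_one]
        _ ≤ _ := by gcongr; exact le_self_add
  refine ⟨C.toNNReal, fun u hu => ?_⟩
  rw [ENNReal.coe_toNNReal hCt]
  have hle : hajlaszTLNorm s₁ p q μ (u ∘ f) ≤ C * hajlaszTLNorm s₂ p q ν u := by
    rw [mul_comm, ← ENNReal.div_le_iff hC0 hCt]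
    refine le_iInf₂ fun g hg => ?_
    rw [ENNReal.div_le_iff hC0 hCt, mul_comm]
    exact key u hu.1 g hg
  refine ⟨⟨?_, hle.trans_lt (ENNReal.mul_lt_top hCt.lt_top hu.2)⟩, hle⟩
  refine hu.1.comp_quasiMeasurePreserving ⟨f.continuous.measurable, ?_⟩
  refine Measure.AbsolutelyContinuous.mk fun E hEm hE => ?_
  rw [Measure.map_apply f.continuous.measurable hEm]
  exact hnull E hE

end NormBound

/-! ### Volume derivative, the A_∞ condition and good parts of f and its inverse -/

section VolumeDerivative

variable {X Y : Type*} [MetricSpace X] [MetricSpace Y] [MeasurableSpace X] [MeasurableSpace Y]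
  {μ : Measure X} {ν : Measure Y} {f : X ≃ₜ Y} {n n₂ c c₂ : ℝ} {K K₂ : ℝ≥0}

lemma ENNReal_div_le_mul_div {a a' b b' C : ℝ≥0∞} (ha : a ≤ a') (hb : b' ≤ C * b) (hC0 : C ≠ 0)
    (hCt : C ≠ ∞) : a / b ≤ C * (a' / b') := by
  have h1 : b⁻¹ ≤ C * b'⁻¹ := by
    calc b⁻¹ = C * (C * b)⁻¹ := by
          rw [ENNReal.mul_inv (Or.inl hC0) (Or.inl hCt), ← mul_assoc,
            ENNReal.mul_inv_cancel hC0 hCt, one_mul]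
      _ ≤ _ := by gcongr
  rw [div_eq_mul_inv, div_eq_mul_inv, mul_left_comm]
  gcongr

lemma map_symm_apply_eq [BorelSpace X] [BorelSpace Y] (f : X ≃ₜ Y) (ν : Measure Y) {A : Set X} (hA : MeasurableSet A) :
    (ν.map f.symm) A = ν (f '' A) := by
  rw [Measure.map_apply f.symm.continuous.measurable hA, f.image_eq_preimage_symm]

/-- The volume derivative is comparable to the Radon-Nikodym derivative. -/
lemma exists_volDeriv_comparable [BorelSpace X] [BorelSpace Y] [Nontrivial X]
    [SecondCountableTopology X]
    [IsLocallyFiniteMeasure μ] [IsUnifLocDoublingMeasure μ] [IsLocallyFiniteMeasure (ν.map f.symm)]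
    (hK : UpperRegular n K μ) (hc : 0 < c) (hl : LowerRegular n c μ) :
    ∃ C : ℝ≥0, 0 < C ∧ ∀ᵐ x ∂μ, volDeriv μ ν f x ≤ C * (ν.map f.symm).rnDeriv μ x ∧
      (ν.map f.symm).rnDeriv μ x ≤ C * volDeriv μ ν f x := by
  obtain ⟨a, b, hab⟩ := exists_pair_ne X
  have hd : 0 < dist a b := dist_pos.2 hab
  set C : ℝ≥0 := K * (2 ^ n / c).toNNReal + 1 with hC
  have hC0 : (C : ℝ≥0∞) ≠ 0 := by
    rw [ENNReal.coe_ne_zero]; exact ne_of_gt (by positivity)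
  have hball : ∀ x r, 0 < r → r ≤ dist a b → μ (ball x (2 * r)) ≤ C * μ (ball x r) := by
    intro x r hr hrd
    refine (hK.measure_ball_mul_le hc hl (x := x) (y := x) two_pos hr hrd).trans ?_
    gcongr
    rw [hC, ENNReal.coe_add, ENNReal.coe_mul]
    exact le_self_add
  set ν' := ν.map f.symm with hν'
  have him : ∀ x r, ν (f '' ball x r) = ν' (ball x r) := fun x r =>
    (map_symm_apply_eq f ν measurableSet_ball).symm
  refine ⟨C, by positivity, ?_⟩
  filter_upwards [VitaliFamily.ae_tendsto_rnDeriv (IsUnifLocDoublingMeasure.vitaliFamily μ 1) ν']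
    with x hx
  -- Differentiation of measures is along closed balls, whereas `volDeriv` uses open ones; doubling
  -- exchanges them at the price of a constant, which is all that is needed.
  have hlim : Tendsto (fun r : ℝ => ν' (closedBall x r) / μ (closedBall x r)) (𝓝[>] 0)
      (𝓝 (ν'.rnDeriv μ x)) := by
    refine hx.comp (IsUnifLocDoublingMeasure.tendsto_closedBall_filterAt (K := 1) μ
      (fun _ : ℝ => x) (fun r : ℝ => r) tendsto_id ?_)
    filter_upwards [self_mem_nhdsWithin] with r hr
    exact mem_closedBall_self (by simpa using (mem_Ioi.1 hr).le)
  have hhalf : Tendsto (fun r : ℝ => r / 2) (𝓝[>] 0) (𝓝[>] 0) := by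
    refine tendsto_nhdsWithin_iff.2 ⟨?_, ?_⟩
    · have : Tendsto (fun r : ℝ => r / 2) (𝓝 0) (𝓝 (0 / 2)) := tendsto_id.div_const 2
      rw [zero_div] at this
      exact this.mono_left nhdsWithin_le_nhds
    · filter_upwards [self_mem_nhdsWithin] with r hr
      exact half_pos (mem_Ioi.1 hr)
  unfold volDeriv
  simp_rw [him]
  constructor
  · rw [← (ENNReal.Tendsto.const_mul hlim (Or.inr ENNReal.coe_ne_top)).limsup_eq]
    refine limsup_le_limsup ?_
    filter_upwards [Ioc_mem_nhdsGT hd] with r hr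
    refine ENNReal_div_le_mul_div (measure_mono ball_subset_closedBall) ?_ hC0 ENNReal.coe_ne_top
    exact (measure_mono (closedBall_subset_ball (by linarith [hr.1]))).trans (hball x r hr.1 hr.2)
  · rw [← ENNReal.limsup_const_mul_of_ne_top ENNReal.coe_ne_top, ← (hlim.comp hhalf).limsup_eq]
    refine limsup_le_limsup ?_
    filter_upwards [Ioc_mem_nhdsGT hd] with r hr
    have hr0 := hr.1
    have hr1 := hr.2
    refine ENNReal_div_le_mul_div (measure_mono (closedBall_subset_ball (by linarith))) ?_ hC0
      ENNReal.coe_ne_top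
    have h1 := hball x (r / 2) (by linarith) (by linarith)
    rw [mul_div_cancel₀ r two_ne_zero] at h1
    exact h1.trans (by gcongr; exact ball_subset_closedBall)

/-- A weight comparable to a reverse Hölder weight satisfies the `A_∞` condition. -/
lemma ReverseHolder.exists_setLIntegral_le_half {r : ℝ≥0∞} (hr : 1 < r) {J w : X → ℝ≥0∞}
    (hJ : ReverseHolder r μ J) (hμ : BallsFinitePos μ) (hw : Measurable w) {C : ℝ≥0}
    (hJw : ∀ᵐ x ∂μ, J x ≤ C * w x) (hwJ : ∀ᵐ x ∂μ, w x ≤ C * J x) :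
    ∃ δ : ℝ≥0, 0 < δ ∧ ∀ (x : X) (ρ : ℝ) (E : Set X), 0 < ρ → MeasurableSet E → E ⊆ ball x ρ →
      μ E ≤ δ * μ (ball x ρ) → ∫⁻ y in E, w y ∂μ ≤ 2⁻¹ * ∫⁻ y in ball x ρ, w y ∂μ := by
  obtain ⟨C₀, hC₀⟩ := hJ
  have hav : ∀ x ρ, ⨍⁻ y in ball x ρ, J y ∂μ ≤ C * ⨍⁻ y in ball x ρ, w y ∂μ := by
    intro x ρ
    rw [setLAverage_eq, setLAverage_eq, ← mul_div_assoc,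
      ← lintegral_const_mul' _ _ ENNReal.coe_ne_top]
    gcongr ?_ / _
    exact lintegral_mono_ae (ae_restrict_of_ae hJw)
  set C₁ : ℝ≥0 := C * C₀ * C with hC₁
  -- The quantitative A_∞ form: w(E)/w(B) ≤ C₁ (μ(E)/μ(B))^θ, obtained by Hölder with θ = 1 - 1/r,
  -- or directly with θ = 1 if r = ∞.
  suffices hs : ∃ θ : ℝ, 0 < θ ∧ ∀ (x : X) (ρ : ℝ) (E : Set X), 0 < ρ → MeasurableSet E →
      E ⊆ ball x ρ → ∫⁻ y in E, w y ∂μ ≤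
        C₁ * ((μ (ball x ρ))⁻¹ * μ E) ^ θ * ∫⁻ y in ball x ρ, w y ∂μ by
    obtain ⟨θ, hθ, h⟩ := hs
    -- Chosen so that C₁ δ^θ ≤ 1/2; the added 1 avoids division by zero.
    set δ : ℝ≥0 := ((2 * (C₁ + 1))⁻¹) ^ (1 / θ) with hδ
    refine ⟨δ, by positivity, fun x ρ E hρ hE hEB hle => (h x ρ E hρ hE hEB).trans ?_⟩
    gcongr
    have h1 : (μ (ball x ρ))⁻¹ * μ E ≤ δ := by
      have hB := hμ x ρ hρ
      rw [mul_comm, ← div_eq_mul_inv]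
      exact ENNReal.div_le_of_le_mul hle
    calc _ ≤ C₁ * (δ : ℝ≥0∞) ^ θ := by gcongr
      _ = ((C₁ * (2 * (C₁ + 1))⁻¹ : ℝ≥0) : ℝ≥0∞) := by
          rw [hδ, ← ENNReal.coe_rpow_of_nonneg _ hθ.le, ← NNReal.rpow_mul,
            one_div_mul_cancel hθ.ne', NNReal.rpow_one]
          exact (ENNReal.coe_mul C₁ _).symm
      _ ≤ ((2⁻¹ : ℝ≥0) : ℝ≥0∞) := by
          rw [ENNReal.coe_le_coe, mul_inv, mul_left_comm]
          refine mul_le_of_le_one_right zero_le ?_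
          rw [← div_eq_mul_inv, div_le_one (by positivity)]
          exact le_self_add
      _ = _ := by simp
  by_cases hrt : r = ∞
  · refine ⟨1, one_pos, fun x ρ E hρ hE hEB => ?_⟩
    have h1 := hC₀ x ρ hρ
    rw [if_pos hrt] at h1
    set A := ⨍⁻ y in ball x ρ, w y ∂μ with hA
    have h2 : ∀ᵐ y ∂μ.restrict (ball x ρ), w y ≤ C₁ * A := by
      filter_upwards [ENNReal.ae_le_essSup (μ := μ.restrict (ball x ρ)) J,
        ae_restrict_of_ae hwJ] with y hy1 hy2
      calc w y ≤ C * (C₀ * (C * A)) := by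
            refine hy2.trans ?_
            gcongr
            exact hy1.trans (h1.trans (by gcongr; exact hav x ρ))
        _ = _ := by rw [hC₁]; push_cast; ring
    calc _ ≤ ∫⁻ y in E, C₁ * A ∂μ := lintegral_mono_ae (ae_restrict_of_ae_restrict_of_subset hEB h2)
      _ = _ := by
          rw [setLIntegral_const, ENNReal.rpow_one, hA, setLAverage_eq, div_eq_mul_inv]; ring
  · set R := r.toReal with hR
    have hR1 : 1 < R := by
      rw [hR, ← ENNReal.toReal_one]
      exact (ENNReal.toReal_lt_toReal ENNReal.one_ne_top hrt).2 hr
    have hR0 : 0 < R := by linarith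
    have hθ : 0 < 1 - 1 / R := by rw [sub_pos, div_lt_one hR0]; exact hR1
    have hRi : 0 < 1 / R := by positivity
    refine ⟨1 - 1 / R, hθ, fun x ρ E hρ hE hEB => ?_⟩
    obtain ⟨hB0, hBt⟩ := hμ x ρ hρ
    have h1 := hC₀ x ρ hρ
    rw [if_neg hrt] at h1
    set B := ball x ρ with hB
    set m := μ B
    set I := ∫⁻ y in B, w y ∂μ with hI
    have h2 : (⨍⁻ y in B, w y ^ R ∂μ) ^ (1 / R) ≤ C₁ * (I / m) := by
      calc _ ≤ ((C : ℝ≥0∞) ^ R * ⨍⁻ y in B, J y ^ R ∂μ) ^ (1 / R) := by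
            gcongr
            rw [setLAverage_eq, setLAverage_eq, ← mul_div_assoc,
              ← lintegral_const_mul' _ _ (ENNReal.rpow_ne_top_of_nonneg hR0.le ENNReal.coe_ne_top)]
            gcongr ?_ / _
            refine lintegral_mono_ae ?_
            filter_upwards [ae_restrict_of_ae hwJ] with y hy
            rw [← ENNReal.mul_rpow_of_nonneg _ _ hR0.le]
            gcongr
        _ = C * (⨍⁻ y in B, J y ^ R ∂μ) ^ (1 / R) := by
            rw [ENNReal.mul_rpow_of_nonneg _ _ hRi.le, ← ENNReal.rpow_mul,
              mul_one_div_cancel hR0.ne', ENNReal.rpow_one]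
        _ ≤ C * (C₀ * (C * ⨍⁻ y in B, w y ∂μ)) := by
            gcongr
            exact h1.trans (by gcongr; exact hav x ρ)
        _ = _ := by rw [hC₁, setLAverage_eq]; push_cast; ring
    have h3 : ∫⁻ y in E, w y ∂μ ≤ (∫⁻ y in B, w y ^ R ∂μ) ^ (1 / R) * μ E ^ (1 - 1 / R) := by
      have h4 := ENNReal.lintegral_mul_norm_pow_le (μ := μ.restrict E) (f := fun y => w y ^ R)
        (g := fun _ => 1) (hw.pow_const R).aemeasurable aemeasurable_const hRi.le hθ.le (by ring)
      simp only [ENNReal.one_rpow, mul_one, ← ENNReal.rpow_mul, mul_one_div_cancel hR0.ne',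
        ENNReal.rpow_one, one_mul, lintegral_const, Measure.restrict_apply_univ]
        at h4
      refine h4.trans ?_
      gcongr
    have h5 : ∫⁻ y in B, w y ^ R ∂μ = m * ⨍⁻ y in B, w y ^ R ∂μ := by
      rw [setLAverage_eq, ENNReal.mul_div_cancel hB0.ne' hBt.ne]
    calc _ ≤ (m * ⨍⁻ y in B, w y ^ R ∂μ) ^ (1 / R) * μ E ^ (1 - 1 / R) := by rw [← h5]; exact h3
      _ = m ^ (1 / R) * (⨍⁻ y in B, w y ^ R ∂μ) ^ (1 / R) * μ E ^ (1 - 1 / R) := by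
          rw [ENNReal.mul_rpow_of_nonneg _ _ hRi.le]
      _ ≤ m ^ (1 / R) * (C₁ * (I / m)) * μ E ^ (1 - 1 / R) := by gcongr
      _ = C₁ * (m ^ (1 / R) * m⁻¹ * μ E ^ (1 - 1 / R)) * I := by
          rw [div_eq_mul_inv I m]; ring
      _ = C₁ * (m⁻¹ * μ E) ^ (1 - 1 / R) * I := by
          rw [ENNReal.mul_rpow_of_nonneg _ _ hθ.le, ENNReal.inv_rpow, ← ENNReal.rpow_neg,
            ← ENNReal.rpow_neg_one, ← ENNReal.rpow_add _ _ hB0.ne' hBt.ne]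
          congr 4; ring

variable {w : X → ℝ≥0∞} {δ : ℝ≥0}

/-- If the good part had less than the proportion δ of the ball, it would carry at most 1/2 of the
w-mass and its complement, where w is below 1/4 of the mean, at most 1/4; yet the total is positive
and finite. -/
lemma hasGoodParts_of_setLIntegral_le_half [BorelSpace X] (hμ : BallsFinitePos μ) (hw : Measurable w)
    (hwν : ∀ A, MeasurableSet A → ∫⁻ y in A, w y ∂μ = ν (f '' A))
    (hpos : ∀ x ρ, 0 < ρ → 0 < ν (f '' ball x ρ)) (hfin : ∀ x ρ, 0 < ρ → ν (f '' ball x ρ) < ∞)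
    (hδ : 0 < δ)
    (h : ∀ (x : X) (ρ : ℝ) (E : Set X), 0 < ρ → MeasurableSet E → E ⊆ ball x ρ →
      μ E ≤ δ * μ (ball x ρ) → ∫⁻ y in E, w y ∂μ ≤ 2⁻¹ * ∫⁻ y in ball x ρ, w y ∂μ) :
    HasGoodParts μ ν f w := by
  refine ⟨δ, 4⁻¹, hδ, by positivity, fun x _ _ ρ hρ _ => ?_⟩
  by_contra! hc
  set B := ball x ρ with hB
  set G := goodPart μ ν f w 4⁻¹ x ρ with hG
  have hGm : MeasurableSet G := measurableSet_goodPart hw _ x ρ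
  have hGB : G ⊆ B := fun z hz => hz.1
  obtain ⟨hB0, hBt⟩ := hμ x ρ hρ
  set I := ν (f '' B) with hI
  have hI0 : I ≠ 0 := (hpos x ρ hρ).ne'
  have hIt : I ≠ ∞ := (hfin x ρ hρ).ne
  have hIw : ∫⁻ y in B, w y ∂μ = I := hwν B measurableSet_ball
  have h1 := h x ρ G hρ hGm hGB hc.le
  rw [hIw] at h1
  have h2 : ∫⁻ y in B \ G, w y ∂μ ≤ 4⁻¹ * I := by
    calc _ ≤ ∫⁻ y in B \ G, 4⁻¹ * I / μ B ∂μ := by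
          refine setLIntegral_mono measurable_const fun y hy => ?_
          have h3 : ¬ ((4⁻¹ : ℝ≥0) : ℝ≥0∞) * I ≤ w y * μ B := fun hc => hy.2 ⟨hy.1, hc⟩
          rw [ENNReal.le_div_iff_mul_le (Or.inl hB0.ne') (Or.inl hBt.ne)]
          have h4 := (not_le.1 h3).le
          simpa using h4
      _ = 4⁻¹ * I / μ B * μ (B \ G) := setLIntegral_const _ _
      _ ≤ 4⁻¹ * I / μ B * μ B := by gcongr; exact sdiff_subset
      _ = _ := ENNReal.div_mul_cancel hB0.ne' hBt.ne
  have h5 : I ≤ (2⁻¹ + 4⁻¹) * I := by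
    calc I = ∫⁻ y in G ∪ B \ G, w y ∂μ := by rw [union_sdiff_cancel hGB, hIw]
      _ ≤ ∫⁻ y in G, w y ∂μ + ∫⁻ y in B \ G, w y ∂μ := lintegral_union_le _ _ _
      _ ≤ 2⁻¹ * I + 4⁻¹ * I := add_le_add h1 h2
      _ = _ := by ring
  have h6 : (2⁻¹ + 4⁻¹ : ℝ≥0∞) < 1 := by
    have : (2⁻¹ + 4⁻¹ : ℝ≥0∞) = ((2⁻¹ + 4⁻¹ : ℝ≥0) : ℝ≥0∞) := by
      rw [ENNReal.coe_add, ENNReal.coe_inv two_ne_zero, ENNReal.coe_inv four_ne_zero]; rfl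
    rw [this, ← ENNReal.coe_one, ENNReal.coe_lt_coe]
    rw [← NNReal.coe_lt_coe]; push_cast; norm_num
  have h7 : (2⁻¹ + 4⁻¹) * I < 1 * I := (ENNReal.mul_lt_mul_iff_left hI0 hIt).2 h6
  rw [one_mul] at h7
  exact absurd h5 (not_le.2 h7)

/-- Preimages of balls under a quasisymmetric map are comparable to balls, for both measures. -/
lemma WeakQS.exists_ball_subset_preimage_ball (hf : WeakQS f)
    (hK : UpperRegular n K μ) (hc : 0 < c) (hl : LowerRegular n c μ)
    (hn₂ : 0 < n₂) (hν : BallsFinitePos ν)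
    (hK₂ : UpperRegular n₂ K₂ ν) (hc₂ : 0 < c₂) (hl₂ : LowerRegular n₂ c₂ ν) :
    ∃ C : ℝ≥0, 0 < C ∧ ∀ (y a b : Y) (ρ : ℝ), 0 < ρ → ρ ≤ dist a b →
      ∃ R : ℝ, 0 < R ∧ ball (f.symm y) R ⊆ f ⁻¹' ball y ρ ∧
        μ (f ⁻¹' ball y ρ) ≤ C * μ (ball (f.symm y) R) ∧
        ν (ball y ρ) ≤ C * ν (f '' ball (f.symm y) R) := by
  obtain ⟨δ, hδ, hδ1, hδb⟩ := hK₂.exists_measure_ball_mul_le hn₂ hc₂ hl₂ (ε := 2⁻¹) (by simp)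
  obtain ⟨T₁', hT₁', h1⟩ := hf.symm.1 1 one_pos
  obtain ⟨T₂, hT₂, h2⟩ := hf.symm.1 (1 / δ) (by positivity)
  set T₁ := max T₁' 1 with hT₁
  have hT₁0 : 0 < T₁ := by positivity
  obtain ⟨C₀, hC₀⟩ := hf.exists_ofReal_dist_rpow_le hn₂ hc₂ hl₂ hT₁0
  set Ca : ℝ≥0 := K * ((2 * T₂ * T₁) ^ n / c).toNNReal with hCa
  set Cb : ℝ≥0 := K₂ * ((1 / δ) ^ n₂).toNNReal * C₀ with hCb
  refine ⟨Ca + Cb + 1, by positivity, fun y a b ρ hρ hab => ?_⟩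
  set x := f.symm y with hx
  have hfx : f x = y := f.apply_symm_apply y
  -- The annulus between radii δρ and ρ is nonempty because the inner ball has at most half the
  -- measure. Its point v fixes the scale of the preimage.
  obtain ⟨v, hv1, hv2⟩ : ∃ v, v ∈ ball y ρ ∧ v ∉ ball y (δ * ρ) := by
    by_contra! hcon
    have h3 := (measure_mono (μ := ν) (show ball y ρ ⊆ ball y (δ * ρ) from hcon)).trans
      (hδb y a b ρ hρ hab)
    have hpos := hν y ρ hρ
    have h4 : 2⁻¹ * ν (ball y ρ) < 1 * ν (ball y ρ) :=
      (ENNReal.mul_lt_mul_iff_left hpos.1.ne' hpos.2.ne).2 (by simp)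
    rw [one_mul] at h4
    exact absurd h3 (not_le.2 h4)
  rw [mem_ball, dist_comm] at hv1 hv2
  rw [not_lt] at hv2
  set z := f.symm v with hz
  have hfz : f z = v := f.apply_symm_apply v
  have hyv : 0 < dist y v := lt_of_lt_of_le (by positivity) hv2
  have hR₀ : 0 < dist x z := dist_pos.2 (f.symm.injective.ne (dist_pos.1 hyv))
  -- T₁ ≥ T₁' puts the ball inside the preimage; T₁ ≥ 1 gives R ≤ d(x, z), as lower regularity
  -- requires.
  set R := dist x z / T₁ with hR
  have hR0 : 0 < R := by positivity
  have hRz : dist x z = T₁ * R := by rw [hR]; field_simp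
  refine ⟨R, hR0, fun w' hw' => ?_, ?_, ?_⟩
  · by_contra hcon
    have h3 : ρ ≤ dist y (f w') := by rw [dist_comm]; exact not_lt.1 hcon
    have h4 := h1 y v (f w') (by rw [one_mul]; linarith)
    rw [f.symm_apply_apply] at h4
    have h5 : T₁' * dist x w' ≤ T₁ * dist x w' := by gcongr; exact le_max_left _ _
    rw [mem_ball, dist_comm] at hw'
    have h6 : T₁ * dist x w' < T₁ * R := by gcongr
    linarith
  · have hsub : f ⁻¹' ball y ρ ⊆ ball x (2 * T₂ * T₁ * R) := by
      intro w' hw'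
      have h3 : dist y (f w') < ρ := by rw [dist_comm]; exact hw'
      have h4 := h2 y (f w') v (by
        rw [one_div, inv_mul_eq_div, le_div_iff₀ hδ]; nlinarith)
      rw [f.symm_apply_apply] at h4
      rw [mem_ball, dist_comm]
      have : 0 < T₂ * dist x z := by positivity
      calc dist x w' ≤ T₂ * dist x z := h4
        _ < 2 * (T₂ * dist x z) := by linarith
        _ = _ := by rw [hRz]; ring
    have hRle : R ≤ dist x z := div_le_self hR₀.le (le_max_right _ _)
    refine ((measure_mono hsub).trans (hK.measure_ball_mul_le hc hl (y := x) (by positivity) hR0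
      hRle)).trans ?_
    gcongr
    rw [← ENNReal.ofNNReal_toNNReal, ← ENNReal.coe_mul, ENNReal.coe_le_coe, add_assoc]
    exact le_self_add
  · have h3 := hC₀ x z R hRz.le
    rw [hfx, hfz] at h3
    calc ν (ball y ρ) ≤ K₂ * ENNReal.ofReal (ρ ^ n₂) := hK₂ y ρ hρ
      _ ≤ K₂ * ENNReal.ofReal ((1 / δ * dist y v) ^ n₂) := by
          gcongr
          rw [one_div, inv_mul_eq_div, le_div_iff₀ hδ]; linarith
      _ = K₂ * (ENNReal.ofReal ((1 / δ) ^ n₂) * ENNReal.ofReal (dist y v ^ n₂)) := by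
          rw [Real.mul_rpow (by positivity) (by positivity), ENNReal.ofReal_mul (by positivity)]
      _ ≤ K₂ * (ENNReal.ofReal ((1 / δ) ^ n₂) * (C₀ * ν (f '' ball x R))) := by gcongr
      _ = Cb * ν (f '' ball x R) := by rw [hCb]; push_cast; rw [ENNReal.ofNNReal_toNNReal]; ring
      _ ≤ _ := by
          gcongr
          rw [add_right_comm]
          exact le_add_self

/-- By Chebyshev, w exceeds 1/δ times its mean on at most a proportion δ of B, hence on at most half
of its ν-image by the A_∞ condition. On the remaining half 1/w is bounded below by δ μ(B)/ν(f(B)).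
The comparability constant C transfers this from f(B) to the ball in Y. -/
lemma hasGoodParts_symm_of_setLIntegral_le_half [BorelSpace X] (hμ : BallsFinitePos μ)
    (hw : Measurable w)
    (hwν : ∀ A, MeasurableSet A → ∫⁻ y in A, w y ∂μ = ν (f '' A))
    (hpos : ∀ x ρ, 0 < ρ → 0 < ν (f '' ball x ρ)) (hfin : ∀ x ρ, 0 < ρ → ν (f '' ball x ρ) < ∞)
    (hδ : 0 < δ)
    (h : ∀ (x : X) (ρ : ℝ) (E : Set X), 0 < ρ → MeasurableSet E → E ⊆ ball x ρ →
      μ E ≤ δ * μ (ball x ρ) → ∫⁻ y in E, w y ∂μ ≤ 2⁻¹ * ∫⁻ y in ball x ρ, w y ∂μ)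
    {C : ℝ≥0} (hC : 0 < C)
    (hball : ∀ (y a b : Y) (ρ : ℝ), 0 < ρ → ρ ≤ dist a b →
      ∃ R : ℝ, 0 < R ∧ ball (f.symm y) R ⊆ f ⁻¹' ball y ρ ∧
        μ (f ⁻¹' ball y ρ) ≤ C * μ (ball (f.symm y) R) ∧
        ν (ball y ρ) ≤ C * ν (f '' ball (f.symm y) R)) :
    HasGoodParts ν μ f.symm fun y => (w (f.symm y))⁻¹ := by
  refine ⟨2⁻¹ * C⁻¹, δ * C⁻¹, by positivity, by positivity, fun y a b ρ hρ hab => ?_⟩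
  obtain ⟨R, hR, hsub, hμC, hνC⟩ := hball y a b ρ hρ hab
  set B := ball (f.symm y) R with hB
  obtain ⟨hB0, hBt⟩ := hμ (f.symm y) R hR
  set I := ν (f '' B) with hI
  have hI0 : I ≠ 0 := (hpos _ R hR).ne'
  have hIt : I ≠ ∞ := (hfin _ R hR).ne
  have hIw : ∫⁻ y in B, w y ∂μ = I := hwν B measurableSet_ball
  have hδ0 : (δ : ℝ≥0∞) ≠ 0 := ENNReal.coe_ne_zero.2 hδ.ne'
  have hδt : (δ : ℝ≥0∞) ≠ ∞ := ENNReal.coe_ne_top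
  have hC0 : (C : ℝ≥0∞) ≠ 0 := ENNReal.coe_ne_zero.2 hC.ne'
  have hCt : (C : ℝ≥0∞) ≠ ∞ := ENNReal.coe_ne_top
  set S := {z ∈ B | I < w z * (δ * μ B)} with hS
  have hSm : MeasurableSet S :=
    measurableSet_ball.inter (measurableSet_lt measurable_const (hw.mul_const _))
  have hSB : S ⊆ B := fun z hz => hz.1
  have hSμ : μ S ≤ δ * μ B := by
    have h1 : I * μ S ≤ I * (δ * μ B) := by
      calc I * μ S = ∫⁻ _ in S, I ∂μ := (setLIntegral_const _ _).symm
        _ ≤ ∫⁻ z in S, w z * (δ * μ B) ∂μ :=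
            setLIntegral_mono (hw.mul_const _) fun z hz => hz.2.le
        _ = (∫⁻ z in S, w z ∂μ) * (δ * μ B) := lintegral_mul_const _ hw
        _ ≤ (∫⁻ z in B, w z ∂μ) * (δ * μ B) := by gcongr
        _ = _ := by rw [hIw]
    exact (ENNReal.mul_le_mul_iff_right hI0 hIt).1 h1
  have h2 := h _ R S hR hSm hSB hSμ
  rw [hIw, hwν S hSm] at h2
  have h3 : 2⁻¹ * I ≤ ν (f '' (B \ S)) := by
    have h4 : I ≤ ν (f '' S) + ν (f '' (B \ S)) := by
      rw [hI, ← union_sdiff_cancel hSB, image_union, union_sdiff_cancel hSB]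
      exact measure_union_le _ _
    have h5 : 2⁻¹ * I + 2⁻¹ * I ≤ 2⁻¹ * I + ν (f '' (B \ S)) := by
      rw [← add_mul, ENNReal.inv_two_add_inv_two, one_mul]
      exact h4.trans (add_le_add_left h2 _)
    exact (ENNReal.add_le_add_iff_left (by finiteness)).1 h5
  have hgood : f '' (B \ S) ⊆
      goodPart ν μ f.symm (fun y => (w (f.symm y))⁻¹) (δ * C⁻¹) y ρ := by
    rintro _ ⟨z, ⟨hzB, hzS⟩, rfl⟩
    refine ⟨hsub hzB, ?_⟩
    have h6 : w z * (δ * μ B) ≤ I := not_lt.1 fun hc => hzS ⟨hzB, hc⟩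
    have h7 : I ≤ ν (ball y ρ) := measure_mono (image_subset_iff.2 hsub)
    simp only [f.symm_apply_apply]
    rw [f.symm.image_eq_preimage_symm, f.symm_symm]
    have h8 : w z * (δ * μ B) * (w z)⁻¹ ≤ I * (w z)⁻¹ := by gcongr
    have hwt : w z ≠ ∞ := by
      intro hc
      rw [hc, ENNReal.top_mul (mul_ne_zero hδ0 hB0.ne')] at h6
      exact hIt (top_le_iff.1 h6)
    calc ((δ * C⁻¹ : ℝ≥0) : ℝ≥0∞) * μ (f ⁻¹' ball y ρ)
        ≤ ((δ * C⁻¹ : ℝ≥0) : ℝ≥0∞) * (C * μ B) := by gcongr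
      _ = δ * μ B := by
          rw [ENNReal.coe_mul, ENNReal.coe_inv hC.ne']
          calc _ = δ * μ B * ((C : ℝ≥0∞)⁻¹ * C) := by ring
            _ = _ := by rw [ENNReal.inv_mul_cancel hC0 hCt, mul_one]
      _ ≤ (w z)⁻¹ * I := by
          rcases eq_or_ne (w z) 0 with hw0 | hw0
          · rw [hw0, ENNReal.inv_zero, ENNReal.top_mul hI0]; exact le_top
          · calc (δ : ℝ≥0∞) * μ B = w z * (δ * μ B) * (w z)⁻¹ := by
                  rw [mul_right_comm, ENNReal.mul_inv_cancel hw0 hwt, one_mul]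
              _ ≤ _ := h8.trans (le_of_eq (mul_comm _ _))
      _ ≤ _ := by gcongr
  calc ((2⁻¹ * C⁻¹ : ℝ≥0) : ℝ≥0∞) * ν (ball y ρ)
      ≤ ((2⁻¹ * C⁻¹ : ℝ≥0) : ℝ≥0∞) * (C * I) := by gcongr
    _ = 2⁻¹ * I := by
        rw [ENNReal.coe_mul, ENNReal.coe_inv hC.ne', ENNReal.coe_inv two_ne_zero]
        calc _ = ((2 : ℝ≥0) : ℝ≥0∞)⁻¹ * I * ((C : ℝ≥0∞)⁻¹ * C) := by ring
          _ = _ := by rw [ENNReal.inv_mul_cancel hC0 hCt, mul_one]; rfl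
    _ ≤ _ := h3.trans (measure_mono hgood)

end VolumeDerivative

/-! ### One-point spaces and change of variables -/

section Composition

variable {X Y : Type*} [MetricSpace X] [MetricSpace Y] [MeasurableSpace X] [MeasurableSpace Y]
  {μ : Measure X} {ν : Measure Y} {f : X ≃ₜ Y}

/-- No two points are at positive distance, so the zero sequence is a gradient. -/
lemma hajlaszTLNorm_eq_zero_of_subsingleton [Subsingleton X] {s p : ℝ} (hp : 0 < p) {q : ℝ≥0∞}
    (hq : 0 < q) (u : X → ℝ) : hajlaszTLNorm s p q μ u = 0 := by
  have hg : IsFracHajlaszGradient s μ u 0 := by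
    refine ⟨fun k => aemeasurable_const, ∅, measure_empty, fun k x y _ _ h _ => ?_⟩
    rw [Subsingleton.elim x y, dist_self] at h
    exact absurd h (not_le.2 (by positivity))
  have h0 : mixedNorm p q μ (0 : ℤ → X → ℝ≥0) = 0 := by
    have hell : ellNorm q (fun _ : ℤ => 0) = 0 := by
      unfold ellNorm
      split_ifs with h
      · simp
      · have hq' := ENNReal.toReal_pos hq.ne' h
        simp [ENNReal.zero_rpow_of_pos hq', hq']
    simp [mixedNorm, hell, hp]
  exact le_antisymm (h0 ▸ iInf₂_le 0 hg) zero_le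

lemma comp_mem_MSpace_of_subsingleton [Subsingleton X] {s₁ s₂ p : ℝ} (hp : 0 < p) {q : ℝ≥0∞}
    (hq : 0 < q) {C : ℝ≥0∞} (f : X → Y) (u : Y → ℝ) :
    u ∘ f ∈ MSpace s₁ p q μ ∧
      hajlaszTLNorm s₁ p q μ (u ∘ f) ≤ C * hajlaszTLNorm s₂ p q ν u := by
  simp [MSpace, hajlaszTLNorm_eq_zero_of_subsingleton hp hq, Subsingleton.measurable.aemeasurable]

variable [BorelSpace X] [BorelSpace Y] {w : X → ℝ≥0∞}

lemma changeOfVariablesLE_of_withDensity_eq (hw : Measurable w)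
    (h : μ.withDensity w = ν.map f.symm) : ChangeOfVariablesLE μ ν f w := by
  intro G hG
  have hGf : Measurable (G ∘ f) := hG.comp f.continuous.measurable
  calc ∫⁻ z, w z * G (f z) ∂μ = ∫⁻ z, (G ∘ f) z ∂(μ.withDensity w) :=
        (lintegral_withDensity_eq_lintegral_mul μ hw hGf).symm
    _ = ∫⁻ y, (G ∘ f) (f.symm y) ∂ν := by
        rw [h, lintegral_map hGf f.symm.continuous.measurable]
    _ ≤ _ := by simp

/-- Since w · w⁻¹ ≤ 1 always holds, the inequality needs neither positivity nor finiteness of w. -/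
lemma changeOfVariablesLE_symm_of_withDensity_eq (hw : Measurable w)
    (h : μ.withDensity w = ν.map f.symm) :
    ChangeOfVariablesLE ν μ f.symm fun y => (w (f.symm y))⁻¹ := by
  intro G hG
  have hwG : Measurable fun x => (w x)⁻¹ * G x := hw.inv.mul hG
  calc ∫⁻ y, (w (f.symm y))⁻¹ * G (f.symm y) ∂ν = ∫⁻ x, (w x)⁻¹ * G x ∂(μ.withDensity w) := by
        rw [h, lintegral_map hwG f.symm.continuous.measurable]
    _ = ∫⁻ x, w x * ((w x)⁻¹ * G x) ∂μ := lintegral_withDensity_eq_lintegral_mul μ hw hwG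
    _ ≤ ∫⁻ x, G x ∂μ := by
        refine lintegral_mono fun x => ?_
        rw [← mul_assoc]
        exact mul_le_of_le_one_left zero_le (ENNReal.mul_inv_le_one _)

end Composition

end HajlaszTL

end

theorem corollary5p2 {X Y : Type*}
    [MetricSpace X] [MeasurableSpace X] [BorelSpace X]
    [MetricSpace Y] [MeasurableSpace Y] [BorelSpace Y]
    (μX : Measure X) (μY : Measure Y)
    (hμX : HajlaszTL.BallsFinitePos μX) (hμY : HajlaszTL.BallsFinitePos μY)
    (n₁ n₂ : ℝ) (hn₁ : 0 < n₁) (hn₂ : 0 < n₂)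
    (hX : HajlaszTL.AhlforsRegular n₁ μX) (hY : HajlaszTL.AhlforsRegular n₂ μY)
    (f : X ≃ₜ Y) (hf : HajlaszTL.Quasisymmetric f)
    (hac : HajlaszTL.AbsContMap μX μY f) (hac' : HajlaszTL.AbsContMap μY μX f.symm)
    (r : ℝ≥0∞) (hr : 1 < r)
    (hJ : HajlaszTL.ReverseHolder r μX (HajlaszTL.volDeriv μX μY f))
    (s₁ s₂ : ℝ) (hs₁ : s₁ ∈ Ioo 0 n₁) (hs₂ : s₂ ∈ Ioo 0 n₂) (hs : n₁ / s₁ = n₂ / s₂)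
    (q : ℝ≥0∞) (hq : 0 < q) :
    ∃ C : ℝ≥0,
      (∀ u ∈ HajlaszTL.MSpace s₂ (n₂ / s₂) q μY,
        u ∘ f ∈ HajlaszTL.MSpace s₁ (n₁ / s₁) q μX ∧
        HajlaszTL.hajlaszTLNorm s₁ (n₁ / s₁) q μX (u ∘ f) ≤
          C * HajlaszTL.hajlaszTLNorm s₂ (n₂ / s₂) q μY u) ∧
      (∀ v ∈ HajlaszTL.MSpace s₁ (n₁ / s₁) q μX,
        v ∘ f.symm ∈ HajlaszTL.MSpace s₂ (n₂ / s₂) q μY ∧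
        HajlaszTL.hajlaszTLNorm s₂ (n₂ / s₂) q μY (v ∘ f.symm) ≤
          C * HajlaszTL.hajlaszTLNorm s₁ (n₁ / s₁) q μX v) := by
  have hs₁0 : 0 < s₁ := hs₁.1
  have hp : 1 < n₁ / s₁ := (one_lt_div hs₁0).2 hs₁.2
  have hps₁ : s₁ * (n₁ / s₁) = n₁ := mul_div_cancel₀ _ hs₁0.ne'
  have hps₂ : s₂ * (n₁ / s₁) = n₂ := by rw [hs]; exact mul_div_cancel₀ _ hs₂.1.ne'
  rw [← hs]
  generalize n₁ / s₁ = p at hp hps₁ hps₂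
  have hp0 : 0 < p := one_pos.trans hp
  -- Regularity on a one-point space says nothing, since its diameter is 0, but there all seminorms
  -- vanish.
  rcases subsingleton_or_nontrivial X with hXs | hXn
  · have : Subsingleton Y := f.symm.injective.subsingleton
    exact ⟨0, fun u _ => HajlaszTL.comp_mem_MSpace_of_subsingleton hp0 hq f u,
      fun v _ => HajlaszTL.comp_mem_MSpace_of_subsingleton hp0 hq f.symm v⟩
  have : Nontrivial Y := f.injective.nontrivial
  obtain ⟨⟨K₁, hK₁1, hK₁⟩, c₁, hc₁, hl₁⟩ := hX.exists_upper_lower hn₁ hμX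
  obtain ⟨⟨K₂, hK₂1, hK₂⟩, c₂, hc₂, hl₂⟩ := hY.exists_upper_lower hn₂ hμY
  have := hμX.secondCountableTopology
  have := hμY.secondCountableTopology
  have := hμX.isLocallyFiniteMeasure
  have := hμY.isLocallyFiniteMeasure
  have := hK₁.isUnifLocDoublingMeasure hc₁ hl₁
  have := hK₂.isUnifLocDoublingMeasure hc₂ hl₂
  have hfw := hf.weakQS
  have hpos : ∀ x ρ, 0 < ρ → 0 < μY (f '' ball x ρ) := fun x ρ hρ =>
    hμY.measure_image_ball_pos f x hρ
  have hfin : ∀ x ρ, 0 < ρ → μY (f '' ball x ρ) < ∞ := fun x ρ hρ =>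
    hfw.measure_image_ball_lt_top hμY x hρ
  have : IsLocallyFiniteMeasure (μY.map f.symm) := ⟨fun x => ⟨ball x 1, ball_mem_nhds x one_pos, by
    rw [HajlaszTL.map_symm_apply_eq f μY measurableSet_ball]
    exact hfin x 1 one_pos⟩⟩
  have hll : μY.map f.symm ≪ μX := Measure.AbsolutelyContinuous.mk fun A hA hA0 => by
    rw [HajlaszTL.map_symm_apply_eq f μY hA]
    exact hac A hA0
  obtain ⟨C₀, -, hcomp⟩ := HajlaszTL.exists_volDeriv_comparable (f := f) (ν := μY) hK₁ hc₁ hl₁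
  have hwd := Measure.withDensity_rnDeriv_eq _ _ hll
  have hw := Measure.measurable_rnDeriv (μY.map f.symm) μX
  -- From here on only two facts about the density matter: it is comparable to the volume
  -- derivative, and it integrates to the pulled-back measure.
  generalize (μY.map f.symm).rnDeriv μX = w at hcomp hwd hw
  have hwν : ∀ A, MeasurableSet A → ∫⁻ x in A, w x ∂μX = μY (f '' A) := fun A hA => by
    rw [← HajlaszTL.map_symm_apply_eq f μY hA, ← hwd, withDensity_apply _ hA]
  obtain ⟨δ, hδ, hhalf⟩ := hJ.exists_setLIntegral_le_half hr hμX hw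
    (hcomp.mono fun _ h => h.1) (hcomp.mono fun _ h => h.2)
  obtain ⟨C', hC', hball⟩ :=
    hfw.exists_ball_subset_preimage_ball hK₁ hc₁ hl₁ hn₂ hμY hK₂ hc₂ hl₂
  obtain ⟨C₁, h₁⟩ := hfw.exists_hajlaszTLNorm_comp_le hn₁ hμX hK₁ hK₁1 hc₁ hl₁ hn₂ hc₂ hl₂
    (fun E hE => by rw [← f.image_symm]; exact hac' E hE) hw
    (HajlaszTL.hasGoodParts_of_setLIntegral_le_half hμX hw hwν hpos hfin hδ hhalf)
    (HajlaszTL.changeOfVariablesLE_of_withDensity_eq hw hwd) hp hps₁ hps₂ hq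
  -- The inverse direction runs through the same theorem, with density 1/w∘f⁻¹ and absolute
  -- continuity of f in place of that of f⁻¹.
  obtain ⟨C₂, h₂⟩ := hfw.symm.exists_hajlaszTLNorm_comp_le hn₂ hμY hK₂ hK₂1 hc₂ hl₂ hn₁ hc₁ hl₁
    (fun E hE => by rw [← f.image_eq_preimage_symm]; exact hac E hE)
    (hw.comp f.symm.continuous.measurable).inv
    (HajlaszTL.hasGoodParts_symm_of_setLIntegral_le_half hμX hw hwν hpos hfin hδ hhalf hC' hball)
    (HajlaszTL.changeOfVariablesLE_symm_of_withDensity_eq hw hwd) hp hps₂ hps₁ hq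
  refine ⟨max C₁ C₂, fun u hu => ⟨(h₁ u hu).1, (h₁ u hu).2.trans ?_⟩,
    fun v hv => ⟨(h₂ v hv).1, (h₂ v hv).2.trans ?_⟩⟩
  · gcongr; exact le_max_left _ _
  · gcongr; exact le_max_right _ _
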